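/- Let $\mathscr C$ be the set of convex functions $V:\mathbb R\to\mathbb R$ such that (a) there are $C_0>0$ and $K\ge 1$ with $|V(x)|\le C_0(1+|x|)^K$ for all $x\in\mathbb R$, and (b) $V'_-:=\lim_{x\to-\infty}V(x)/x<V'_+:=\lim_{x\to+\infty}V(x)/x$ (limits in $[-\infty,\infty]$). For $N\ge 2$ let $$\Omega_N=\{(x_0,\dots,x_N)\in\mathbb R^{N+1}: x_0=x_N=0\},\qquad H(x)=\sum_{i=1}^N V(x_i-x_{i-1}),$$ and let $\pi_N$ be the probability measure on $\Omega_N$ with density $e^{-H}/Z_N$ with respect to $dx_1\cdots dx_{N-1}$, where $Z_N=\int e^{-H}\,dx_1\cdots dx_{N-1}$. For $b,c\in\mathbb R$ put $$\rho_{b,c}(u)=\frac{e^{-V(u-b)-V(c-u)}}{\int_{\mathbb R} e^{-V(s-b)-V(c-s)}\,ds},$$ and for $1\le k\le N-1$ let $\mathcal Q_kf(x)=\int_{\mathbb R} f(x^{(k,u)})\,\rho_{x_{k-1},x_{k+1}}(u)\,du$, where $x^{(k,u)}$ is $x$ with its $k$-th coordinate replaced by $u$. For a probability measure $\nu$ on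 $\Omega_N$, let $P_t^\nu$ be the law at time $t$ of the continuous-time Markov chain on $\Omega_N$ with generator $\mathcal L f=\sum_{k=1}^{N-1}(\mathcal Q_kf-f)$ and initial law $\nu$. Let $\|\mu-\mu'\|_{TV}=\sup_B(\mu(B)-\mu'(B))$, the supremum being over Borel subsets $B$ of $\Omega_N$, and $$B(\nu)=\inf\sqrt{\sum_{k=1}^{N-1}\mathbf E\big[|x_k-x'_k|\big]^2}\in[0,\infty],$$ where the infimum is over all couplings $(x,x')$ of $\nu$ and $\pi_N$ (that is, $x\sim\nu$ and $x'\sim\pi_N$) and $\mathbf E$ is the expectation with respect to the coupling. **Proposition.** For every $V\in\mathscr C$ there is a constant $C>0$, depending only on $V$, such that for all $N\ge 2$, all probability measures $\nu$ on $\Omega_N$ and all real $t\ge C\log N$, $$\|P_t^\nu-\pi_N\|_{TV}\le C\Big(N^{1/2}\,B(\nu)\,t^{C}\,e^{-\lambda_Nt}+N\,e^{-t}\Big),\qquad \lambda_N=1-\cos(\pi/N).$$ -/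

import Mathlib

open MeasureTheory Filter Topology
open scoped ENNReal

namespace GradPhi

/-- The class `𝒞` of potentials: convex, of at most polynomial growth, and non-affine in the sense
that the asymptotic slopes `V'₋ = lim_{x → -∞} V x / x` and `V'₊ = lim_{x → +∞} V x / x`
(possibly infinite) satisfy `V'₋ < V'₊`. -/
structure IsPotential (V : ℝ → ℝ) : Prop where
  convex : ConvexOn ℝ Set.univ V
  growth : ∃ C : ℝ, 0 < C ∧ ∃ K : ℝ, 1 ≤ K ∧ ∀ x : ℝ, |V x| ≤ C * (1 + |x|) ^ K
  nonaffine : ∃ a b : EReal,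
    Tendsto (fun x : ℝ => ((V x / x : ℝ) : EReal)) atBot (𝓝 a) ∧
    Tendsto (fun x : ℝ => ((V x / x : ℝ) : EReal)) atTop (𝓝 b) ∧ a < b

theorem IsPotential.measurable {V : ℝ → ℝ} (hV : IsPotential V) : Measurable V :=
  (continuousOn_univ.1 (hV.convex.continuousOn isOpen_univ)).measurable

/-- The state space `Ω_N` of interfaces `(x_0, …, x_N)` with `x_0 = x_N = 0`, with the Borel
σ-algebra it inherits from `ℝ^{N+1}`. -/
abbrev Interface (N : ℕ) : Type :=
  {x : Fin (N + 1) → ℝ // x 0 = 0 ∧ x (Fin.last N) = 0}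

/-- `k : Fin (N - 1)` enumerates the interior sites `1, …, N - 1`; this is the site `k + 1`. -/
def site {N : ℕ} (k : Fin (N - 1)) : Fin (N + 1) := ⟨k.1 + 1, by omega⟩

/-- The left neighbour of `site k`. -/
def left {N : ℕ} (k : Fin (N - 1)) : Fin (N + 1) := ⟨k.1, by omega⟩

/-- The right neighbour of `site k`. -/
def right {N : ℕ} (k : Fin (N - 1)) : Fin (N + 1) := ⟨k.1 + 2, by omega⟩

/-- The interface with prescribed interior heights `x_1, …, x_{N-1}`. -/
def ofHeights {N : ℕ} (y : Fin (N - 1) → ℝ) : Interface N :=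
  ⟨fun i => if h : 0 < i.1 ∧ i.1 < N then y ⟨i.1 - 1, by omega⟩ else 0, by simp⟩

/-- `x^{(k,u)}`: the height at `site k` is replaced by `u`. -/
def setHeight {N : ℕ} (x : Interface N) (k : Fin (N - 1)) (u : ℝ) : Interface N :=
  ⟨Function.update x.1 (site k) u, by
    have h0 : (0 : Fin (N + 1)) ≠ site k := by simp [site, Fin.ext_iff]
    have h1 : Fin.last N ≠ site k := by
      have := k.2
      simp only [site, ne_eq, Fin.ext_iff, Fin.val_last]
      omega
    simp [Function.update_of_ne h0, Function.update_of_ne h1, x.2.1, x.2.2]⟩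

/-- The Hamiltonian `H(x) = ∑_{i=1}^N V(x_i - x_{i-1})`. -/
noncomputable def hamiltonian {N : ℕ} (V : ℝ → ℝ) (x : Interface N) : ℝ :=
  ∑ i : Fin N, V (x.1 i.succ - x.1 i.castSucc)

/-- Lebesgue measure `dx_1 ⋯ dx_{N-1}` on `Ω_N`. -/
noncomputable def lebesgue (N : ℕ) : Measure (Interface N) :=
  (volume : Measure (Fin (N - 1) → ℝ)).map ofHeights

/-- The interface measure `π_N`, with density `e^{-H} / Z_N`. -/
noncomputable def equilibrium (V : ℝ → ℝ) (N : ℕ) : Measure (Interface N) :=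
  (lebesgue N).withDensity fun x =>
    ENNReal.ofReal
      (Real.exp (-hamiltonian V x) / ∫ z, Real.exp (-hamiltonian V z) ∂(lebesgue N))

/-- The conditional equilibrium density `ρ_{b,c}` of a height given the two neighbouring heights
`b` and `c`. -/
noncomputable def rho (V : ℝ → ℝ) (b c u : ℝ) : ℝ :=
  Real.exp (-V (u - b) - V (c - u)) / ∫ s, Real.exp (-V (s - b) - V (c - s))

/-- The law of `x^{(k,U)}`, where `U` has density `ρ_{x_{k-1}, x_{k+1}}`. -/
noncomputable def resampleAt {N : ℕ} (V : ℝ → ℝ) (k : Fin (N - 1)) (x : Interface N) :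
    Measure (Interface N) :=
  ((volume : Measure ℝ).withDensity
    fun u => ENNReal.ofReal (rho V (x.1 (left k)) (x.1 (right k)) u)).map (setHeight x k)

/-- The operator `𝒬_k` acting on functions: `𝒬_k f(x) = ∫ f(x^{(k,u)}) ρ_{x_{k-1},x_{k+1}}(u) du`. -/
noncomputable def resampleFun {N : ℕ} (V : ℝ → ℝ) (k : Fin (N - 1)) (f : Interface N → ℝ)
    (x : Interface N) : ℝ :=
  ∫ u, f (setHeight x k u) * rho V (x.1 (left k)) (x.1 (right k)) u

/-- The generator of the heat-bath dynamics, `ℒ f = ∑_{k=1}^{N-1} (𝒬_k f - f)`. -/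
noncomputable def generator {N : ℕ} (V : ℝ → ℝ) (f : Interface N → ℝ) (x : Interface N) : ℝ :=
  ∑ k : Fin (N - 1), (resampleFun V k f x - f x)

/-- The operator `∑_k 𝒬_k` acting (on the right) on measures: `μ ↦ ∑_k μ 𝒬_k`. -/
noncomputable def resampleSum {N : ℕ} (V : ℝ → ℝ) (μ : Measure (Interface N)) : Measure (Interface N) :=
  ∑ k : Fin (N - 1), μ.bind (resampleAt V k)

/-- The law `P_t^ν` at time `t` of the continuous-time Markov chain with generator
`ℒ = ∑_k 𝒬_k - (N - 1)` and initial law `ν`, that is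
`P_t^ν = ν e^{tℒ} = e^{-(N-1)t} ∑_n (t^n / n!) ν (∑_k 𝒬_k)^n`:
a Poisson number, of mean `(N-1)t`, of resamplings at independent uniformly chosen sites.
`hasDerivWithinAt_integral_lawAt` below is Kolmogorov's equation with the generator `ℒ`. -/
noncomputable def lawAt {N : ℕ} (V : ℝ → ℝ) (ν : Measure (Interface N)) (t : ℝ) :
    Measure (Interface N) :=
  Measure.sum fun n : ℕ =>
    ENNReal.ofReal (Real.exp (-(((N - 1 : ℕ) : ℝ) * t)) * (t ^ n / n.factorial)) •
      (resampleSum V)^[n] ν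

/-- The total variation distance `sup_B (μ(B) - ν(B))` over Borel sets `B`. Truncated subtraction
does not change the supremum, because `B = ∅` already gives `0`. -/
noncomputable def tvDist {N : ℕ} (μ ν : Measure (Interface N)) : ℝ≥0∞ :=
  ⨆ (B : Set (Interface N)) (_ : MeasurableSet B), (μ B - ν B)

/-- The quantity `B(ν)`: the infimum over all couplings `(x, x')` of `ν` and `π_N` of
`√(∑_{k=1}^{N-1} 𝐄[|x_k - x'_k|]²)`, with values in `[0, ∞]`. -/
noncomputable def couplingCost {N : ℕ} (V : ℝ → ℝ) (ν : Measure (Interface N)) : ℝ≥0∞ :=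
  ⨅ (γ : Measure (Interface N × Interface N))
    (_ : γ.map Prod.fst = ν ∧ γ.map Prod.snd = equilibrium V N),
    (∑ k : Fin (N - 1),
      (∫⁻ p, ENNReal.ofReal |p.1.1 (site k) - p.2.1 (site k)| ∂γ) ^ 2) ^ (1 / 2 : ℝ)

/-- `λ_N = 1 - cos(π / N)`. -/
noncomputable def gapValue (N : ℕ) : ℝ := 1 - Real.cos (Real.pi / N)

theorem measurable_ofHeights {N : ℕ} : Measurable (ofHeights (N := N)) := by
  refine Measurable.subtype_mk (measurable_pi_iff.2 fun i => ?_)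
  by_cases h : 0 < i.1 ∧ i.1 < N
  · simpa only [h, and_self, dite_true] using measurable_pi_apply _
  · simp only [h, dite_false, measurable_const]

theorem measurable_setHeight {N : ℕ} (k : Fin (N - 1)) :
    Measurable fun p : Interface N × ℝ => setHeight p.1 k p.2 := by
  refine Measurable.subtype_mk (measurable_pi_iff.2 fun i => ?_)
  by_cases h : i = site k
  · subst h
    simpa using measurable_snd
  · simp only [Function.update_of_ne h]
    exact (measurable_pi_apply i).comp (measurable_subtype_coe.comp measurable_fst)

theorem measurable_rho {V : ℝ → ℝ} (hV : Measurable V) :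
    Measurable fun p : (ℝ × ℝ) × ℝ => rho V p.1.1 p.1.2 p.2 := by
  have h : Measurable fun p : (ℝ × ℝ) × ℝ =>
      Real.exp (-V (p.2 - p.1.1) - V (p.1.2 - p.2)) := by fun_prop
  have h2 : StronglyMeasurable fun q : ℝ × ℝ =>
      ∫ s, Real.exp (-V (s - q.1) - V (q.2 - s)) :=
    h.stronglyMeasurable.integral_prod_right
  exact h.div (h2.measurable.comp measurable_fst)

theorem rho_nonneg (V : ℝ → ℝ) (b c u : ℝ) : 0 ≤ rho V b c u :=
  div_nonneg (Real.exp_pos _).le (integral_nonneg fun _ => (Real.exp_pos _).le)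

theorem lintegral_rho_le_one (V : ℝ → ℝ) (b c : ℝ) :
    ∫⁻ u, ENNReal.ofReal (rho V b c u) ≤ 1 := by
  by_cases h : Integrable fun s => Real.exp (-V (s - b) - V (c - s))
  · have hi : Integrable fun u => rho V b c u := h.div_const _
    rw [← ofReal_integral_eq_lintegral_ofReal hi
      (Eventually.of_forall fun u => rho_nonneg V b c u)]
    simp only [rho, integral_div]
    exact ENNReal.ofReal_le_one.2 (div_self_le_one _)
  · simp [rho, integral_undef h]

theorem measurable_rho_heights {N : ℕ} {V : ℝ → ℝ} (hV : Measurable V) (k : Fin (N - 1)) :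
    Measurable fun p : Interface N × ℝ => rho V (p.1.1 (left k)) (p.1.1 (right k)) p.2 := by
  have h : ∀ i : Fin (N + 1), Measurable fun p : Interface N × ℝ => p.1.1 i := fun i =>
    (measurable_pi_apply i).comp (measurable_subtype_coe.comp measurable_fst)
  exact (measurable_rho hV).comp
    (f := fun p : Interface N × ℝ => ((p.1.1 (left k), p.1.1 (right k)), p.2))
    (((h _).prodMk (h _)).prodMk measurable_snd)

theorem measurable_resampleAt {N : ℕ} {V : ℝ → ℝ} (hV : Measurable V) (k : Fin (N - 1)) :
    Measurable (resampleAt V k) := by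
  have hs := measurable_setHeight k
  refine Measure.measurable_of_measurable_coe _ fun s h => ?_
  have : ∀ x, resampleAt V k x s = ∫⁻ u, (Set.indicator
      {p : Interface N × ℝ | setHeight p.1 k p.2 ∈ s}
      (fun p => ENNReal.ofReal (rho V (p.1.1 (left k)) (p.1.1 (right k)) p.2))) (x, u) := by
    intro x
    have hx : Measurable (setHeight x k) := hs.comp measurable_prodMk_left
    rw [resampleAt, Measure.map_apply hx h, withDensity_apply _ (hx h),
      ← lintegral_indicator (hx h)]
    rfl
  simp only [this]
  exact ((measurable_rho_heights hV k).ennreal_ofReal.indicator (hs h)).lintegral_prod_right'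

theorem resampleAt_univ_le {N : ℕ} (V : ℝ → ℝ) (k : Fin (N - 1)) (x : Interface N) :
    resampleAt V k x Set.univ ≤ 1 := by
  have hx : Measurable (setHeight x k) := (measurable_setHeight k).comp measurable_prodMk_left
  rw [resampleAt, Measure.map_apply hx .univ,
    Set.preimage_univ, withDensity_apply _ .univ, setLIntegral_univ]
  exact lintegral_rho_le_one V _ _

theorem integral_resampleAt {N : ℕ} {V : ℝ → ℝ} (hV : Measurable V) (k : Fin (N - 1))
    {f : Interface N → ℝ} (hf : Measurable f) (x : Interface N) :
    ∫ z, f z ∂(resampleAt V k x) = resampleFun V k f x := by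
  have hx : Measurable (setHeight x k) := (measurable_setHeight k).comp measurable_prodMk_left
  have hr : Measurable fun u => rho V (x.1 (left k)) (x.1 (right k)) u :=
    (measurable_rho_heights hV k).comp (measurable_prodMk_left (x := x))
  rw [resampleAt, integral_map hx.aemeasurable hf.aestronglyMeasurable,
    integral_withDensity_eq_integral_toReal_smul₀ hr.ennreal_ofReal.aemeasurable
      (Eventually.of_forall fun _ => ENNReal.ofReal_lt_top)]
  simp only [resampleFun, smul_eq_mul, ENNReal.toReal_ofReal (rho_nonneg _ _ _ _), mul_comm]

theorem abs_resampleFun_le {N : ℕ} {V : ℝ → ℝ} (hV : Measurable V) (k : Fin (N - 1))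
    {f : Interface N → ℝ} (hf : Measurable f) {M : ℝ} (hM : ∀ x, |f x| ≤ M) (x : Interface N) :
    |resampleFun V k f x| ≤ M := by
  have hM0 : 0 ≤ M := (abs_nonneg _).trans (hM x)
  rw [← integral_resampleAt hV k hf]
  have h1 := resampleAt_univ_le V k x
  have : IsFiniteMeasure (resampleAt V k x) := ⟨h1.trans_lt ENNReal.one_lt_top⟩
  have hM' : ∀ x, ‖f x‖ ≤ M := hM
  refine (norm_integral_le_of_norm_le_const (C := M) (Eventually.of_forall hM')).trans ?_
  have : (resampleAt V k x).real Set.univ ≤ 1 := ENNReal.toReal_le_of_le_ofReal zero_le_one (by simpa)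
  nlinarith

theorem resampleSum_univ_le {N : ℕ} {V : ℝ → ℝ} (hV : Measurable V) (μ : Measure (Interface N)) :
    resampleSum V μ Set.univ ≤ (N - 1 : ℕ) * μ Set.univ := by
  rw [resampleSum, Measure.finsetSum_apply]
  calc ∑ k : Fin (N - 1), μ.bind (resampleAt V k) Set.univ
      ≤ ∑ _k : Fin (N - 1), μ Set.univ := by
        refine Finset.sum_le_sum fun k _ => ?_
        rw [Measure.bind_apply .univ (measurable_resampleAt hV k).aemeasurable]
        exact (lintegral_mono (resampleAt_univ_le V k)).trans (by simp)
    _ = _ := by simp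

theorem iterate_univ_le {N : ℕ} {V : ℝ → ℝ} (hV : Measurable V) (ν : Measure (Interface N))
    (n : ℕ) : (resampleSum V)^[n] ν Set.univ ≤ (N - 1 : ℕ) ^ n * ν Set.univ := by
  induction n with
  | zero => simp
  | succ n ih =>
    rw [Function.iterate_succ_apply', pow_succ', mul_assoc]
    exact (resampleSum_univ_le hV _).trans (by gcongr)

theorem integral_resampleSum {N : ℕ} {V : ℝ → ℝ} (hV : Measurable V)
    (μ : Measure (Interface N)) [IsFiniteMeasure μ] {f : Interface N → ℝ} (hf : Measurable f)
    {M : ℝ} (hM : ∀ x, |f x| ≤ M) :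
    ∫ z, f z ∂(resampleSum V μ) = ∫ x, ∑ k, resampleFun V k f x ∂μ := by
  have hm : ∀ k : Fin (N - 1), Measurable (resampleFun V k f) := fun k => by
    have h1 := measurable_rho_heights hV k
    have h2 := hf.comp (measurable_setHeight k)
    exact ((h2.mul h1).stronglyMeasurable.integral_prod_right).measurable
  have key : ∀ k : Fin (N - 1), Integrable f (μ.bind (resampleAt V k)) ∧
      ∫ z, f z ∂(μ.bind (resampleAt V k)) = ∫ x, resampleFun V k f x ∂μ := by
    intro k
    let κ : ProbabilityTheory.Kernel (Interface N) (Interface N) :=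
      ⟨resampleAt V k, measurable_resampleAt hV k⟩
    have : ProbabilityTheory.IsFiniteKernel κ := ⟨⟨1, by simp, resampleAt_univ_le V k⟩⟩
    have hi : Integrable f ((κ.comp (ProbabilityTheory.Kernel.const Unit μ)) ()) :=
      Integrable.of_bound hf.aestronglyMeasurable M (Eventually.of_forall hM)
    have h := ProbabilityTheory.Kernel.integral_comp hi
    rw [← Measure.comp_eq_comp_const_apply] at h hi
    refine ⟨hi, h.trans ?_⟩
    simp only [ProbabilityTheory.Kernel.const_apply]
    exact integral_congr_ae (Eventually.of_forall fun x => integral_resampleAt hV k hf x)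
  rw [resampleSum, integral_finsetSum_measure fun k _ => (key k).1, integral_finsetSum]
  · exact Finset.sum_congr rfl fun k _ => (key k).2
  · intro k _
    exact Integrable.of_bound (hm k).aestronglyMeasurable M
      (Eventually.of_forall (abs_resampleFun_le hV k hf hM))

theorem hasDerivAt_expSeries {a : ℕ → ℝ} {A R : ℝ} (ha : ∀ n, |a n| ≤ A * R ^ n)
    (_hR : 0 ≤ R) (t : ℝ) :
    HasDerivAt (fun s : ℝ => ∑' n : ℕ, s ^ n / n.factorial * a n)
      (∑' n : ℕ, t ^ n / n.factorial * a (n + 1)) t := by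
  have hA : 0 ≤ A := by simpa using (abs_nonneg _).trans (ha 0)
  set r := |t| + 1
  have hr : 0 ≤ r := by positivity
  have hsum : Summable fun n : ℕ => (r * R) ^ n / n.factorial * (A * R) :=
    (Real.summable_pow_div_factorial _).mul_right _
  have key : ∀ n : ℕ, ∀ y ∈ Metric.ball (0 : ℝ) r,
      ‖y ^ n / n.factorial * a (n + 1)‖ ≤ (r * R) ^ n / n.factorial * (A * R) := by
    intro n y hy
    have hy' : |y| ≤ r := by simpa using (Metric.mem_ball.1 hy).le
    rw [Real.norm_eq_abs, abs_mul, abs_div, abs_pow, Nat.abs_cast]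
    calc |y| ^ n / n.factorial * |a (n + 1)|
        ≤ r ^ n / n.factorial * (A * R ^ (n + 1)) := by gcongr; exact ha _
      _ = _ := by rw [mul_pow]; ring
  have h1 := hasDerivAt_tsum_of_isPreconnected
    (g := fun n y => y ^ (n + 1) / (n + 1).factorial * a (n + 1))
    (g' := fun n y => y ^ n / n.factorial * a (n + 1)) (y := t) (y₀ := 0) hsum
    Metric.isOpen_ball (convex_ball (0 : ℝ) r).isPreconnected
    (fun n y _ => by
      have := ((hasDerivAt_pow (n + 1) y).div_const ((n + 1).factorial : ℝ)).mul_const (a (n + 1))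
      refine this.congr_deriv ?_
      have h3 : (n.factorial : ℝ) ≠ 0 := by positivity
      have h4 : (n : ℝ) + 1 ≠ 0 := by positivity
      rw [Nat.factorial_succ]
      push_cast
      field_simp) key (by simp [r]; positivity) (by simp) (by simp [r])
  have h2 : ∀ s : ℝ, ∑' n : ℕ, s ^ n / n.factorial * a n =
      a 0 + ∑' n : ℕ, s ^ (n + 1) / (n + 1).factorial * a (n + 1) := by
    intro s
    have : Summable fun n : ℕ => s ^ n / n.factorial * a n := by
      refine Summable.of_norm_bounded
        (g := fun n : ℕ => (|s| * R) ^ n / n.factorial * A)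
        ((Real.summable_pow_div_factorial _).mul_right _) fun n => ?_
      rw [Real.norm_eq_abs, abs_mul, abs_div, abs_pow, Nat.abs_cast]
      calc |s| ^ n / n.factorial * |a n| ≤ |s| ^ n / n.factorial * (A * R ^ n) := by
            gcongr; exact ha _
        _ = _ := by rw [mul_pow]; ring
    rw [this.tsum_eq_zero_add]
    simp
  simp only [h2]
  exact h1.const_add _

/-- Kolmogorov's equation: `d/dt P_t^ν(f) = P_t^ν(ℒ f)` for bounded measurable `f`. -/
theorem hasDerivWithinAt_integral_lawAt {N : ℕ} {V : ℝ → ℝ} (hV : Measurable V)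
    (ν : Measure (Interface N)) [IsFiniteMeasure ν] {f : Interface N → ℝ} (hf : Measurable f)
    {M : ℝ} (hM : ∀ x, |f x| ≤ M) {t : ℝ} (ht : 0 ≤ t) :
    HasDerivWithinAt (fun s => ∫ x, f x ∂(lawAt V ν s)) (∫ x, generator V f x ∂(lawAt V ν t))
      (Set.Ici 0) t := by
  set R : ℝ := ((N - 1 : ℕ) : ℝ)
  set m : ℕ → Measure (Interface N) := fun n => (resampleSum V)^[n] ν
  have hfin : ∀ n, IsFiniteMeasure (m n) := fun n =>
    ⟨(iterate_univ_le hV ν n).trans_lt (by finiteness)⟩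
  have hmass : ∀ n, (m n).real Set.univ ≤ R ^ n * ν.real Set.univ := fun n => by
    have := ENNReal.toReal_mono (by finiteness) (iterate_univ_le hV ν n)
    rwa [ENNReal.toReal_mul, ENNReal.toReal_pow, ENNReal.toReal_natCast] at this
  have hbd : ∀ {g : Interface N → ℝ} {L : ℝ}, (∀ x, |g x| ≤ L) →
      ∀ n, |∫ x, g x ∂(m n)| ≤ (|L| * ν.real Set.univ) * R ^ n := by
    intro g L hL n
    have hL' : ∀ x, ‖g x‖ ≤ |L| := fun x => (hL x).trans (le_abs_self _)
    refine (norm_integral_le_of_norm_le_const (C := |L|) (Eventually.of_forall hL')).trans ?_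
    calc |L| * (m n).real Set.univ ≤ |L| * (R ^ n * ν.real Set.univ) := by gcongr; exact hmass n
      _ = _ := by ring
  have hexp : ∀ {g : Interface N → ℝ} {L : ℝ}, Measurable g → (∀ x, |g x| ≤ L) → ∀ s, 0 ≤ s →
      ∫ x, g x ∂(lawAt V ν s) =
        Real.exp (-(R * s)) * ∑' n : ℕ, s ^ n / n.factorial * ∫ x, g x ∂(m n) := by
    intro g L hg hL s hs
    have hfin' : IsFiniteMeasure (lawAt V ν s) := by
      constructor
      rw [lawAt, Measure.sum_apply _ .univ]
      have hsm : Summable fun n : ℕ => Real.exp (-(R * s)) * (s ^ n / n.factorial) *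
          (R ^ n * ν.real Set.univ) := by
        have := ((Real.summable_pow_div_factorial (s * R)).mul_left
          (Real.exp (-(R * s)))).mul_right (ν.real Set.univ)
        refine this.congr fun n => ?_
        rw [mul_pow]; ring
      refine lt_of_le_of_lt (ENNReal.tsum_le_tsum fun n => ?_) hsm.tsum_ofReal_lt_top
      rw [Measure.smul_apply, smul_eq_mul,
        ENNReal.ofReal_mul (q := R ^ n * ν.real Set.univ) (by positivity)]
      refine mul_le_mul_right ?_ _
      rw [← ofReal_measureReal (μ := m n) (h := measure_ne_top (m n) _)]
      exact ENNReal.ofReal_le_ofReal (hmass n)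
    have hi : Integrable g (lawAt V ν s) :=
      Integrable.of_bound hg.aestronglyMeasurable L (Eventually.of_forall hL)
    rw [lawAt] at hi ⊢
    rw [integral_sum_measure hi, ← tsum_mul_left]
    refine tsum_congr fun n => ?_
    rw [integral_smul_measure, ENNReal.toReal_ofReal (by positivity), smul_eq_mul, mul_assoc]
  have hrm : ∀ k : Fin (N - 1), Measurable (resampleFun V k f) := fun k =>
    (((hf.comp (measurable_setHeight k)).mul
      (measurable_rho_heights hV k)).stronglyMeasurable.integral_prod_right).measurable
  have hgm : Measurable (generator V f) :=
    Finset.measurable_sum _ fun k _ => (hrm k).sub hf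
  have hgb : ∀ x, |generator V f x| ≤ ∑ _k : Fin (N - 1), (M + M) := fun x =>
    (Finset.abs_sum_le_sum_abs _ _).trans (Finset.sum_le_sum fun k _ =>
      (abs_sub _ _).trans (add_le_add (abs_resampleFun_le hV k hf hM x) (hM x)))
  have hstep : ∀ n, ∫ x, generator V f x ∂(m n) = ∫ x, f x ∂(m (n + 1)) - R * ∫ x, f x ∂(m n) := by
    intro n
    have hi : ∀ k : Fin (N - 1), Integrable (resampleFun V k f) (m n) := fun k =>
      Integrable.of_bound (hrm k).aestronglyMeasurable M
        (Eventually.of_forall (abs_resampleFun_le hV k hf hM))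
    have hif : Integrable f (m n) :=
      Integrable.of_bound hf.aestronglyMeasurable M (Eventually.of_forall hM)
    have h1 : m (n + 1) = resampleSum V (m n) := Function.iterate_succ_apply' _ _ _
    rw [h1, integral_resampleSum hV (m n) hf hM]
    simp only [generator, Finset.sum_sub_distrib, Finset.sum_const, Finset.card_univ,
      Fintype.card_fin, nsmul_eq_mul]
    rw [integral_sub (integrable_finsetSum _ fun k _ => hi k) (hif.const_mul _),
      integral_const_mul]
  have hR : 0 ≤ R := Nat.cast_nonneg _
  have hd := hasDerivAt_expSeries (hbd hM) hR t
  have he : HasDerivAt (fun s : ℝ => Real.exp (-(R * s))) (Real.exp (-(R * t)) * (-R)) t := by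
    simpa using (((hasDerivAt_id t).const_mul R).neg).exp
  have hs0 : Summable fun n : ℕ => t ^ n / n.factorial * ∫ x, f x ∂(m n) := by
    refine Summable.of_norm_bounded
      (g := fun n : ℕ => (|t| * R) ^ n / n.factorial * (|M| * ν.real Set.univ))
      ((Real.summable_pow_div_factorial _).mul_right _) fun n => ?_
    rw [Real.norm_eq_abs, abs_mul, abs_div, abs_pow, Nat.abs_cast]
    calc |t| ^ n / n.factorial * |∫ x, f x ∂(m n)|
        ≤ |t| ^ n / n.factorial * ((|M| * ν.real Set.univ) * R ^ n) := by
          gcongr; exact hbd hM _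
      _ = _ := by rw [mul_pow]; ring
  have hs1 : Summable fun n : ℕ => t ^ n / n.factorial * ∫ x, f x ∂(m (n + 1)) := by
    refine Summable.of_norm_bounded
      (g := fun n : ℕ => (|t| * R) ^ n / n.factorial * (|M| * ν.real Set.univ * R))
      ((Real.summable_pow_div_factorial _).mul_right _) fun n => ?_
    rw [Real.norm_eq_abs, abs_mul, abs_div, abs_pow, Nat.abs_cast]
    calc |t| ^ n / n.factorial * |∫ x, f x ∂(m (n + 1))|
        ≤ |t| ^ n / n.factorial * ((|M| * ν.real Set.univ) * R ^ (n + 1)) := by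
          gcongr; exact hbd hM _
      _ = _ := by rw [mul_pow]; ring
  refine (((he.mul hd).hasDerivWithinAt (s := Set.Ici 0)).congr_deriv ?_).congr
    (fun s hs => hexp hf hM s hs) (hexp hf hM t ht)
  rw [hexp hgm hgb t ht]
  simp only [hstep, mul_sub]
  rw [hs1.tsum_sub (by simpa [mul_left_comm] using hs0.mul_left R)]
  simp only [mul_left_comm _ R, tsum_mul_left]
  ring

theorem lawAt_zero {N : ℕ} (V : ℝ → ℝ) (ν : Measure (Interface N)) : lawAt V ν 0 = ν := by
  ext s hs
  rw [lawAt, Measure.sum_apply _ hs, tsum_eq_single 0]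
  · simp
  · intro n hn
    simp [hn]

end GradPhi

/-! The chain performs a Poisson number of resamplings along a random word of sites. Fix the word,
couple `ν` with `equilibrium`, and run both copies along the word. At a visit that is not the last
one to its site, the two heights are drawn by the monotone (quantile) coupling. Convexity of V
orders the conditional laws and symmetry puts their means at (b + c)/2, so the expected discrepancy
at the site becomes at most the average of those at its neighbours. At the last visit to a site the
two heights are matched as well as possible in total variation, and failure costs a Lipschitz
constant times the neighbouring discrepancies. If every site is visited and no last visit fails, the
copies coincide at the end. The argument is run on test functions (`wordOp_le`), so no coupled
process has to be built.

The failure probability is linear in the initial discrepancies, with weights given by a backward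
recursion along the word. Summed over all words of length n, the weights obey a linear recursion
with matrix N - 2 plus the killed walk, and the walk has ℓ² norm at most cos(π/N), by Schur's test
with the eigenvector sin(πj/N) (`sqrt_sum_sq_totalWeight_le`). Cauchy–Schwarz pairs the weights with
the coupling cost, and averaging over the Poisson length gives t e^{-λ_N t}. Words that miss some
site contribute at most (N - 1) e^{-t}.

The Lipschitz constant grows polynomially with the distance between the two neighbours of the site
in the equilibrium copy (`IsConfining.exists_lintegral_rho_sub_le`). By invariance that copy stays
in equilibrium, where two-step increments have exponential tails uniformly in N
(`IsConfining.exists_equilibrium_tail`). Taking the threshold R of order t, large increments cost a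
multiple of N e^{-t} and the Lipschitz constant becomes a power of t.

For the uniform tails, the law of one increment is log-concave, so a uniform bound on its second
moment M is enough. Take two increments a, b. Negative correlation gives E(a + b)² ≤ 2M,
conditioning on the sum gives E(a - b)² ≤ E(a + b)²/2 + C, and the two left sides add up to 4M;
hence M ≤ C (`IsConfining.exists_second_moment_le`). -/

namespace GradPhi

/-! ### Reduction to a confining potential -/

/-- Convex potentials of polynomial growth which grow at least linearly in both directions. -/
structure IsConfining (V : ℝ → ℝ) : Prop where
  convex : ConvexOn ℝ Set.univ V
  growth : ∃ C : ℝ, 1 ≤ C ∧ ∃ K : ℕ, ∀ x : ℝ, |V x| ≤ C * (1 + |x|) ^ K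
  lower : ∃ a b : ℝ, 0 < a ∧ ∀ x : ℝ, a * |x| - b ≤ V x

theorem IsConfining.continuous {V : ℝ → ℝ} (hV : IsConfining V) : Continuous V :=
  continuousOn_univ.1 (hV.convex.continuousOn isOpen_univ)

theorem IsConfining.measurable {V : ℝ → ℝ} (hV : IsConfining V) : Measurable V :=
  hV.continuous.measurable

/-- A linear term in the potential can be subtracted so that the result is confining. -/
theorem IsPotential.exists_tilt {V : ℝ → ℝ} (hV : IsPotential V) :
    ∃ θ : ℝ, IsConfining fun x => V x - θ * x := by
  have hc : Continuous V := continuousOn_univ.1 (hV.convex.continuousOn isOpen_univ)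
  obtain ⟨A, B, hA, hB, hAB⟩ := hV.nonaffine
  obtain ⟨r₁, h1, h2⟩ := EReal.exists_between_coe_real hAB
  obtain ⟨r₂, h3, h4⟩ := EReal.exists_between_coe_real h2
  have h3' : r₁ < r₂ := by exact_mod_cast h3
  have e1 : ∀ᶠ x in atBot, V x / x < r₁ := by
    filter_upwards [hA.eventually_lt_const h1] with x hx
    exact_mod_cast hx
  have e2 : ∀ᶠ x in atTop, r₂ < V x / x := by
    filter_upwards [hB.eventually_const_lt h4] with x hx
    exact_mod_cast hx
  obtain ⟨M₁, hM₁⟩ := eventually_atBot.1 e1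
  obtain ⟨M₂, hM₂⟩ := eventually_atTop.1 e2
  set M : ℝ := max (max (-M₁) M₂) 1 with hM
  have hM1 : 1 ≤ M := le_max_right _ _
  obtain ⟨b, hb⟩ := (isCompact_Icc (a := -M) (b := M)).bddBelow_image hc.continuousOn
  -- Since r₁ < r₂ lie strictly between the asymptotic slopes, tilting by the midpoint leaves growth
  -- of rate at least (r₂ - r₁)/2 at both ends; compactness covers the middle.
  refine ⟨(r₁ + r₂) / 2, ?_, ?_, ?_⟩
  · refine hV.convex.sub ?_
    exact (LinearMap.mul ℝ ℝ ((r₁ + r₂) / 2)).concaveOn convex_univ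
  · obtain ⟨C, hC, K, hK, h⟩ := hV.growth
    refine ⟨C + |(r₁ + r₂) / 2| + 1, by linarith [abs_nonneg ((r₁ + r₂) / 2)], ⌈K⌉₊ + 1,
      fun x => ?_⟩
    have hx1 : 1 ≤ 1 + |x| := by linarith [abs_nonneg x]
    have i1 : (1 + |x|) ^ K ≤ (1 + |x|) ^ (⌈K⌉₊ + 1) := by
      rw [← Real.rpow_natCast]
      refine Real.rpow_le_rpow_of_exponent_le hx1 ?_
      push_cast
      linarith [Nat.le_ceil K]
    have i2 : |x| ≤ (1 + |x|) ^ (⌈K⌉₊ + 1) :=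
      calc |x| ≤ 1 + |x| := by linarith
        _ = (1 + |x|) ^ 1 := (pow_one _).symm
        _ ≤ _ := pow_le_pow_right₀ hx1 (by omega)
    have i3 : 0 ≤ (1 + |x|) ^ (⌈K⌉₊ + 1) := by positivity
    calc |V x - (r₁ + r₂) / 2 * x| ≤ |V x| + |(r₁ + r₂) / 2 * x| := abs_sub _ _
      _ ≤ C * (1 + |x|) ^ K + |(r₁ + r₂) / 2| * |x| := by rw [abs_mul]; gcongr; exact h x
      _ ≤ C * (1 + |x|) ^ (⌈K⌉₊ + 1) + |(r₁ + r₂) / 2| * (1 + |x|) ^ (⌈K⌉₊ + 1) := by gcongr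
      _ ≤ _ := by nlinarith
  · set a := (r₂ - r₁) / 2 with ha
    have ha0 : 0 < a := by rw [ha]; linarith
    refine ⟨a, |b| + (|(r₁ + r₂) / 2| + a) * M, ha0, fun x => ?_⟩
    have hpos : 0 ≤ |b| + |(r₁ + r₂) / 2| * M + a * M := by positivity
    rcases le_or_gt x (-M) with hx | hx
    · have hx0 : x < 0 := by linarith
      have := hM₁ x (by linarith [le_max_left (-M₁) M₂, le_max_left (max (-M₁) M₂) 1])
      rw [div_lt_iff_of_neg hx0] at this
      rw [abs_of_neg hx0]
      nlinarith
    rcases le_or_gt M x with hx' | hx'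
    · have hx0 : 0 < x := by linarith
      have := hM₂ x (by linarith [le_max_right (-M₁) M₂, le_max_left (max (-M₁) M₂) 1])
      rw [lt_div_iff₀ hx0] at this
      rw [abs_of_pos hx0]
      nlinarith
    · have i1 : b ≤ V x := hb ⟨x, ⟨hx.le, hx'.le⟩, rfl⟩
      have i2 : |x| ≤ M := abs_le.2 ⟨hx.le, hx'.le⟩
      have i3 : (r₁ + r₂) / 2 * x ≤ |(r₁ + r₂) / 2| * M :=
        (le_abs_self _).trans (by rw [abs_mul]; gcongr)
      have i4 := neg_abs_le b
      nlinarith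

/-- The tilt contributes θ(u - b) + θ(c - u) = θ(c - b), which is independent of u and cancels
against the normalization. -/
theorem rho_tilt (V : ℝ → ℝ) (θ b c u : ℝ) : rho (fun x => V x - θ * x) b c u = rho V b c u := by
  have h : ∀ s, Real.exp (-(V (s - b) - θ * (s - b)) - (V (c - s) - θ * (c - s))) =
      Real.exp (θ * (c - b)) * Real.exp (-V (s - b) - V (c - s)) := fun s => by
    rw [← Real.exp_add]; congr 1; ring
  simp only [rho, h, integral_const_mul]
  exact mul_div_mul_left _ _ (Real.exp_pos _).ne'

/-- The increments telescope to zero because both ends are pinned. With `rho_tilt`, this makes the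
dynamics, the equilibrium and the coupling cost blind to the tilt. -/
theorem hamiltonian_tilt {N : ℕ} (V : ℝ → ℝ) (θ : ℝ) (x : Interface N) :
    hamiltonian (fun x => V x - θ * x) x = hamiltonian V x := by
  have h : ∑ i : Fin N, (x.1 i.succ - x.1 i.castSucc) = 0 := by
    rw [Finset.sum_sub_distrib]
    have h1 := Fin.sum_univ_succ x.1
    have h2 := Fin.sum_univ_castSucc x.1
    rw [x.2.1] at h1
    rw [x.2.2] at h2
    linarith
  simp only [hamiltonian, Finset.sum_sub_distrib, ← Finset.mul_sum] at h ⊢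
  rw [h]
  simp

theorem equilibrium_tilt (V : ℝ → ℝ) (θ : ℝ) (N : ℕ) :
    equilibrium (fun x => V x - θ * x) N = equilibrium V N := by
  simp only [equilibrium, hamiltonian_tilt]

theorem lawAt_tilt {N : ℕ} (V : ℝ → ℝ) (θ : ℝ) (ν : Measure (Interface N)) (t : ℝ) :
    lawAt (fun x => V x - θ * x) ν t = lawAt V ν t := by
  have : resampleSum (N := N) (fun x => V x - θ * x) = resampleSum V := by
    funext μ
    simp only [resampleSum]
    refine Finset.sum_congr rfl fun k _ => ?_
    congr 1
    funext x
    simp only [resampleAt, rho_tilt]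
  simp only [lawAt, this]

theorem couplingCost_tilt {N : ℕ} (V : ℝ → ℝ) (θ : ℝ) (ν : Measure (Interface N)) :
    couplingCost (fun x => V x - θ * x) ν = couplingCost V ν := by
  simp only [couplingCost, equilibrium_tilt]

/-! ### Log-concavity and exponential tails -/

/-- Four-point form of log-concavity. -/
def FourPoint (g : ℝ → ℝ≥0∞) : Prop :=
  ∀ v w h : ℝ, v ≤ w → 0 ≤ h → g v * g (w + h) ≤ g (v + h) * g w

theorem FourPoint.mul {f g : ℝ → ℝ≥0∞} (hf : FourPoint f) (hg : FourPoint g) :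
    FourPoint fun x => f x * g x := fun v w h hvw hh => by
  calc f v * g v * (f (w + h) * g (w + h)) = f v * f (w + h) * (g v * g (w + h)) := by ring
    _ ≤ f (v + h) * f w * (g (v + h) * g w) := mul_le_mul' (hf v w h hvw hh) (hg v w h hvw hh)
    _ = _ := by ring

theorem FourPoint.comp_neg {g : ℝ → ℝ≥0∞} (hg : FourPoint g) : FourPoint fun x => g (-x) :=
  fun v w h hvw hh => by
    have := hg (-w - h) (-v - h) h (by linarith) hh
    rw [mul_comm, mul_comm (g (-(v + h)))]
    convert this using 3 <;> ring

/-- The points `v + h` and `w` are convex combinations of `v` and `w + h` with swapped weights; add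
the two convexity inequalities. The case `v = w + h`, where the weights degenerate, is treated
apart. -/
theorem fourPoint_exp_neg {V : ℝ → ℝ} (hV : ConvexOn ℝ Set.univ V) :
    FourPoint fun x => ENNReal.ofReal (Real.exp (-V x)) := fun v w h hvw hh => by
  rw [← ENNReal.ofReal_mul (Real.exp_pos _).le, ← ENNReal.ofReal_mul (Real.exp_pos _).le,
    ← Real.exp_add, ← Real.exp_add]
  refine ENNReal.ofReal_le_ofReal (Real.exp_le_exp.2 ?_)
  rcases eq_or_lt_of_le (by linarith : v ≤ w + h) with h0 | h0
  · have : h = 0 := by linarith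
    subst this
    simp
  have hd : 0 < w + h - v := by linarith
  have h1 := hV.2 (Set.mem_univ v) (Set.mem_univ (w + h)) 
    (show 0 ≤ (w - v) / (w + h - v) from div_nonneg (by linarith) hd.le)
    (show 0 ≤ h / (w + h - v) from div_nonneg hh hd.le)
    (by rw [← add_div]; exact (div_eq_one_iff_eq hd.ne').2 (by ring))
  have h2 := hV.2 (Set.mem_univ v) (Set.mem_univ (w + h)) 
    (show 0 ≤ h / (w + h - v) from div_nonneg hh hd.le)
    (show 0 ≤ (w - v) / (w + h - v) from div_nonneg (by linarith) hd.le)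
    (by rw [← add_div]; exact (div_eq_one_iff_eq hd.ne').2 (by ring))
  have e1 : (w - v) / (w + h - v) + h / (w + h - v) = 1 := by
    rw [← add_div]; exact (div_eq_one_iff_eq hd.ne').2 (by ring)
  simp only [smul_eq_mul] at h1 h2
  have e2 : (w - v) / (w + h - v) * v + h / (w + h - v) * (w + h) = v + h := by
    field_simp; ring
  have e3 : h / (w + h - v) * v + (w - v) / (w + h - v) * (w + h) = w := by
    field_simp; ring
  rw [e2] at h1
  rw [e3] at h2
  have e4 : h / (w + h - v) = 1 - (w - v) / (w + h - v) := by linarith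
  rw [e4] at h1 h2
  linarith

/-- This is (b - a)(d - c) ≥ 0, arranged so that nothing is subtracted. -/
theorem ENNReal.mul_add_mul_le_mul_add_mul {a b c d : ℝ≥0∞} (hab : a ≤ b) (hcd : c ≤ d) :
    a * d + b * c ≤ a * c + b * d := by
  obtain ⟨e, rfl⟩ := exists_add_of_le hab
  obtain ⟨k, rfl⟩ := exists_add_of_le hcd
  ring_nf
  exact le_self_add

/-- Convolutions of log-concave functions are log-concave: the composition formula for totally
positive kernels of order two. -/
theorem FourPoint.conv {f g : ℝ → ℝ≥0∞} (hf : FourPoint f) (hg : FourPoint g)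
    (hfm : Measurable f) (hgm : Measurable g) :
    FourPoint fun x => ∫⁻ z, g z * f (x - z) := fun v w h hvw hh => by
  set x₁ := v + h
  set x₂ := w + h
  have hx : x₁ ≤ x₂ := by simp only [x₁, x₂]; linarith
  have ev : v = x₁ - h := by simp [x₁]
  have ew : w = x₂ - h := by simp [x₂]
  have shift : ∀ x, ∫⁻ z, g z * f (x - h - z) = ∫⁻ z, g (z - h) * f (x - z) := fun x => by
    rw [← lintegral_sub_right_eq_self (fun z => g z * f (x - h - z)) h]
    congr 1; ext z; congr 2; ring
  have e1 : ∀ (p q : ℝ → ℝ≥0∞), Measurable p → Measurable q →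
      (∫⁻ z, p z) * ∫⁻ z, q z = ∫⁻ z, ∫⁻ z', p z * q z' := fun p q hp hq => by
    rw [← lintegral_mul_const _ hp]
    congr 1; ext z
    rw [lintegral_const_mul _ hq]
  simp only []
  rw [ev, ew, shift, shift]
  have m1 : ∀ x y, Measurable fun z => g (z - y) * f (x - z) := fun x y => by fun_prop
  have m0 : ∀ x, Measurable fun z => g z * f (x - z) := fun x => by fun_prop
  -- Doubling and symmetrizing in (z, z') reduces the claim to the pointwise inequality (α - β)(γ -
  -- δ) ≥ 0 in the notation below; the two factors change sign together when z and z' are exchanged.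
  have key : ∀ p q : ℝ → ℝ≥0∞, Measurable p → Measurable q →
      2 * ((∫⁻ z, p z) * ∫⁻ z, q z) = ∫⁻ z, ∫⁻ z', (p z * q z' + p z' * q z) := by
    intro p q hp hq
    have : ∀ z, ∫⁻ z', (p z * q z' + p z' * q z) =
        (∫⁻ z', p z * q z') + ∫⁻ z', p z' * q z := fun z => by
      rw [lintegral_add_left (by fun_prop)]
    simp only [this]
    rw [lintegral_add_left (by
      exact (Measurable.lintegral_prod_right' (f := fun r : ℝ × ℝ => p r.1 * q r.2)
        (by fun_prop))), ← e1 p q hp hq]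
    have : ∫⁻ z, ∫⁻ z', p z' * q z = (∫⁻ z, p z) * ∫⁻ z, q z := by
      rw [mul_comm, e1 q p hq hp]
      simp only [mul_comm]
    rw [this, two_mul]
  have two : (2 : ℝ≥0∞) ≠ 0 := two_ne_zero
  have twot : (2 : ℝ≥0∞) ≠ ⊤ := ENNReal.ofNat_ne_top
  rw [← ENNReal.mul_le_mul_iff_right two twot, key _ _ (m1 _ _) (m0 _), key _ _ (m0 _) (m1 _ _)]
  refine lintegral_mono fun z => lintegral_mono fun z' => ?_
  set α := f (x₁ - z) * f (x₂ - z')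
  set β := f (x₁ - z') * f (x₂ - z)
  set γ := g z * g (z' - h)
  set δ := g z' * g (z - h)
  have l : g (z - h) * f (x₁ - z) * (g z' * f (x₂ - z')) +
      g (z' - h) * f (x₁ - z') * (g z * f (x₂ - z)) = α * δ + β * γ := by
    simp only [α, β, γ, δ]; ring
  have r : g z * f (x₁ - z) * (g (z' - h) * f (x₂ - z')) +
      g z' * f (x₁ - z') * (g (z - h) * f (x₂ - z)) = α * γ + β * δ := by
    simp only [α, β, γ, δ]; ring
  simp only [l, r]
  rcases le_total z z' with hz | hz
  · have hβα : β ≤ α := by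
      have := hf (x₁ - z') (x₂ - z') (z' - z) (by linarith) (by linarith)
      convert this using 3 <;> ring
    have hδγ : δ ≤ γ := by
      have := hg (z - h) (z' - h) h (by linarith) hh
      simp only [sub_add_cancel] at this
      simpa only [γ, δ, mul_comm] using this
    have := ENNReal.mul_add_mul_le_mul_add_mul hβα hδγ
    calc α * δ + β * γ = β * γ + α * δ := add_comm _ _
      _ ≤ β * δ + α * γ := this
      _ = _ := add_comm _ _
  · have hβα : α ≤ β := by
      have := hf (x₁ - z) (x₂ - z) (z - z') (by linarith) (by linarith)
      convert this using 3 <;> ring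
    have hδγ : γ ≤ δ := by
      have := hg (z' - h) (z - h) h (by linarith) hh
      simp only [sub_add_cancel] at this
      simpa only [γ, δ, mul_comm] using this
    exact ENNReal.mul_add_mul_le_mul_add_mul hβα hδγ

/-- The survival function of a log-concave density decays at a nondecreasing rate. -/
theorem FourPoint.lintegral_Ioi_mul_le {g : ℝ → ℝ≥0∞} (hg : FourPoint g) (hgm : Measurable g)
    {u v h : ℝ} (huv : u ≤ v) (hh : 0 ≤ h) :
    (∫⁻ x in Set.Ioi (v + h), g x) * ∫⁻ x in Set.Ioi u, g x ≤
      (∫⁻ x in Set.Ioi (u + h), g x) * ∫⁻ x in Set.Ioi v, g x := by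
  have shift : ∀ s t : ℝ, ∫⁻ x in Set.Ioc (s + h) (t + h), g x =
      ∫⁻ x in Set.Ioc s t, g (x + h) := fun s t => by
    rw [← lintegral_indicator measurableSet_Ioc, ← lintegral_indicator measurableSet_Ioc,
      ← lintegral_add_right_eq_self _ h]
    congr 1; ext x
    simp [Set.indicator]
  have shift' : ∀ s : ℝ, ∫⁻ x in Set.Ioi (s + h), g x = ∫⁻ x in Set.Ioi s, g (x + h) := fun s => by
    rw [← lintegral_indicator measurableSet_Ioi, ← lintegral_indicator measurableSet_Ioi,
      ← lintegral_add_right_eq_self _ h]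
    congr 1; ext x
    simp [Set.indicator]
  have split : ∀ s t : ℝ, s ≤ t → ∫⁻ x in Set.Ioi s, g x =
      (∫⁻ x in Set.Ioc s t, g x) + ∫⁻ x in Set.Ioi t, g x := fun s t hst => by
    rw [← Set.Ioc_union_Ioi_eq_Ioi hst, lintegral_union measurableSet_Ioi]
    exact Set.disjoint_left.2 fun x hx hx' => (not_lt.2 hx.2) hx'
  -- The product of the tails beyond v and v + h occurs on both sides. What remains pairs x ∈ (u, v]
  -- with y > v, and for such ordered pairs the four-point inequality holds pointwise.
  rw [split u v huv, split (u + h) (v + h) (by linarith), mul_add, add_mul, mul_comm, add_comm,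
    add_comm (_ * _) (_ * _)]
  refine add_le_add ?_ le_rfl
  rw [shift, shift', ← lintegral_mul_const _ (by fun_prop), ← lintegral_mul_const _ (by fun_prop)]
  refine setLIntegral_mono' measurableSet_Ioc fun x hx => ?_
  rw [← lintegral_const_mul _ (by fun_prop), ← lintegral_const_mul _ (by fun_prop)]
  refine setLIntegral_mono' measurableSet_Ioi fun y hy => ?_
  exact hg x y h (hx.2.trans (le_of_lt hy)) hh

/-- Exponential tails of a log-concave density of total mass `T` that puts little mass
outside `[-A, A]`. -/
theorem FourPoint.lintegral_Ioi_le_exp {g : ℝ → ℝ≥0∞} (hg : FourPoint g) (hgm : Measurable g)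
    {A : ℝ} (hA : 0 ≤ A) {T : ℝ≥0∞} (hT : ∫⁻ x, g x = T) (hTt : T ≠ ⊤)
    (hout : ∫⁻ x in {x | A ≤ |x|}, g x ≤ T / 4) (j : ℕ) :
    ∫⁻ x in Set.Ioi (A + 2 * A * j), g x ≤ ENNReal.ofReal (Real.exp (-j)) * T := by
  rcases eq_or_ne T 0 with rfl | hT0
  · refine (setLIntegral_le_lintegral _ _).trans ?_
    rw [hT]; exact zero_le
  have hq0 : T / 4 ≠ 0 := ENNReal.div_ne_zero.2 ⟨hT0, ENNReal.ofNat_ne_top⟩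
  have hqt : T / 4 ≠ ⊤ := ENNReal.div_ne_top hTt (by norm_num)
  have hq4 : T = 3 * (T / 4) + T / 4 := by
    calc T = 4 * (T / 4) := (ENNReal.mul_div_cancel (by norm_num) ENNReal.ofNat_ne_top).symm
      _ = (3 + 1) * (T / 4) := by norm_num
      _ = _ := by rw [add_mul, one_mul]
  have hup : ∫⁻ x in Set.Ioi A, g x ≤ T / 4 := by
    refine le_trans (lintegral_mono_set fun x hx => ?_) hout
    exact (le_of_lt hx).trans (le_abs_self x)
  have hlow : 3 * (T / 4) ≤ ∫⁻ x in Set.Ioi (-A), g x := by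
    have h1 : T ≤ (∫⁻ x in Set.Ioi (-A), g x) + T / 4 := by
      have h0 := lintegral_add_compl (μ := volume) g (measurableSet_Ioi (a := -A))
      rw [hT] at h0
      nth_rw 1 [← h0]
      refine add_le_add le_rfl (le_trans (lintegral_mono_set fun x hx => ?_) hout)
      have : x ≤ -A := not_lt.1 hx
      exact (by linarith : A ≤ -x).trans (neg_le_abs x)
    nth_rw 1 [hq4] at h1
    exact (ENNReal.add_le_add_iff_right hqt).1 h1
  -- The tails beyond -A and A are at least 3T/4 and at most T/4, so one step of length 2A costs a
  -- factor 3. Log-concavity of the survival function carries this factor to every later step, and 3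
  -- > e.
  have step : ∀ x, -A ≤ x → 3 * ∫⁻ y in Set.Ioi (x + 2 * A), g y ≤ ∫⁻ y in Set.Ioi x, g y := by
    intro x hx
    have h1 := hg.lintegral_Ioi_mul_le hgm hx (by linarith : 0 ≤ 2 * A)
    have e : -A + 2 * A = A := by ring
    rw [e] at h1
    have h2 : (3 * ∫⁻ y in Set.Ioi (x + 2 * A), g y) * (T / 4) ≤
        (∫⁻ y in Set.Ioi x, g y) * (T / 4) :=
      calc (3 * ∫⁻ y in Set.Ioi (x + 2 * A), g y) * (T / 4)
          = (∫⁻ y in Set.Ioi (x + 2 * A), g y) * (3 * (T / 4)) := by ring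
        _ ≤ (∫⁻ y in Set.Ioi (x + 2 * A), g y) * ∫⁻ y in Set.Ioi (-A), g y := by gcongr
        _ ≤ _ := h1
        _ ≤ (T / 4) * ∫⁻ y in Set.Ioi x, g y := by gcongr
        _ = _ := mul_comm _ _
    exact (ENNReal.mul_le_mul_iff_left hq0 hqt).1 h2
  induction j with
  | zero => simpa [hT] using (setLIntegral_le_lintegral (μ := volume) (Set.Ioi A) g)
  | succ j ih =>
    have h1 := step (A + 2 * A * j) (by nlinarith [(Nat.cast_nonneg j : (0 : ℝ) ≤ j)])
    have e : A + 2 * A * j + 2 * A = A + 2 * A * ((j + 1 : ℕ) : ℝ) := by push_cast; ring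
    rw [e] at h1
    have h3 : (1 : ℝ≥0∞) ≤ ENNReal.ofReal (Real.exp (-1)) * 3 := by
      rw [← ENNReal.ofReal_ofNat 3, ← ENNReal.ofReal_mul (Real.exp_pos _).le,
        ENNReal.one_le_ofReal, Real.exp_neg, inv_mul_eq_div, le_div_iff₀ (Real.exp_pos _)]
      linarith [Real.exp_one_lt_d9]
    calc ∫⁻ y in Set.Ioi (A + 2 * A * ((j + 1 : ℕ) : ℝ)), g y
        ≤ (ENNReal.ofReal (Real.exp (-1)) * 3) *
            ∫⁻ y in Set.Ioi (A + 2 * A * ((j + 1 : ℕ) : ℝ)), g y := le_mul_of_one_le_left' h3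
      _ = ENNReal.ofReal (Real.exp (-1)) *
          (3 * ∫⁻ y in Set.Ioi (A + 2 * A * ((j + 1 : ℕ) : ℝ)), g y) := mul_assoc _ _ _
      _ ≤ ENNReal.ofReal (Real.exp (-1)) * (ENNReal.ofReal (Real.exp (-j)) * T) := by
          exact mul_le_mul_right (h1.trans ih) _
      _ = _ := by
          rw [← mul_assoc, ← ENNReal.ofReal_mul (Real.exp_pos _).le, ← Real.exp_add]
          congr 3; push_cast; ring

/-- Two-sided version of `FourPoint.lintegral_Ioi_le_exp`. -/
theorem FourPoint.lintegral_abs_le_exp {g : ℝ → ℝ≥0∞} (hg : FourPoint g) (hgm : Measurable g)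
    {A : ℝ} (hA : 0 ≤ A) {T : ℝ≥0∞} (hT : ∫⁻ x, g x = T) (hTt : T ≠ ⊤)
    (hout : ∫⁻ x in {x | A ≤ |x|}, g x ≤ T / 4) (j : ℕ) :
    ∫⁻ x in {x | A + 2 * A * j < |x|}, g x ≤ ENNReal.ofReal (2 * Real.exp (-j)) * T := by
  have hneg : ∀ s : Set ℝ, MeasurableSet s → ∫⁻ x in s, g (-x) = ∫⁻ x in {x | -x ∈ s}, g x := by
    intro s hs
    have hs' : MeasurableSet {x | -x ∈ s} := hs.preimage measurable_neg
    rw [← lintegral_indicator hs, ← lintegral_indicator hs', ← lintegral_neg_eq_self]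
    congr 1; ext x
    simp [Set.indicator]
  have h1 := hg.lintegral_Ioi_le_exp hgm hA hT hTt hout j
  have h2 := hg.comp_neg.lintegral_Ioi_le_exp (hgm.comp measurable_neg) hA
    (by rw [lintegral_neg_eq_self, hT]) hTt
    (by
      have hm : MeasurableSet {x : ℝ | A ≤ |x|} := measurableSet_le measurable_const measurable_norm
      rw [hneg _ hm]
      simpa using hout) j
  rw [hneg _ measurableSet_Ioi] at h2
  calc ∫⁻ x in {x | A + 2 * A * j < |x|}, g x
      ≤ ∫⁻ x in Set.Ioi (A + 2 * A * j) ∪ {x | -x ∈ Set.Ioi (A + 2 * A * j)}, g x :=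
        lintegral_mono_set fun x hx => by
          have hx' : A + 2 * A * j < |x| := hx
          exact lt_abs.1 hx'
    _ ≤ _ := lintegral_union_le _ _ _
    _ ≤ _ := add_le_add h1 h2
    _ = _ := by
      rw [ENNReal.ofReal_mul (by norm_num), ENNReal.ofReal_ofNat, mul_assoc, two_mul]

/-! ### Second moments by comparison with a plateau profile -/

theorem integrable_pow_mul_exp_neg_abs (n : ℕ) {κ : ℝ} (hκ : 0 < κ) :
    Integrable fun x : ℝ => |x| ^ n * Real.exp (-(κ * |x|)) := by
  have h : IntegrableOn (fun x : ℝ => |x| ^ n * Real.exp (-(κ * |x|))) (Set.Ioi 0) := by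
    have := integrableOn_rpow_mul_exp_neg_mul_rpow (p := 1) (s := n) (b := κ)
      (by have := (Nat.cast_nonneg n : (0 : ℝ) ≤ n); linarith) one_pos hκ
    refine this.congr_fun (fun x hx => ?_) measurableSet_Ioi
    have hx0 : (0 : ℝ) < x := hx
    simp [abs_of_pos hx0]
  rw [← integrableOn_univ, ← Set.Iic_union_Ioi (a := (0 : ℝ)), integrableOn_union]
  refine ⟨?_, h⟩
  rw [integrableOn_Iic_iff_integrableOn_Iio]
  have h2 := h.comp_neg
  simpa using h2

theorem integrable_one_add_pow_mul_exp_neg_abs (n : ℕ) {κ : ℝ} (hκ : 0 < κ) :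
    Integrable fun x : ℝ => (1 + |x|) ^ n * Real.exp (-(κ * |x|)) := by
  have h := ((integrable_pow_mul_exp_neg_abs 0 hκ).add
    (integrable_pow_mul_exp_neg_abs n hκ)).const_mul (2 ^ (n - 1))
  refine h.mono' (by fun_prop) (Eventually.of_forall fun x => ?_)
  rw [Real.norm_eq_abs, abs_of_nonneg (by positivity)]
  have := add_pow_le (zero_le_one' ℝ) (abs_nonneg x) n
  calc (1 + |x|) ^ n * Real.exp (-(κ * |x|))
      ≤ (2 ^ (n - 1) * (1 ^ n + |x| ^ n)) * Real.exp (-(κ * |x|)) := by gcongr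
    _ = _ := by simp; ring

theorem integrable_exp_neg_abs {κ : ℝ} (hκ : 0 < κ) :
    Integrable fun x : ℝ => Real.exp (-(κ * |x|)) := by
  simpa using integrable_pow_mul_exp_neg_abs 0 hκ

theorem integral_Ioi_pow_mul_exp (n : ℕ) {κ : ℝ} (hκ : 0 < κ) :
    ∫ x in Set.Ioi (0 : ℝ), x ^ n * Real.exp (-(κ * x)) = n.factorial / κ ^ (n + 1) := by
  have := Real.integral_rpow_mul_exp_neg_mul_Ioi (a := n + 1) (r := κ) (by positivity) hκ
  rw [Real.Gamma_nat_eq_factorial] at this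
  have e : (1 / κ : ℝ) ^ ((n : ℝ) + 1) = 1 / κ ^ (n + 1) := by
    have : ((n : ℝ) + 1) = ((n + 1 : ℕ) : ℝ) := by push_cast; ring
    rw [this, Real.rpow_natCast, div_pow, one_pow]
  rw [e] at this
  rw [← mul_one_div, mul_comm, ← this]
  refine setIntegral_congr_fun measurableSet_Ioi fun x _ => ?_
  simp

theorem integrableOn_Ioi_pow_mul_exp (n : ℕ) {κ : ℝ} (hκ : 0 < κ) :
    IntegrableOn (fun x : ℝ => x ^ n * Real.exp (-(κ * x))) (Set.Ioi 0) :=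
  (integrable_pow_mul_exp_neg_abs n hκ).integrableOn.congr_fun (fun x hx => by
    have hx0 : (0 : ℝ) < x := hx
    simp [abs_of_pos hx0]) measurableSet_Ioi

/-- The profile that is constant on `[-T, T]` and decays exponentially outside. -/
noncomputable def plateau (T κ v : ℝ) : ℝ := Real.exp (-(κ * max (|v| - T) 0))

theorem plateau_pos (T κ v : ℝ) : 0 < plateau T κ v := Real.exp_pos _

theorem plateau_le {T κ : ℝ} (hκ : 0 < κ) (v : ℝ) :
    plateau T κ v ≤ Real.exp (κ * T) * Real.exp (-(κ * |v|)) := by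
  rw [plateau, ← Real.exp_add]
  refine Real.exp_le_exp.2 ?_
  nlinarith [le_max_left (|v| - T) 0]

theorem integrable_pow_mul_plateau (n : ℕ) {T κ : ℝ} (hκ : 0 < κ) :
    Integrable fun v => v ^ n * plateau T κ v := by
  have h := (integrable_pow_mul_exp_neg_abs n hκ).const_mul (Real.exp (κ * T))
  refine h.mono' (by unfold plateau; fun_prop) (Eventually.of_forall fun x => ?_)
  rw [norm_mul, norm_pow, Real.norm_eq_abs, Real.norm_eq_abs, abs_of_pos (plateau_pos _ _ _)]
  calc |x| ^ n * plateau T κ x ≤ |x| ^ n * (Real.exp (κ * T) * Real.exp (-(κ * |x|))) := by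
        gcongr; exact plateau_le hκ x
    _ = _ := by ring

theorem integral_Ioi_plateau {T κ : ℝ} (hT : 0 ≤ T) (hκ : 0 < κ) (p q : ℝ) :
    ∫ v in Set.Ioi (0 : ℝ), (p * v ^ 2 + q) * plateau T κ v =
      p * (T ^ 3 / 3 + T ^ 2 / κ + 2 * T / κ ^ 2 + 2 / κ ^ 3) + q * (T + 1 / κ) := by
  have hint : Integrable fun v => (p * v ^ 2 + q) * plateau T κ v := by
    have := ((integrable_pow_mul_plateau 2 (T := T) hκ).const_mul p).add
      ((integrable_pow_mul_plateau 0 (T := T) hκ).const_mul q)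
    refine this.congr (Eventually.of_forall fun v => ?_)
    simp; ring
  rw [← Set.Ioc_union_Ioi_eq_Ioi hT, setIntegral_union (Set.Ioc_disjoint_Ioi le_rfl)
    measurableSet_Ioi hint.integrableOn hint.integrableOn]
  have h1 : ∫ v in Set.Ioc 0 T, (p * v ^ 2 + q) * plateau T κ v = p * (T ^ 3 / 3) + q * T := by
    rw [setIntegral_congr_fun (g := fun v => p * v ^ 2 + q) measurableSet_Ioc (fun v hv => by
      simp [plateau, abs_of_pos hv.1, hv.2]), ← intervalIntegral.integral_of_le hT]
    rw [intervalIntegral.integral_add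
      (Continuous.intervalIntegrable (by fun_prop) _ _)
      (Continuous.intervalIntegrable (by fun_prop) _ _),
      intervalIntegral.integral_const_mul, integral_pow]
    simp
    ring
  have h2 : ∫ v in Set.Ioi T, (p * v ^ 2 + q) * plateau T κ v =
      p * (T ^ 2 / κ + 2 * T / κ ^ 2 + 2 / κ ^ 3) + q * (1 / κ) := by
    have e : ∫ v in Set.Ioi T, (p * v ^ 2 + q) * plateau T κ v =
        ∫ v in Set.Ioi (0 : ℝ), (p * (v + T) ^ 2 + q) * Real.exp (-(κ * v)) := by
      rw [← integral_indicator measurableSet_Ioi, ← integral_indicator measurableSet_Ioi,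
        ← integral_add_right_eq_self _ T]
      congr 1; ext v
      by_cases hv : 0 < v
      · have : 0 < v + T := by linarith
        simp [Set.indicator, hv, plateau, abs_of_pos this, max_eq_left hv.le]
      · simp [Set.indicator, hv]
    rw [e]
    have i : ∀ n, IntegrableOn (fun x : ℝ => x ^ n * Real.exp (-(κ * x))) (Set.Ioi 0) :=
      fun n => integrableOn_Ioi_pow_mul_exp n hκ
    have e2 : ∀ v : ℝ, (p * (v + T) ^ 2 + q) * Real.exp (-(κ * v)) =
        p * (v ^ 2 * Real.exp (-(κ * v))) + 2 * p * T * (v ^ 1 * Real.exp (-(κ * v))) +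
          (p * T ^ 2 + q) * (v ^ 0 * Real.exp (-(κ * v))) := fun v => by ring
    simp only [e2]
    have i12 : IntegrableOn (fun v : ℝ => p * (v ^ 2 * Real.exp (-(κ * v))) +
        2 * p * T * (v ^ 1 * Real.exp (-(κ * v)))) (Set.Ioi 0) :=
      ((i 2).const_mul _).add ((i 1).const_mul _)
    rw [integral_add i12 ((i 0).const_mul _),
      integral_add ((i 2).const_mul _) ((i 1).const_mul _)]
    simp only [integral_const_mul, integral_Ioi_pow_mul_exp _ hκ]
    simp [Nat.factorial]
    field_simp
    ring
  rw [h1, h2]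
  ring

/-- Second moment of an even function which is nonincreasing on `[0, ∞)` and decays exponentially
beyond `T`. -/
theorem integral_sq_mul_le {h : ℝ → ℝ} {T κ : ℝ} (hT : 0 ≤ T) (hκ : 0 < κ)
    (h0 : ∀ v, 0 ≤ h v) (heven : ∀ v, h v = h |v|)
    (hanti : ∀ v w, 0 ≤ v → v ≤ w → h w ≤ h v)
    (hdecay : ∀ v w, T ≤ v → v ≤ w → h w ≤ h v * Real.exp (-(κ * (w - v))))
    (hi0 : Integrable h) (hi2 : Integrable fun v => v ^ 2 * h v) :
    ∫ v, v ^ 2 * h v ≤ (T ^ 2 / 3 + T / κ + 2 / κ ^ 2) * ∫ v, h v := by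
  -- B is an upper bound for the second moment of the normalized plateau profile; the excess
  -- computed in `hpl` below is T²/(3κ) + T/κ².
  set B := T ^ 2 / 3 + T / κ + 2 / κ ^ 2 with hB
  have hB0 : 0 ≤ B := by positivity
  set c := h (√B) / plateau T κ (√B) with hc
  have hc0 : 0 ≤ c := div_nonneg (h0 _) (plateau_pos _ _ _).le
  -- The quotient of h by the plateau is nonincreasing on [0, ∞) and equals c at √B. So h - c ·
  -- plateau and v² - B have opposite signs, and integrating their product compares the second
  -- moments.
  have ratio : ∀ v w, 0 ≤ v → v ≤ w → h w * plateau T κ v ≤ h v * plateau T κ w := by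
    intro v w hv hvw
    have hw := hv.trans hvw
    simp only [plateau, abs_of_nonneg hv, abs_of_nonneg hw]
    rcases le_total T v with hTv | hTv
    · rw [max_eq_left (by linarith), max_eq_left (by linarith)]
      calc _ ≤ (h v * Real.exp (-(κ * (w - v)))) * Real.exp (-(κ * (v - T))) := by
            gcongr; exact hdecay v w hTv hvw
        _ = _ := by rw [mul_assoc, ← Real.exp_add]; congr 2; ring
    · rcases le_total T w with hTw | hTw
      · rw [max_eq_right (by linarith), max_eq_left (by linarith)]
        calc _ = h w := by simp
          _ ≤ h T * Real.exp (-(κ * (w - T))) := hdecay T w le_rfl hTw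
          _ ≤ _ := by gcongr; exact hanti v T hv hTv
      · rw [max_eq_right (by linarith), max_eq_right (by linarith)]
        simpa using hanti v w hv hvw
  have hsq : √B ^ 2 = B := Real.sq_sqrt hB0
  have pt : ∀ v, (v ^ 2 - B) * h v ≤ c * ((v ^ 2 - B) * plateau T κ v) := by
    intro v
    have hpl : plateau T κ v = plateau T κ |v| := by simp [plateau]
    rw [heven v, hpl, ← sq_abs, hc]
    have hp := plateau_pos T κ √B
    rw [div_mul_eq_mul_div, le_div_iff₀ hp]
    rcases le_total |v| √B with hv | hv
    · have h1 := ratio |v| √B (abs_nonneg v) hv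
      have h2 : |v| ^ 2 ≤ B := by rw [← hsq]; gcongr
      nlinarith
    · have h1 := ratio √B |v| (Real.sqrt_nonneg _) hv
      have h2 : B ≤ |v| ^ 2 := by rw [← hsq]; gcongr
      nlinarith
  have hpint : Integrable fun v => (v ^ 2 - B) * plateau T κ v := by
    have := (integrable_pow_mul_plateau 2 (T := T) hκ).sub
      ((integrable_pow_mul_plateau 0 (T := T) hκ).const_mul B)
    refine this.congr (Eventually.of_forall fun v => ?_)
    simp; ring
  have hhint : Integrable fun v => (v ^ 2 - B) * h v := by
    refine (hi2.sub (hi0.const_mul B)).congr (Eventually.of_forall fun v => ?_)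
    simp; ring
  have hpl : ∫ v, (v ^ 2 - B) * plateau T κ v ≤ 0 := by
    have e : ∀ v, (v ^ 2 - B) * plateau T κ v =
        (fun w => (1 * w ^ 2 + (-B)) * plateau T κ w) |v| := fun v => by
      simp [plateau]; ring
    simp only [e]
    rw [integral_comp_abs (f := fun w => (1 * w ^ 2 + (-B)) * plateau T κ w),
      integral_Ioi_plateau hT hκ]
    have : 1 * (T ^ 3 / 3 + T ^ 2 / κ + 2 * T / κ ^ 2 + 2 / κ ^ 3) + -B * (T + 1 / κ) =
        -(T ^ 2 / (3 * κ) + T / κ ^ 2) := by rw [hB]; field_simp; ring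
    rw [this]
    have : 0 ≤ T ^ 2 / (3 * κ) + T / κ ^ 2 := by positivity
    linarith
  have := integral_mono hhint (hpint.const_mul c) pt
  rw [integral_const_mul] at this
  have h3 : ∫ v, (v ^ 2 - B) * h v = (∫ v, v ^ 2 * h v) - B * ∫ v, h v := by
    rw [← integral_const_mul, ← integral_sub hi2 (hi0.const_mul B)]
    congr 1; ext v; ring
  nlinarith

/-! ### Convolution powers of the increment weight -/

/-- The `(n + 1)`-fold convolution power of `e^{-V}`. -/
noncomputable def convPow (V : ℝ → ℝ) : ℕ → ℝ → ℝ
  | 0, x => Real.exp (-V x)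
  | n + 1, x => ∫ u, Real.exp (-V u) * convPow V n (x - u)

section convPow

variable {V : ℝ → ℝ}

theorem IsConfining.exp_neg_le (hV : IsConfining V) :
    ∃ a B : ℝ, 0 < a ∧ 0 < B ∧ ∀ x, Real.exp (-V x) ≤ B * Real.exp (-(a * |x|)) := by
  obtain ⟨a, b, ha, h⟩ := hV.lower
  refine ⟨a, Real.exp b, ha, Real.exp_pos _, fun x => ?_⟩
  rw [← Real.exp_add]
  exact Real.exp_le_exp.2 (by linarith [h x])

theorem measurable_convPow (hV : Measurable V) (n : ℕ) : Measurable (convPow V n) := by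
  induction n with
  | zero => exact (hV.neg).exp
  | succ n ih =>
    have : Measurable fun p : ℝ × ℝ => Real.exp (-V p.2) * convPow V n (p.1 - p.2) := by fun_prop
    exact (this.stronglyMeasurable.integral_prod_right).measurable

theorem convPow_nonneg (V : ℝ → ℝ) (n : ℕ) (x : ℝ) : 0 ≤ convPow V n x := by
  induction n generalizing x with
  | zero => exact (Real.exp_pos _).le
  | succ n ih => exact integral_nonneg fun u => mul_nonneg (Real.exp_pos _).le (ih _)

/-- All convolution powers decay at a common exponential rate. -/
theorem IsConfining.convPow_le (hV : IsConfining V) :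
    ∃ a : ℝ, 0 < a ∧ ∀ n, ∃ B : ℝ, 0 < B ∧ ∀ x, convPow V n x ≤ B * Real.exp (-(a * |x|)) := by
  obtain ⟨a, B, ha, hB, h⟩ := hV.exp_neg_le
  refine ⟨a / 2, by positivity, fun n => ?_⟩
  induction n with
  | zero =>
    refine ⟨B, hB, fun x => (h x).trans ?_⟩
    gcongr
    linarith
  | succ n ih =>
    obtain ⟨D, hD, hn⟩ := ih
    have hi : Integrable fun u : ℝ => Real.exp (-(a / 2 * |u|)) :=
      integrable_exp_neg_abs (by positivity)
    refine ⟨B * D * ((∫ u : ℝ, Real.exp (-(a / 2 * |u|))) + 1), ?_, fun x => ?_⟩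
    · have : 0 ≤ ∫ u : ℝ, Real.exp (-(a / 2 * |u|)) := integral_nonneg fun _ => (Real.exp_pos _).le
      positivity
    have key : ∀ u, Real.exp (-V u) * convPow V n (x - u) ≤
        B * D * Real.exp (-(a / 2 * |x|)) * Real.exp (-(a / 2 * |u|)) := fun u => by
      calc Real.exp (-V u) * convPow V n (x - u)
          ≤ (B * Real.exp (-(a * |u|))) * (D * Real.exp (-(a / 2 * |x - u|))) :=
            mul_le_mul (h u) (hn _) (convPow_nonneg _ _ _) (by positivity)
        _ = B * D * Real.exp (-(a * |u|) + -(a / 2 * |x - u|)) := by rw [Real.exp_add]; ring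
        _ ≤ B * D * Real.exp (-(a / 2 * |x|) + -(a / 2 * |u|)) := by
            have : |x| ≤ |x - u| + |u| := by
              have := abs_add_le (x - u) u
              simpa using this
            refine mul_le_mul_of_nonneg_left (Real.exp_le_exp.2 ?_) (by positivity)
            nlinarith
        _ = _ := by rw [Real.exp_add]; ring
    calc convPow V (n + 1) x
        ≤ ∫ u, B * D * Real.exp (-(a / 2 * |x|)) * Real.exp (-(a / 2 * |u|)) :=
          integral_mono_of_nonneg (Eventually.of_forall fun u =>
            mul_nonneg (Real.exp_pos _).le (convPow_nonneg _ _ _)) (hi.const_mul _)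
            (Eventually.of_forall key)
      _ = B * D * (∫ u : ℝ, Real.exp (-(a / 2 * |u|))) * Real.exp (-(a / 2 * |x|)) := by
          rw [integral_const_mul]; ring
      _ ≤ _ := by
          have : B * D * (∫ u : ℝ, Real.exp (-(a / 2 * |u|))) ≤
            B * D * ((∫ u : ℝ, Real.exp (-(a / 2 * |u|))) + 1) := by gcongr; linarith
          gcongr

/-- Products of `e^{-V}` with a convolution power have moments of all orders. -/
theorem IsConfining.integrable_pow_mul_convPow (hV : IsConfining V) (k n : ℕ) (x : ℝ) :
    Integrable fun u => u ^ k * (Real.exp (-V u) * convPow V n (x - u)) := by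
  obtain ⟨a, B, ha, hB, h⟩ := hV.exp_neg_le
  obtain ⟨a', ha', h'⟩ := hV.convPow_le
  obtain ⟨D, hD, hn⟩ := h' n
  have hm := measurable_convPow hV.measurable n
  have hVm := hV.measurable
  refine ((integrable_pow_mul_exp_neg_abs k ha).const_mul (B * D)).mono'
    (by fun_prop) (Eventually.of_forall fun u => ?_)
  rw [norm_mul, norm_pow, Real.norm_eq_abs, Real.norm_eq_abs,
    abs_of_nonneg (mul_nonneg (Real.exp_pos _).le (convPow_nonneg _ _ _))]
  have : convPow V n (x - u) ≤ D := (hn _).trans (by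
    have : Real.exp (-(a' * |x - u|)) ≤ 1 := Real.exp_le_one_iff.2 (by
      have := mul_nonneg ha'.le (abs_nonneg (x - u)); linarith)
    nlinarith)
  calc |u| ^ k * (Real.exp (-V u) * convPow V n (x - u))
      ≤ |u| ^ k * (B * Real.exp (-(a * |u|)) * D) := by
        gcongr
        · exact convPow_nonneg _ _ _
        · exact h u
    _ = _ := by ring

theorem IsConfining.integrable_convPow (hV : IsConfining V) (n : ℕ) (x : ℝ) :
    Integrable fun u => Real.exp (-V u) * convPow V n (x - u) := by
  simpa using hV.integrable_pow_mul_convPow 0 n x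

theorem IsConfining.convPow_pos (hV : IsConfining V) (n : ℕ) (x : ℝ) : 0 < convPow V n x := by
  induction n generalizing x with
  | zero => exact Real.exp_pos _
  | succ n ih =>
    have h0 : ∀ u, 0 < Real.exp (-V u) * convPow V n (x - u) := fun u =>
      mul_pos (Real.exp_pos _) (ih _)
    show 0 < ∫ u, Real.exp (-V u) * convPow V n (x - u)
    rw [integral_pos_iff_support_of_nonneg (fun u => (h0 u).le) (hV.integrable_convPow n x)]
    have : (Function.support fun u => Real.exp (-V u) * convPow V n (x - u)) = Set.univ :=
      Set.eq_univ_of_forall fun u => (h0 u).ne'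
    simp [this]

theorem IsConfining.ofReal_convPow_succ (hV : IsConfining V) (n : ℕ) (x : ℝ) :
    ENNReal.ofReal (convPow V (n + 1) x) =
      ∫⁻ u, ENNReal.ofReal (Real.exp (-V u)) * ENNReal.ofReal (convPow V n (x - u)) := by
  show ENNReal.ofReal (∫ u, Real.exp (-V u) * convPow V n (x - u)) = _
  rw [ofReal_integral_eq_lintegral_ofReal (hV.integrable_convPow n x)
    (Eventually.of_forall fun u => mul_nonneg (Real.exp_pos _).le (convPow_nonneg _ _ _))]
  simp only [ENNReal.ofReal_mul (Real.exp_pos _).le]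

theorem IsConfining.fourPoint_convPow (hV : IsConfining V) (n : ℕ) :
    FourPoint fun x => ENNReal.ofReal (convPow V n x) := by
  induction n with
  | zero => exact fourPoint_exp_neg hV.convex
  | succ n ih =>
    simp only [hV.ofReal_convPow_succ]
    have hVm := hV.measurable
    exact ih.conv (fourPoint_exp_neg hV.convex)
      (measurable_convPow hV.measurable n).ennreal_ofReal (by fun_prop)

/-- The mean of one increment given the sum of all increments. -/
theorem IsConfining.integral_mul_convPow (hV : IsConfining V) (n : ℕ) (x : ℝ) :
    ∫ u, u * (Real.exp (-V u) * convPow V n (x - u)) = x / (n + 2) * convPow V (n + 1) x := by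
  have hi1 : ∀ n x, Integrable fun u => u * (Real.exp (-V u) * convPow V n (x - u)) :=
    fun n x => by simpa using hV.integrable_pow_mul_convPow 1 n x
  -- Split x = u + (x - u) under the integral. The second part is n + 1 copies of the first: by the
  -- reflection u ↦ x - u if n = 0, by induction and Fubini otherwise.
  have hx : ∀ n x, x * convPow V (n + 1) x =
      (∫ u, u * (Real.exp (-V u) * convPow V n (x - u))) +
        ∫ u, Real.exp (-V u) * ((x - u) * convPow V n (x - u)) := fun n x => by
    show x * ∫ u, Real.exp (-V u) * convPow V n (x - u) = _
    rw [← integral_const_mul, ← integral_add (hi1 n x)]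
    · congr 1; ext u; ring
    · refine (((hV.integrable_convPow n x).const_mul x).sub (hi1 n x)).congr
        (Eventually.of_forall fun u => ?_)
      simp; ring
  induction n generalizing x with
  | zero =>
    have h := hx 0 x
    have e : ∫ u, Real.exp (-V u) * ((x - u) * convPow V 0 (x - u)) =
        ∫ u, u * (Real.exp (-V u) * convPow V 0 (x - u)) := by
      rw [← integral_sub_left_eq_self _ _ x]
      congr 1; ext u
      simp only [convPow, sub_sub_cancel]; ring
    rw [e] at h
    simp only [Nat.cast_zero, zero_add]
    linarith
  | succ n ih =>
    have h := hx (n + 1) x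
    have hsplit : ∀ u, Real.exp (-V u) * ((x - u) * convPow V (n + 1) (x - u)) =
        (n + 2) * ∫ b, Real.exp (-V u) * (b * (Real.exp (-V b) * convPow V n (x - u - b))) :=
      fun u => by
        rw [integral_const_mul, ih (x - u)]
        have : (n : ℝ) + 2 ≠ 0 := by positivity
        field_simp
    have hswap : ∫ u, ∫ b, Real.exp (-V u) * (b * (Real.exp (-V b) * convPow V n (x - u - b))) =
        ∫ b, b * (Real.exp (-V b) * convPow V (n + 1) (x - b)) := by
      rw [integral_integral_swap]
      · congr 1; ext b
        show _ = b * (Real.exp (-V b) * ∫ u, Real.exp (-V u) * convPow V n (x - b - u))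
        rw [← integral_const_mul, ← integral_const_mul]
        congr 1; ext u
        rw [sub_right_comm]; ring
      · obtain ⟨a, B, ha, hB, hf⟩ := hV.exp_neg_le
        obtain ⟨a', ha', h'⟩ := hV.convPow_le
        obtain ⟨D, hD, hn⟩ := h' n
        have hm := measurable_convPow hV.measurable n
        have hVm := hV.measurable
        have hprod := ((integrable_exp_neg_abs ha).const_mul (B * B * D)).mul_prod
          (integrable_pow_mul_exp_neg_abs 1 ha)
        refine hprod.mono' ?_ (Eventually.of_forall fun p => ?_)
        · exact (by unfold Function.uncurry; fun_prop : Measurable (Function.uncurry fun u b =>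
            Real.exp (-V u) * (b * (Real.exp (-V b) * convPow V n (x - u - b))))).aestronglyMeasurable
        · simp only [Function.uncurry, norm_mul, Real.norm_eq_abs, Real.abs_exp, pow_one,
            abs_of_nonneg (convPow_nonneg V n _)]
          have : convPow V n (x - p.1 - p.2) ≤ D := (hn _).trans (by
            have : Real.exp (-(a' * |x - p.1 - p.2|)) ≤ 1 := Real.exp_le_one_iff.2 (by
              have := mul_nonneg ha'.le (abs_nonneg (x - p.1 - p.2)); linarith)
            nlinarith)
          calc Real.exp (-V p.1) * (|p.2| * (Real.exp (-V p.2) * convPow V n (x - p.1 - p.2)))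
              ≤ (B * Real.exp (-(a * |p.1|))) * (|p.2| * ((B * Real.exp (-(a * |p.2|))) * D)) := by
                gcongr
                · have := convPow_nonneg V n (x - p.1 - p.2)
                  positivity
                · exact hf _
                · exact convPow_nonneg _ _ _
                · exact hf _
            _ = _ := by ring
    simp only [hsplit, integral_const_mul] at h
    simp only [integral_const_mul] at hswap
    rw [hswap] at h
    push_cast
    generalize ∫ b, b * (Real.exp (-V b) * convPow V (n + 1) (x - b)) = I at h
    have : (n : ℝ) + 1 + 2 ≠ 0 := by positivity
    rw [div_mul_eq_mul_div, h, eq_div_iff this]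
    ring

end convPow

/-! ### Uniform moments and tails of conditioned increments -/

section tails

variable {V : ℝ → ℝ}

theorem four_point_of_convex (hV : ConvexOn ℝ Set.univ V) {v w h : ℝ} (hvw : v ≤ w) (hh : 0 ≤ h) :
    V (v + h) + V w ≤ V v + V (w + h) := by
  have := fourPoint_exp_neg hV v w h hvw hh
  rw [← ENNReal.ofReal_mul (Real.exp_pos _).le, ← ENNReal.ofReal_mul (Real.exp_pos _).le,
    ← Real.exp_add, ← Real.exp_add, ENNReal.ofReal_le_ofReal_iff (Real.exp_pos _).le,
    Real.exp_le_exp] at this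
  linarith

theorem IsConfining.comp_neg (hV : IsConfining V) : IsConfining fun x => V (-x) where
  convex := ⟨convex_univ, fun x _ y _ a b ha hb hab => by
    have := hV.convex.2 (Set.mem_univ (-x)) (Set.mem_univ (-y)) ha hb hab
    simp only [smul_eq_mul] at this ⊢
    convert this using 2
    ring⟩
  growth := by
    obtain ⟨C, hC, K, h⟩ := hV.growth
    exact ⟨C, hC, K, fun x => by simpa using h (-x)⟩
  lower := by
    obtain ⟨a, b, ha, h⟩ := hV.lower
    exact ⟨a, b, ha, fun x => by simpa using h (-x)⟩

/-- Slopes of a convex function increase, so the slope beyond x is at least that from 0 to x, and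
linear growth makes the latter at least a/2 once x ≥ 2(b + V 0)/a. -/
theorem IsConfining.exists_slope_right (hV : IsConfining V) :
    ∃ κ R : ℝ, 0 < κ ∧ 0 ≤ R ∧ ∀ x y, R ≤ x → x ≤ y → κ * (y - x) ≤ V y - V x := by
  obtain ⟨a, b, ha, h⟩ := hV.lower
  have hb : 0 ≤ b + V 0 := by have := h 0; simp at this; linarith
  refine ⟨a / 2, 2 * (b + V 0) / a + 1, by positivity, by positivity, fun x y hx hxy => ?_⟩
  rcases eq_or_lt_of_le hxy with rfl | hxy
  · simp
  have hx0 : 0 < x := lt_of_lt_of_le (by positivity) hx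
  have hs := hV.convex.slope_mono_adjacent (Set.mem_univ 0) (Set.mem_univ y) hx0 hxy
  have h1 : a / 2 ≤ (V x - V 0) / (x - 0) := by
    rw [le_div_iff₀ (by linarith)]
    have h2 := h x
    rw [abs_of_pos hx0] at h2
    have h3 : 2 * (b + V 0) ≤ a * x := by
      have : 2 * (b + V 0) / a ≤ x := by linarith
      rwa [div_le_iff₀' ha] at this
    linarith
  have := h1.trans hs
  rwa [le_div_iff₀ (by linarith)] at this

theorem IsConfining.exists_slope (hV : IsConfining V) :
    ∃ κ R : ℝ, 0 < κ ∧ 0 ≤ R ∧ (∀ x y, R ≤ x → x ≤ y → κ * (y - x) ≤ V y - V x) ∧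
      ∀ x y, x ≤ -R → y ≤ x → κ * (x - y) ≤ V y - V x := by
  obtain ⟨κ₁, R₁, h1, h2, h3⟩ := hV.exists_slope_right
  obtain ⟨κ₂, R₂, h4, h5, h6⟩ := hV.comp_neg.exists_slope_right
  refine ⟨min κ₁ κ₂, max R₁ R₂, lt_min h1 h4, h2.trans (le_max_left _ _), fun x y hx hxy => ?_,
    fun x y hx hxy => ?_⟩
  · have := h3 x y ((le_max_left _ _).trans hx) hxy
    nlinarith [min_le_left κ₁ κ₂]
  · have := h6 (-x) (-y) (by linarith [le_max_right R₁ R₂]) (by linarith)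
    simp only [neg_neg] at this
    nlinarith [min_le_right κ₁ κ₂]

/-- The spread of two increments given their sum `s`: the conditional second moment of the
difference is at most `s² / 2 + C`. -/
theorem IsConfining.exists_lintegral_sq_le (hV : IsConfining V) :
    ∃ C : ℝ, 0 < C ∧ ∀ s : ℝ,
      ∫⁻ u, ENNReal.ofReal ((2 * u - s) ^ 2) *
        (ENNReal.ofReal (Real.exp (-V u)) * ENNReal.ofReal (Real.exp (-V (s - u)))) ≤
      ENNReal.ofReal (s ^ 2 / 2 + C) *
        ∫⁻ u, ENNReal.ofReal (Real.exp (-V u)) * ENNReal.ofReal (Real.exp (-V (s - u))) := by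
  obtain ⟨κ, R, hκ, hR, hr, hl⟩ := hV.exists_slope
  set β := 4 * R / 3 + 2 / κ
  refine ⟨3 / 2 * β ^ 2 + 4 * R ^ 2 / 3 + 4 * R / κ + 8 / κ ^ 2, by positivity, fun s => ?_⟩
  -- Given the sum s, the half-difference v has an even density that decreases on [0, ∞). For v ≥ T
  -- the arguments s/2 + v and s/2 - v both lie where V is steep, which gives exponential decay.
  set T := |s| / 2 + R with hT
  set h : ℝ → ℝ := fun v => Real.exp (-V (s / 2 + v)) * Real.exp (-V (s / 2 - v)) with hh
  have hVc := hV.continuous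
  have hh0 : ∀ v, 0 < h v := fun v => mul_pos (Real.exp_pos _) (Real.exp_pos _)
  have hmom : ∀ k : ℕ, Integrable fun v => (s / 2 + v) ^ k * h v := fun k => by
    have := (hV.integrable_pow_mul_convPow k 0 s).comp_add_left (s / 2)
    refine this.congr (Eventually.of_forall fun v => ?_)
    simp only [convPow, hh]
    congr 5
    ring
  have hi0 : Integrable h := by simpa using hmom 0
  have hi1 : Integrable fun v => (s / 2 + v) * h v := by simpa using hmom 1
  have hi2 : Integrable fun v => v ^ 2 * h v := by
    refine (((hmom 2).sub (hi1.const_mul s)).add (hi0.const_mul (s ^ 2 / 4))).congr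
      (Eventually.of_forall fun v => ?_)
    simp only [Pi.add_apply, Pi.sub_apply]
    ring
  have hanti : ∀ v w, 0 ≤ v → v ≤ w → h w ≤ h v := fun v w hv hvw => by
    simp only [hh, ← Real.exp_add]
    refine Real.exp_le_exp.2 ?_
    have := four_point_of_convex hV.convex (by linarith : s / 2 - w ≤ s / 2 + v)
      (by linarith : 0 ≤ w - v)
    have e1 : s / 2 - w + (w - v) = s / 2 - v := by ring
    have e2 : s / 2 + v + (w - v) = s / 2 + w := by ring
    rw [e1, e2] at this
    linarith
  have key := integral_sq_mul_le (h := h) (T := T) (κ := κ) (by positivity) hκ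
    (fun v => (hh0 v).le) (fun v => by
      rcases abs_choice v with hv | hv
      · rw [hv]
      · rw [hv]; simp only [hh, sub_neg_eq_add, ← sub_eq_add_neg]; ring_nf) hanti
    (fun v w hv hvw => by
      simp only [hh, ← Real.exp_add]
      refine Real.exp_le_exp.2 ?_
      have h1 := hr (s / 2 + v) (s / 2 + w) (by linarith [neg_abs_le s]) (by linarith)
      have h2 := hl (s / 2 - v) (s / 2 - w) (by linarith [le_abs_self s]) (by linarith)
      nlinarith) hi0 hi2
  have hshift : ∀ g : ℝ → ℝ≥0∞, ∫⁻ u, g u = ∫⁻ v, g (s / 2 + v) := fun g =>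
    (lintegral_add_left_eq_self g _).symm
  rw [hshift, hshift fun u => ENNReal.ofReal (Real.exp (-V u)) * _]
  have e : ∀ v, ENNReal.ofReal (Real.exp (-V (s / 2 + v))) *
      ENNReal.ofReal (Real.exp (-V (s - (s / 2 + v)))) = ENNReal.ofReal (h v) := fun v => by
    rw [← ENNReal.ofReal_mul (Real.exp_pos _).le]
    simp only [hh]
    congr 4; ring_nf
  have e2 : ∀ v, ENNReal.ofReal ((2 * (s / 2 + v) - s) ^ 2) * ENNReal.ofReal (h v) =
      ENNReal.ofReal (4 * (v ^ 2 * h v)) := fun v => by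
    rw [← ENNReal.ofReal_mul (by positivity)]
    congr 1; ring
  simp only [e, e2]
  rw [← ofReal_integral_eq_lintegral_ofReal (hi2.const_mul 4)
    (Eventually.of_forall fun v => by have := hh0 v; positivity),
    ← ofReal_integral_eq_lintegral_ofReal hi0 (Eventually.of_forall fun v => (hh0 v).le),
    ← ENNReal.ofReal_mul (by positivity), integral_const_mul]
  refine ENNReal.ofReal_le_ofReal ?_
  have hI : 0 ≤ ∫ v, h v := integral_nonneg fun v => (hh0 v).le
  -- The leading term is s²/3, and |s|β ≤ s²/6 + 3β²/2 absorbs the linear one. What matters later is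
  -- that the final coefficient 1/2 is below 1.
  have hcoef : 4 * (T ^ 2 / 3 + T / κ + 2 / κ ^ 2) ≤
      s ^ 2 / 2 + (3 / 2 * β ^ 2 + 4 * R ^ 2 / 3 + 4 * R / κ + 8 / κ ^ 2) := by
    have e3 : 4 * (T ^ 2 / 3 + T / κ + 2 / κ ^ 2) =
        |s| ^ 2 / 3 + |s| * β + 4 * R ^ 2 / 3 + 4 * R / κ + 8 / κ ^ 2 := by
      simp only [hT, β]; field_simp; ring
    rw [e3, ← sq_abs s]
    nlinarith [sq_nonneg (|s| - 3 * β)]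
  calc 4 * ∫ v, v ^ 2 * h v ≤ 4 * ((T ^ 2 / 3 + T / κ + 2 / κ ^ 2) * ∫ v, h v) := by gcongr
    _ = 4 * (T ^ 2 / 3 + T / κ + 2 / κ ^ 2) * ∫ v, h v := by ring
    _ ≤ _ := by gcongr

/-- The second moment of one of `n + 3` increments, conditioned to sum to zero, is bounded
uniformly in `n`. -/
theorem IsConfining.exists_second_moment_le (hV : IsConfining V) :
    ∃ C : ℝ, 0 < C ∧ ∀ n : ℕ,
      ∫⁻ u, ENNReal.ofReal (u ^ 2) *
        (ENNReal.ofReal (Real.exp (-V u)) * ENNReal.ofReal (convPow V (n + 1) (-u))) ≤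
      ENNReal.ofReal C * ENNReal.ofReal (convPow V (n + 2) 0) := by
  obtain ⟨C, hC, hs⟩ := hV.exists_lintegral_sq_le
  refine ⟨C, hC, fun n => ?_⟩
  have hVm := hV.measurable
  have hqm := measurable_convPow hV.measurable
  set F : ℝ → ℝ≥0∞ := fun u => ENNReal.ofReal (Real.exp (-V u)) with hF
  set Q : ℕ → ℝ → ℝ≥0∞ := fun n u => ENNReal.ofReal (convPow V n u) with hQ
  have hFm : Measurable F := by fun_prop
  have hQm : ∀ n, Measurable (Q n) := fun n => (hqm n).ennreal_ofReal
  have hQs : ∀ n x, Q (n + 1) x = ∫⁻ u, F u * Q n (x - u) := hV.ofReal_convPow_succ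
  have hQn := hQm n
  set M := ∫⁻ u, ENNReal.ofReal (u ^ 2) * (F u * Q (n + 1) (-u)) with hM
  show M ≤ ENNReal.ofReal C * Q (n + 2) 0
  -- Finiteness of M is what allows 3M to be cancelled at the end.
  have hMt : M ≠ ⊤ := by
    have hi := hV.integrable_pow_mul_convPow 2 (n + 1) 0
    have : M = ∫⁻ u, ENNReal.ofReal (u ^ 2 * (Real.exp (-V u) * convPow V (n + 1) (0 - u))) := by
      refine lintegral_congr fun u => ?_
      simp only [hF, hQ]
      rw [ENNReal.ofReal_mul (by positivity), ENNReal.ofReal_mul (Real.exp_pos _).le, zero_sub]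
    rw [this]
    exact hi.lintegral_lt_top.ne
  set Φ : ℝ → ℝ → ℝ≥0∞ := fun a b => F a * (F b * Q n (-a - b)) with hΦ
  have hΦm : Measurable fun p : ℝ × ℝ => Φ p.1 p.2 := by fun_prop
  have hinner : ∀ a, ∫⁻ b, Φ a b = F a * Q (n + 1) (-a) := fun a => by
    simp only [hΦ]
    rw [lintegral_const_mul _ (by fun_prop), hQs]
  have hA : ∫⁻ a, ∫⁻ b, ENNReal.ofReal (a ^ 2) * Φ a b = M := by
    refine lintegral_congr fun a => ?_
    rw [lintegral_const_mul _ (by fun_prop), hinner]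
  have hB : ∫⁻ a, ∫⁻ b, ENNReal.ofReal (b ^ 2) * Φ a b = M := by
    rw [lintegral_lintegral_swap (by fun_prop), ← hA]
    refine lintegral_congr fun a => lintegral_congr fun b => ?_
    simp only [hΦ]
    rw [show -b - a = -a - b by ring]
    ring
  have hZ : ∫⁻ a, ∫⁻ b, Φ a b = Q (n + 2) 0 := by
    simp only [hinner, hQs (n + 1) 0, zero_sub]
  set X := ∫⁻ a, ∫⁻ b, ENNReal.ofReal ((a + b) ^ 2) * Φ a b with hX
  have shear : ∀ g : ℝ → ℝ → ℝ≥0∞, Measurable (fun p : ℝ × ℝ => g p.1 p.2) →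
      ∫⁻ a, ∫⁻ b, g a b = ∫⁻ s, ∫⁻ a, g a (s - a) := fun g hg => by
    rw [lintegral_lintegral_swap (f := fun s a => g a (s - a))]
    · refine lintegral_congr fun a => ?_
      rw [lintegral_sub_right_eq_self (fun b => g a b) a]
    · exact (hg.comp (f := fun p : ℝ × ℝ => (p.2, p.1 - p.2)) (by fun_prop)).aemeasurable
  -- In the coordinates (s, a) with b = s - a, the weight of the other increments depends on s
  -- alone, so the bound for two increments applies at each fixed s.
  have hdiff : ∫⁻ a, ∫⁻ b, ENNReal.ofReal ((a - b) ^ 2) * Φ a b ≤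
      ENNReal.ofReal (1 / 2) * X + ENNReal.ofReal C * Q (n + 2) 0 := by
    rw [shear _ (by fun_prop)]
    have e1 : ENNReal.ofReal (1 / 2) * X + ENNReal.ofReal C * Q (n + 2) 0 =
        ∫⁻ s, ∫⁻ a, ENNReal.ofReal (s ^ 2 / 2 + C) * Φ a (s - a) := by
      rw [← hZ, hX, shear _ (by fun_prop), shear Φ hΦm, ← lintegral_const_mul _ ?_,
        ← lintegral_const_mul _ ?_, ← lintegral_add_left ?_]
      · refine lintegral_congr fun s => ?_
        rw [← lintegral_const_mul _ (by fun_prop), ← lintegral_const_mul _ (by fun_prop),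
          ← lintegral_add_left (by fun_prop)]
        refine lintegral_congr fun a => ?_
        rw [← mul_assoc, ← add_mul, add_sub_cancel, ← ENNReal.ofReal_mul (by norm_num),
          ← ENNReal.ofReal_add (by positivity) hC.le]
        congr 2; ring
      · refine Measurable.const_mul ?_ _
        exact Measurable.lintegral_prod_right' (f := fun p : ℝ × ℝ =>
          ENNReal.ofReal ((p.2 + (p.1 - p.2)) ^ 2) * Φ p.2 (p.1 - p.2)) (by fun_prop)
      · exact Measurable.lintegral_prod_right' (f := fun p : ℝ × ℝ => Φ p.2 (p.1 - p.2))
          (by fun_prop)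
      · exact Measurable.lintegral_prod_right' (f := fun p : ℝ × ℝ =>
          ENNReal.ofReal ((p.2 + (p.1 - p.2)) ^ 2) * Φ p.2 (p.1 - p.2)) (by fun_prop)
    rw [e1]
    refine lintegral_mono fun s => ?_
    have h1 : ∀ a, ENNReal.ofReal ((a - (s - a)) ^ 2) * Φ a (s - a) =
        ENNReal.ofReal ((2 * a - s) ^ 2) * (F a * F (s - a)) * Q n (-s) := fun a => by
      simp only [hΦ]
      rw [show a - (s - a) = 2 * a - s by ring, show -a - (s - a) = -s by ring]
      ring
    have h2 : ∀ a, ENNReal.ofReal (s ^ 2 / 2 + C) * Φ a (s - a) =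
        ENNReal.ofReal (s ^ 2 / 2 + C) * (F a * F (s - a)) * Q n (-s) := fun a => by
      simp only [hΦ]
      rw [show -a - (s - a) = -s by ring]
      ring
    simp only [h1, h2]
    rw [lintegral_mul_const _ (by fun_prop), lintegral_mul_const _ (by fun_prop),
      lintegral_const_mul _ (by fun_prop)]
    exact mul_le_mul_left (hs s) _
  -- Given a, the increment b has mean -a/(n + 2), so the cross term 2ab contributes a nonpositive
  -- amount.
  have hX2 : X ≤ 2 * M := by
    have : 2 * M = ∫⁻ a, (ENNReal.ofReal (a ^ 2) * (F a * Q (n + 1) (-a)) +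
        ∫⁻ b, ENNReal.ofReal (b ^ 2) * Φ a b) := by
      rw [lintegral_add_left (by have := hQm (n + 1); fun_prop), hB, two_mul]
    rw [this]
    refine lintegral_mono fun a => ?_
    set p : ℝ → ℝ := fun b => Real.exp (-V b) * convPow V n (-a - b) with hp
    have hp0 : ∀ b, 0 ≤ p b := fun b => mul_nonneg (Real.exp_pos _).le (convPow_nonneg _ _ _)
    have hpe : ∀ c b : ℝ, 0 ≤ c → ENNReal.ofReal c * Φ a b = F a * ENNReal.ofReal (c * p b) :=
      fun c b hc => by
        simp only [hΦ, hp, hF, hQ]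
        rw [ENNReal.ofReal_mul hc, ENNReal.ofReal_mul (Real.exp_pos _).le]
        ring
    have hpi : ∀ k : ℕ, Integrable fun b => b ^ k * p b := fun k =>
      hV.integrable_pow_mul_convPow k n (-a)
    have hp0i : Integrable p := by simpa using hpi 0
    have hp1i : Integrable fun b => b * p b := by simpa using hpi 1
    have hmean : ∫ b, b * p b = -a / (n + 2) * convPow V (n + 1) (-a) :=
      hV.integral_mul_convPow n (-a)
    have hmass : ∫ b, p b = convPow V (n + 1) (-a) := rfl
    have hsum : Integrable fun b => (a + b) ^ 2 * p b := by
      refine (((hpi 2).add (hp1i.const_mul (2 * a))).add (hp0i.const_mul (a ^ 2))).congr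
        (Eventually.of_forall fun b => ?_)
      simp only [Pi.add_apply]
      ring
    have hval : ∫ b, (a + b) ^ 2 * p b =
        (∫ b, b ^ 2 * p b) + 2 * a * (∫ b, b * p b) + a ^ 2 * ∫ b, p b := by
      have h12 : Integrable fun b => b ^ 2 * p b + 2 * a * (b * p b) :=
        (hpi 2).add (hp1i.const_mul (2 * a))
      rw [← integral_const_mul, ← integral_const_mul,
        ← integral_add (hpi 2) (hp1i.const_mul (2 * a)),
        ← integral_add h12 (hp0i.const_mul _)]
      congr 1; ext b; ring
    have hle : ∫ b, (a + b) ^ 2 * p b ≤ a ^ 2 * convPow V (n + 1) (-a) + ∫ b, b ^ 2 * p b := by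
      rw [hval, hmean, hmass]
      have : 2 * a * (-a / (n + 2) * convPow V (n + 1) (-a)) =
          -(2 * a ^ 2 / (n + 2) * convPow V (n + 1) (-a)) := by ring
      rw [this]
      have : 0 ≤ 2 * a ^ 2 / (n + 2) * convPow V (n + 1) (-a) :=
        mul_nonneg (by positivity) (convPow_nonneg _ _ _)
      linarith
    have hl : ∀ c : ℝ → ℝ, (∀ b, 0 ≤ c b) → Integrable (fun b => c b * p b) →
        ∫⁻ b, ENNReal.ofReal (c b) * Φ a b = F a * ENNReal.ofReal (∫ b, c b * p b) := by
      intro c hc hci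
      rw [ofReal_integral_eq_lintegral_ofReal hci
        (Eventually.of_forall fun b => mul_nonneg (hc b) (hp0 b)),
        ← lintegral_const_mul' _ _ ENNReal.ofReal_ne_top]
      exact lintegral_congr fun b => hpe _ _ (hc b)
    rw [hl (fun b => (a + b) ^ 2) (fun b => sq_nonneg _) hsum,
      hl (fun b => b ^ 2) (fun b => sq_nonneg _) (hpi 2), mul_left_comm, ← mul_add, hQ,
      ← ENNReal.ofReal_mul (sq_nonneg a), ← ENNReal.ofReal_add
        (mul_nonneg (sq_nonneg a) (convPow_nonneg _ _ _))
        (integral_nonneg fun b => mul_nonneg (sq_nonneg b) (hp0 b))]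
    exact mul_le_mul_right (ENNReal.ofReal_le_ofReal hle) _
  -- The parallelogram identity, integrated.
  have hsum : (∫⁻ a, ∫⁻ b, ENNReal.ofReal ((a - b) ^ 2) * Φ a b) + X = 2 * M + 2 * M := by
    have e1 : ∀ a, (∫⁻ b, ENNReal.ofReal ((a - b) ^ 2) * Φ a b) +
        ∫⁻ b, ENNReal.ofReal ((a + b) ^ 2) * Φ a b =
        2 * (∫⁻ b, ENNReal.ofReal (a ^ 2) * Φ a b) +
          2 * ∫⁻ b, ENNReal.ofReal (b ^ 2) * Φ a b := fun a => by
      rw [← lintegral_add_left (by fun_prop), ← lintegral_const_mul _ (by fun_prop),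
        ← lintegral_const_mul _ (by fun_prop), ← lintegral_add_left (by fun_prop)]
      refine lintegral_congr fun b => ?_
      rw [← add_mul, ← ENNReal.ofReal_add (sq_nonneg _) (sq_nonneg _),
        show (a - b) ^ 2 + (a + b) ^ 2 = 2 * a ^ 2 + 2 * b ^ 2 by ring,
        ENNReal.ofReal_add (by positivity) (by positivity), ENNReal.ofReal_mul (by norm_num),
        ENNReal.ofReal_mul (by norm_num), ENNReal.ofReal_ofNat]
      ring
    have m1 : Measurable fun a => ∫⁻ b, ENNReal.ofReal ((a - b) ^ 2) * Φ a b :=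
      Measurable.lintegral_prod_right' (f := fun p : ℝ × ℝ =>
        ENNReal.ofReal ((p.1 - p.2) ^ 2) * Φ p.1 p.2) (by fun_prop)
    have m2 : Measurable fun a => ∫⁻ b, ENNReal.ofReal (a ^ 2) * Φ a b :=
      Measurable.lintegral_prod_right' (f := fun p : ℝ × ℝ =>
        ENNReal.ofReal (p.1 ^ 2) * Φ p.1 p.2) (by fun_prop)
    have m3 : Measurable fun a => ∫⁻ b, ENNReal.ofReal (b ^ 2) * Φ a b :=
      Measurable.lintegral_prod_right' (f := fun p : ℝ × ℝ =>
        ENNReal.ofReal (p.2 ^ 2) * Φ p.1 p.2) (by fun_prop)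
    rw [hX, ← lintegral_add_left m1]
    simp only [e1]
    rw [lintegral_add_left (m2.const_mul _), lintegral_const_mul _ m2, lintegral_const_mul _ m3,
      hA, hB]
  have hhalf : ENNReal.ofReal (1 / 2) * X ≤ M := by
    calc ENNReal.ofReal (1 / 2) * X ≤ ENNReal.ofReal (1 / 2) * (2 * M) := by gcongr
      _ = M := by
        rw [← mul_assoc, ← ENNReal.ofReal_ofNat 2, ← ENNReal.ofReal_mul (by norm_num)]
        norm_num
  have h4 : 3 * M + M ≤ 3 * M + ENNReal.ofReal C * Q (n + 2) 0 := by
    calc 3 * M + M = 2 * M + 2 * M := by ring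
      _ ≤ (M + ENNReal.ofReal C * Q (n + 2) 0) + 2 * M := by
          rw [← hsum]
          exact add_le_add (hdiff.trans (add_le_add hhalf le_rfl)) hX2
      _ = _ := by ring
  exact (ENNReal.add_le_add_iff_left (ENNReal.mul_ne_top (by norm_num) hMt)).1 h4

/-- The law of one of `n + 3` increments, conditioned to sum to zero, has exponential tails
uniformly in `n`. -/
theorem IsConfining.exists_tail_le (hV : IsConfining V) :
    ∃ A : ℝ, 0 < A ∧ ∀ n j : ℕ,
      ∫⁻ u in {u | A + 2 * A * j < |u|},
        ENNReal.ofReal (Real.exp (-V u)) * ENNReal.ofReal (convPow V (n + 1) (-u)) ≤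
      ENNReal.ofReal (2 * Real.exp (-j)) * ENNReal.ofReal (convPow V (n + 2) 0) := by
  obtain ⟨C, hC, hm⟩ := hV.exists_second_moment_le
  -- By Chebyshev, a second moment of at most C leaves at most a quarter of the mass outside [-2√C,
  -- 2√C], as the log-concave tail bound requires.
  refine ⟨2 * √C, by positivity, fun n j => ?_⟩
  have hVm := hV.measurable
  have hqm := measurable_convPow hV.measurable (n + 1)
  set g : ℝ → ℝ≥0∞ := fun u =>
    ENNReal.ofReal (Real.exp (-V u)) * ENNReal.ofReal (convPow V (n + 1) (-u)) with hg
  have hgm : Measurable g := by fun_prop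
  have hmass : ∫⁻ u, g u = ENNReal.ofReal (convPow V (n + 2) 0) := by
    rw [hV.ofReal_convPow_succ (n + 1) 0]
    simp only [zero_sub, hg]
  refine FourPoint.lintegral_abs_le_exp (g := g)
    ((fourPoint_exp_neg hV.convex).mul (hV.fourPoint_convPow (n + 1)).comp_neg) hgm (by positivity)
    hmass ENNReal.ofReal_ne_top ?_ j
  have hset : MeasurableSet {x : ℝ | 2 * √C ≤ |x|} :=
    measurableSet_le measurable_const measurable_norm
  have h1 : ENNReal.ofReal (4 * C) * ∫⁻ u in {x | 2 * √C ≤ |x|}, g u ≤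
      ENNReal.ofReal C * ENNReal.ofReal (convPow V (n + 2) 0) := by
    rw [← lintegral_const_mul _ hgm]
    refine le_trans (le_trans (setLIntegral_mono' hset fun u hu => ?_)
      (setLIntegral_le_lintegral _ _)) (hm n)
    refine mul_le_mul_left (ENNReal.ofReal_le_ofReal ?_) _
    have hu' : 2 * √C ≤ |u| := hu
    rw [← sq_abs]
    calc 4 * C = (2 * √C) ^ 2 := by rw [mul_pow, Real.sq_sqrt hC.le]; ring
      _ ≤ _ := by gcongr
  rw [ENNReal.le_div_iff_mul_le (by simp) (by simp)]
  have hC0 : ENNReal.ofReal C ≠ 0 := by simpa using hC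
  refine (ENNReal.mul_le_mul_iff_right hC0 ENNReal.ofReal_ne_top).1 (le_trans (le_of_eq ?_) h1)
  rw [ENNReal.ofReal_mul (by norm_num), ENNReal.ofReal_ofNat]
  ring

end tails

/-! ### Path weights as convolutions -/

/-- The path from `x` to `z` with intermediate heights `y`. -/
def path {n : ℕ} (x : ℝ) (y : Fin n → ℝ) (z : ℝ) : Fin (n + 2) → ℝ :=
  Fin.cons (α := fun _ => ℝ) x (Fin.snoc (α := fun _ => ℝ) y z)

/-- Total weight of the paths from `x` to `z`, where the `i`-th increment has weight `g i`. -/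
noncomputable def chainWeight {n : ℕ} (g : Fin (n + 1) → ℝ → ℝ≥0∞) (x z : ℝ) : ℝ≥0∞ :=
  ∫⁻ y : Fin n → ℝ, ∏ i : Fin (n + 1), g i (path x y z i.succ - path x y z i.castSucc)

theorem measurable_path {n : ℕ} (x z : ℝ) (i : Fin (n + 2)) :
    Measurable fun y : Fin n → ℝ => path x y z i := by
  refine Fin.cases ?_ (fun j => ?_) i
  · simp only [path, Fin.cons_zero]; fun_prop
  · refine Fin.lastCases ?_ (fun k => ?_) j
    · simp only [path, Fin.cons_succ, Fin.snoc_last]; fun_prop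
    · simp only [path, Fin.cons_succ, Fin.snoc_castSucc]; fun_prop

theorem path_cons {n : ℕ} (x u : ℝ) (y : Fin n → ℝ) (z : ℝ) :
    path x (Fin.cons (α := fun _ => ℝ) u y) z = Fin.cons (α := fun _ => ℝ) x (path u y z) := by
  simp only [path, Fin.cons_snoc_eq_snoc_cons]

theorem chainWeight_zero (g : Fin 1 → ℝ → ℝ≥0∞) (x z : ℝ) :
    chainWeight g x z = g 0 (z - x) := by
  have h1 : ∀ y : Fin 0 → ℝ, path x y z 1 = z := fun y => by
    show path x y z (Fin.succ (Fin.last 0)) = z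
    simp only [path, Fin.cons_succ, Fin.snoc_last]
  have h0 : ∀ y : Fin 0 → ℝ, path x y z 0 = x := fun y => by simp [path]
  rw [chainWeight, volume_pi, Measure.pi_of_empty]
  simp [h0, h1]

/-- Fubini in the first intermediate height. This recursion identifies path weights with convolution
powers. -/
theorem chainWeight_succ {n : ℕ} (g : Fin (n + 2) → ℝ → ℝ≥0∞) (hg : ∀ i, Measurable (g i))
    (x z : ℝ) :
    chainWeight g x z = ∫⁻ u, g 0 (u - x) * chainWeight (fun i => g i.succ) u z := by
  have hm : ∀ u, Measurable fun y : Fin n → ℝ =>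
      ∏ i : Fin (n + 1), g i.succ (path u y z i.succ - path u y z i.castSucc) := fun u =>
    Finset.measurable_prod _ fun i _ =>
      (hg _).comp ((measurable_path u z _).sub (measurable_path u z _))
  have hm' : Measurable fun y : Fin (n + 1) → ℝ =>
      ∏ i : Fin (n + 2), g i (path x y z i.succ - path x y z i.castSucc) :=
    Finset.measurable_prod _ fun i _ =>
      (hg _).comp ((measurable_path x z _).sub (measurable_path x z _))
  have hp := (volume_preserving_piFinSuccAbove (fun _ : Fin (n + 1) => ℝ) 0).symm
  rw [chainWeight, ← hp.lintegral_comp hm', Measure.volume_eq_prod,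
    lintegral_prod]
  swap
  · exact (hm'.comp (MeasurableEquiv.measurable _)).aemeasurable
  refine lintegral_congr fun u => ?_
  rw [chainWeight, ← lintegral_const_mul _ (hm u)]
  refine lintegral_congr fun y => ?_
  have e : (MeasurableEquiv.piFinSuccAbove (fun _ : Fin (n + 1) => ℝ) 0).symm (u, y) =
      Fin.cons (α := fun _ => ℝ) u y := by
    simp [MeasurableEquiv.piFinSuccAbove]
    rfl
  rw [e, Fin.prod_univ_succ, path_cons]
  congr 1

section powers

variable {V : ℝ → ℝ}

theorem IsConfining.chainWeight_const (hV : IsConfining V) (n : ℕ) (x z : ℝ) :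
    chainWeight (fun _ : Fin (n + 1) => fun u => ENNReal.ofReal (Real.exp (-V u))) x z =
      ENNReal.ofReal (convPow V n (z - x)) := by
  have hVm := hV.measurable
  induction n generalizing x with
  | zero => rw [chainWeight_zero]; rfl
  | succ n ih =>
    rw [chainWeight_succ _ (fun _ => by fun_prop), hV.ofReal_convPow_succ]
    simp only [ih]
    rw [← lintegral_add_right_eq_self _ x]
    refine lintegral_congr fun u => ?_
    rw [add_sub_cancel_right, sub_add_eq_sub_sub_swap]

/-- Convolution is commutative, so the marked factor `G` can be moved to the front: its position
along the path does not matter. -/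
theorem IsConfining.chainWeight_update (hV : IsConfining V) {G : ℝ → ℝ≥0∞} (hG : Measurable G)
    (n : ℕ) (k : Fin (n + 2)) (x z : ℝ) :
    chainWeight (Function.update (fun _ : Fin (n + 2) => fun u =>
        ENNReal.ofReal (Real.exp (-V u))) k G) x z =
      ∫⁻ u, G u * ENNReal.ofReal (convPow V n (z - x - u)) := by
  have hVm := hV.measurable
  set F : ℝ → ℝ≥0∞ := fun u => ENNReal.ofReal (Real.exp (-V u)) with hF
  have hFm : Measurable F := by fun_prop
  have hqm := measurable_convPow hV.measurable
  have hm : ∀ (n : ℕ) (k : Fin (n + 2)) (i : Fin (n + 2)),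
      Measurable (Function.update (fun _ : Fin (n + 2) => F) k G i) := fun n k i => by
    by_cases h : i = k
    · subst h; simpa using hG
    · simpa [Function.update_of_ne h] using hFm
  have shift : ∀ (p q : ℝ → ℝ≥0∞) (x z : ℝ), ∫⁻ u, p (u - x) * q (z - u) =
      ∫⁻ u, p u * q (z - x - u) := fun p q x z => by
    rw [← lintegral_add_right_eq_self _ x]
    refine lintegral_congr fun u => ?_
    rw [add_sub_cancel_right, sub_add_eq_sub_sub_swap]
  have comm : ∀ (p q : ℝ → ℝ≥0∞) (x : ℝ), ∫⁻ u, p u * q (x - u) = ∫⁻ u, q u * p (x - u) :=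
    fun p q x => by
      rw [← lintegral_sub_left_eq_self _ x]
      refine lintegral_congr fun u => ?_
      rw [sub_sub_cancel, mul_comm]
  induction n generalizing x with
  | zero =>
    rw [chainWeight_succ _ (hm 0 k)]
    simp only [chainWeight_zero]
    obtain rfl | rfl : k = 0 ∨ k = 1 := by fin_cases k <;> simp
    · simp only [Function.update_self]
      have : ∀ u, Function.update (fun _ : Fin 2 => F) 0 G (Fin.succ 0) (z - u) = F (z - u) :=
        fun u => by rw [Function.update_of_ne (by decide)]
      simp only [this]
      exact shift G F x z
    · have h1 : ∀ u, Function.update (fun _ : Fin 2 => F) 1 G (Fin.succ 0) (z - u) = G (z - u) :=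
        fun u => by
          show Function.update (fun _ : Fin 2 => F) 1 G 1 (z - u) = _
          rw [Function.update_self]
      have h2 : ∀ u, Function.update (fun _ : Fin 2 => F) 1 G 0 (u - x) = F (u - x) :=
        fun u => by rw [Function.update_of_ne (by decide)]
      simp only [h1, h2]
      rw [shift F G x z, comm]
      rfl
  | succ n ih =>
    rw [chainWeight_succ _ (hm (n + 1) k)]
    refine Fin.cases ?_ (fun k' => ?_) k
    · have : (fun i : Fin (n + 2) => Function.update (fun _ : Fin (n + 3) => F) 0 G i.succ) =
          fun _ => F := by
        funext i
        rw [Function.update_of_ne (Fin.succ_ne_zero i)]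
      simp only [this, Function.update_self]
      simp only [hF, hV.chainWeight_const]
      exact shift G (fun u => ENNReal.ofReal (convPow V (n + 1) u)) x z
    · have h1 : (fun i : Fin (n + 2) => Function.update (fun _ : Fin (n + 3) => F) k'.succ G i.succ) =
          Function.update (fun _ => F) k' G := by
        funext i
        by_cases h : i = k'
        · subst h; simp
        · rw [Function.update_of_ne h, Function.update_of_ne (by simpa using h)]
      have h2 : Function.update (fun _ : Fin (n + 3) => F) k'.succ G 0 = F := by
        rw [Function.update_of_ne (Fin.succ_ne_zero k').symm]
      simp only [h1, h2, ih]
      rw [shift F (fun w => ∫⁻ v, G v * ENNReal.ofReal (convPow V n (w - v))) x z]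
      simp only [hV.ofReal_convPow_succ]
      have e1 : ∀ u, F u * ∫⁻ v, G v * ENNReal.ofReal (convPow V n (z - x - u - v)) =
          ∫⁻ v, F u * (G v * ENNReal.ofReal (convPow V n (z - x - u - v))) := fun u => by
        have := hqm n
        rw [lintegral_const_mul _ (by fun_prop)]
      have e2 : ∀ v, G v * ∫⁻ u, F u * ENNReal.ofReal (convPow V n (z - x - v - u)) =
          ∫⁻ u, F u * (G v * ENNReal.ofReal (convPow V n (z - x - u - v))) := fun v => by
        have := hqm n
        rw [← lintegral_const_mul _ (by fun_prop)]
        refine lintegral_congr fun u => ?_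
        rw [sub_right_comm]
        ring
      simp only [e1]
      show _ = ∫⁻ v, G v * ∫⁻ u, F u * ENNReal.ofReal (convPow V n (z - x - v - u))
      simp only [e2]
      rw [lintegral_lintegral_swap]
      have := hqm n
      fun_prop

end powers

theorem ofHeights_eq_path {n : ℕ} (y : Fin (n + 1) → ℝ) :
    (ofHeights (N := n + 2) y).1 = path 0 y 0 := by
  funext i
  refine Fin.cases ?_ (fun j => ?_) i
  · simp [ofHeights, path]
  · refine Fin.lastCases ?_ (fun k => ?_) j
    · simp only [path, Fin.cons_succ, Fin.snoc_last, ofHeights]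
      simp
    · simp only [path, Fin.cons_succ, Fin.snoc_castSucc, ofHeights]
      have hk := k.2
      rw [dif_pos ⟨by simp, by simp; omega⟩]
      congr 1

theorem measurable_height {N : ℕ} (i : Fin (N + 1)) : Measurable fun x : Interface N => x.1 i :=
  (measurable_pi_apply i).comp measurable_subtype_coe

/-! ### Increments under the equilibrium measure -/

section equilibrium

variable {V : ℝ → ℝ}

theorem measurable_hamiltonian {N : ℕ} (hV : Measurable V) :
    Measurable (hamiltonian V : Interface N → ℝ) :=
  Finset.measurable_sum _ fun _i _ =>
    hV.comp ((measurable_height _).sub (measurable_height _))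

theorem exp_neg_hamiltonian {N : ℕ} (V : ℝ → ℝ) (x : Interface N) :
    ENNReal.ofReal (Real.exp (-hamiltonian V x)) =
      ∏ i : Fin N, ENNReal.ofReal (Real.exp (-V (x.1 i.succ - x.1 i.castSucc))) := by
  rw [← ENNReal.ofReal_prod_of_nonneg fun _ _ => (Real.exp_pos _).le, ← Real.exp_sum,
    hamiltonian, Finset.sum_neg_distrib]

theorem IsConfining.integral_exp_neg_hamiltonian (hV : IsConfining V) (n : ℕ) :
    ∫ z, Real.exp (-hamiltonian V z) ∂(lebesgue (n + 2)) = convPow V (n + 1) 0 := by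
  have hm : Measurable fun x : Interface (n + 2) => Real.exp (-hamiltonian V x) :=
    (measurable_hamiltonian hV.measurable).neg.exp
  rw [integral_eq_lintegral_of_nonneg_ae (Eventually.of_forall fun x => (Real.exp_pos _).le)
    hm.aestronglyMeasurable, lebesgue, lintegral_map hm.ennreal_ofReal measurable_ofHeights]
  simp only [exp_neg_hamiltonian, ofHeights_eq_path]
  have := hV.chainWeight_const (n + 1) 0 0
  rw [chainWeight, sub_zero] at this
  erw [this]
  rw [ENNReal.toReal_ofReal (convPow_nonneg _ _ _)]

/-- The event only replaces the k-th factor of the product density by its restriction to `s`. The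
answer is the same for every k, which reduces tail bounds to a statement about one real density. -/
theorem IsConfining.equilibrium_increment (hV : IsConfining V) {n : ℕ} (k : Fin (n + 2))
    {s : Set ℝ} (hs : MeasurableSet s) :
    equilibrium V (n + 2) {x | x.1 k.succ - x.1 k.castSucc ∈ s} =
      ENNReal.ofReal (convPow V (n + 1) 0)⁻¹ * ∫⁻ u in s,
        ENNReal.ofReal (Real.exp (-V u)) * ENNReal.ofReal (convPow V n (-u)) := by
  have hVm := hV.measurable
  have hinc : Measurable fun x : Interface (n + 2) => x.1 k.succ - x.1 k.castSucc :=
    (measurable_height _).sub (measurable_height _)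
  have hset : MeasurableSet {x : Interface (n + 2) | x.1 k.succ - x.1 k.castSucc ∈ s} := hinc hs
  have hm : Measurable fun x : Interface (n + 2) => ENNReal.ofReal (Real.exp (-hamiltonian V x)) :=
    (measurable_hamiltonian hV.measurable).neg.exp.ennreal_ofReal
  have h0 := hV.convPow_pos (n + 1) 0
  set F : ℝ → ℝ≥0∞ := fun u => ENNReal.ofReal (Real.exp (-V u)) with hF
  set G : ℝ → ℝ≥0∞ := s.indicator F with hG
  have hFm : Measurable F := by fun_prop
  have hGm : Measurable G := hFm.indicator hs
  rw [equilibrium, withDensity_apply _ hset, hV.integral_exp_neg_hamiltonian]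
  have e1 : ∀ x : Interface (n + 2),
      ENNReal.ofReal (Real.exp (-hamiltonian V x) / convPow V (n + 1) 0) =
      ENNReal.ofReal (convPow V (n + 1) 0)⁻¹ * ENNReal.ofReal (Real.exp (-hamiltonian V x)) :=
    fun x => by rw [← ENNReal.ofReal_mul (inv_nonneg.2 h0.le), div_eq_inv_mul]
  simp only [e1]
  rw [lintegral_const_mul _ hm, ← lintegral_indicator hset, lebesgue,
    lintegral_map (hm.indicator hset) measurable_ofHeights]
  congr 1
  have e2 : ∀ y : Fin (n + 1) → ℝ,
      ({x : Interface (n + 2) | x.1 k.succ - x.1 k.castSucc ∈ s}.indicator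
        fun x => ENNReal.ofReal (Real.exp (-hamiltonian V x))) (ofHeights y) =
      ∏ i, Function.update (fun _ : Fin (n + 2) => F) k G i
        (path 0 y 0 i.succ - path 0 y 0 i.castSucc) := fun y => by
    have hmem : (ofHeights (N := n + 2) y ∈
        {x : Interface (n + 2) | x.1 k.succ - x.1 k.castSucc ∈ s}) ↔
        path 0 y 0 k.succ - path 0 y 0 k.castSucc ∈ s := by
      rw [← ofHeights_eq_path]; rfl
    by_cases h : ofHeights (N := n + 2) y ∈
        {x : Interface (n + 2) | x.1 k.succ - x.1 k.castSucc ∈ s}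
    · rw [Set.indicator_of_mem h, exp_neg_hamiltonian, ofHeights_eq_path]
      refine Finset.prod_congr rfl fun i _ => ?_
      by_cases hik : i = k
      · subst hik
        rw [Function.update_self, hG, Set.indicator_of_mem (hmem.1 h)]
      · rw [Function.update_of_ne hik]
    · rw [Set.indicator_of_notMem h]
      refine (Finset.prod_eq_zero (Finset.mem_univ k) ?_).symm
      rw [Function.update_self, hG, Set.indicator_of_notMem (fun h' => h (hmem.2 h'))]
  have h3 := hV.chainWeight_update hGm n k 0 0
  rw [chainWeight] at h3
  calc _ = ∫⁻ y : Fin (n + 1) → ℝ, ∏ i, Function.update (fun _ : Fin (n + 2) => F) k G i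
        (path 0 y 0 i.succ - path 0 y 0 i.castSucc) := lintegral_congr e2
    _ = _ := h3
    _ = _ := by
      rw [← lintegral_indicator hs]
      refine lintegral_congr fun u => ?_
      by_cases hu : u ∈ s <;> simp [hG, hu, hF]

/-- Under the equilibrium measure the increments over two steps have exponential tails, uniformly
in `N`. -/
theorem IsConfining.exists_equilibrium_tail (hV : IsConfining V) :
    ∃ A : ℝ, 0 < A ∧ ∀ N : ℕ, 2 ≤ N → ∀ (k : Fin (N - 1)) (j : ℕ),
      equilibrium V N {x | 2 * (A + 2 * A * j) < |x.1 (right k) - x.1 (left k)|} ≤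
        ENNReal.ofReal (4 * Real.exp (-j)) := by
  obtain ⟨A, hA, h⟩ := hV.exists_tail_le
  refine ⟨A, hA, fun N hN k j => ?_⟩
  have hR : 0 < A + 2 * A * j := by positivity
  obtain ⟨m, rfl⟩ : ∃ m, N = m + 2 := ⟨N - 2, by omega⟩
  -- For N = 2 both neighbours of the only site are pinned at 0 and the event is empty. The bound on
  -- conditioned increments needs at least three of them.
  rcases Nat.eq_zero_or_pos m with rfl | hm
  · have : {x : Interface (0 + 2) | 2 * (A + 2 * A * j) < |x.1 (right k) - x.1 (left k)|} = ∅ := by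
      refine Set.eq_empty_of_forall_notMem fun x hx => ?_
      have hk : k = ⟨0, by omega⟩ := by
        have := k.2; ext; simp at this ⊢
      have h1 : x.1 (right k) = 0 := by rw [hk]; exact x.2.2
      have h2 : x.1 (left k) = 0 := by rw [hk]; exact x.2.1
      have hx' : 2 * (A + 2 * A * j) < |x.1 (right k) - x.1 (left k)| := hx
      rw [h1, h2] at hx'
      simp at hx'
      linarith
    rw [this]
    simp
  obtain ⟨n, rfl⟩ : ∃ n, m = n + 1 := ⟨m - 1, by omega⟩
  set s : Set ℝ := {u | A + 2 * A * j < |u|} with hs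
  have hsm : MeasurableSet s := measurableSet_lt measurable_const measurable_norm
  have one : ∀ i : Fin (n + 1 + 2), equilibrium V (n + 1 + 2)
      {x | x.1 i.succ - x.1 i.castSucc ∈ s} ≤ ENNReal.ofReal (2 * Real.exp (-j)) := fun i => by
    rw [hV.equilibrium_increment i hsm]
    calc _ ≤ ENNReal.ofReal (convPow V (n + 2) 0)⁻¹ *
          (ENNReal.ofReal (2 * Real.exp (-j)) * ENNReal.ofReal (convPow V (n + 2) 0)) := by
          gcongr
          exact h n j
      _ = _ := by
          have h0 := hV.convPow_pos (n + 2) 0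
          rw [mul_left_comm, ← ENNReal.ofReal_mul (inv_nonneg.2 h0.le), inv_mul_cancel₀ h0.ne']
          simp
  have hk := k.2
  set i₁ : Fin (n + 1 + 2) := ⟨k.1, by omega⟩
  set i₂ : Fin (n + 1 + 2) := ⟨k.1 + 1, by omega⟩
  calc _ ≤ equilibrium V (n + 1 + 2) ({x | x.1 i₁.succ - x.1 i₁.castSucc ∈ s} ∪
        {x | x.1 i₂.succ - x.1 i₂.castSucc ∈ s}) := by
        refine measure_mono fun x hx => ?_
        by_contra hcon
        have hx' : 2 * (A + 2 * A * j) < |x.1 (right k) - x.1 (left k)| := hx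
        have hcon' := not_or.1 hcon
        have h1 : |x.1 i₁.succ - x.1 i₁.castSucc| ≤ A + 2 * A * j := not_lt.1 hcon'.1
        have h2 : |x.1 i₂.succ - x.1 i₂.castSucc| ≤ A + 2 * A * j := not_lt.1 hcon'.2
        have e1 : i₁.succ = i₂.castSucc := rfl
        have e2 : i₂.succ = right k := rfl
        have e3 : i₁.castSucc = left k := rfl
        rw [e1, e3] at h1
        rw [e2] at h2
        have := abs_sub_le (x.1 (right k)) (x.1 i₂.castSucc) (x.1 (left k))
        linarith
    _ ≤ _ := measure_union_le _ _
    _ ≤ _ := add_le_add (one i₁) (one i₂)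
    _ = _ := by
        rw [← ENNReal.ofReal_add (by positivity) (by positivity)]
        congr 1; ring

end equilibrium

/-! ### Regularity of the conditional densities -/

section rho

variable {V : ℝ → ℝ}

/-- The unnormalized conditional density of a height given its neighbours. -/
noncomputable def rhoWeight (V : ℝ → ℝ) (b c u : ℝ) : ℝ := Real.exp (-V (u - b) - V (c - u))

theorem rhoWeight_pos (V : ℝ → ℝ) (b c u : ℝ) : 0 < rhoWeight V b c u := Real.exp_pos _

theorem IsConfining.continuous_rhoWeight (hV : IsConfining V) (b c : ℝ) :
    Continuous (rhoWeight V b c) := by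
  have := hV.continuous
  unfold rhoWeight
  fun_prop

theorem rho_eq (V : ℝ → ℝ) (b c u : ℝ) :
    rho V b c u = rhoWeight V b c u / ∫ s, rhoWeight V b c s := rfl

/-- Convex functions of polynomial growth have polynomially growing Lipschitz constants. -/
theorem IsConfining.exists_abs_sub_le (hV : IsConfining V) :
    ∃ C : ℝ, 1 ≤ C ∧ ∃ K : ℕ, ∀ x y : ℝ, |V x - V y| ≤ C * (1 + |x| + |y|) ^ K * |x - y| := by
  obtain ⟨C, hC, K, h⟩ := hV.growth
  have hstep : ∀ x z y, |z| ≤ |x| + |y| + 1 → |V z| ≤ C * (2 * (1 + |x| + |y|)) ^ K :=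
    fun x z y hz => (h z).trans (by gcongr; linarith [abs_nonneg x, abs_nonneg y])
  -- The slope over [x, y] lies between the unit difference quotients over [x - 1, x] and [y, y +
  -- 1], which polynomial growth controls.
  have key : ∀ x y, x < y →
      |V x - V y| ≤ 2 * (C * (2 * (1 + |x| + |y|)) ^ K) * |x - y| := fun x y hxy => by
    have h1 := hV.convex.slope_mono_adjacent (Set.mem_univ x) (Set.mem_univ (y + 1)) hxy
      (by linarith : y < y + 1)
    have h2 := hV.convex.slope_mono_adjacent (Set.mem_univ (x - 1)) (Set.mem_univ y)
      (by linarith : x - 1 < x) hxy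
    rw [add_sub_cancel_left, div_one, div_le_iff₀ (by linarith)] at h1
    rw [sub_sub_cancel, div_one, le_div_iff₀ (by linarith)] at h2
    have a1 := abs_le.1 (hstep x (y + 1) y (by
      have := abs_add_le y 1; rw [abs_one] at this; linarith [abs_nonneg x]))
    have a2 := abs_le.1 (hstep x y y (by linarith [abs_nonneg x]))
    have a3 := abs_le.1 (hstep x x y (by linarith [abs_nonneg y]))
    have a4 := abs_le.1 (hstep x (x - 1) y (by
      have := abs_sub x 1; rw [abs_one] at this; linarith [abs_nonneg y]))
    rw [abs_sub_comm x y, abs_of_pos (by linarith : 0 < y - x), abs_le]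
    constructor <;> nlinarith
  refine ⟨2 * C * 2 ^ K, by nlinarith [one_le_pow₀ (one_le_two : (1 : ℝ) ≤ 2) (n := K)], K,
    fun x y => ?_⟩
  have e : ∀ x y : ℝ, 2 * (C * (2 * (1 + |x| + |y|)) ^ K) * |x - y| =
      2 * C * 2 ^ K * (1 + |x| + |y|) ^ K * |x - y| := fun x y => by rw [mul_pow]; ring
  rcases lt_trichotomy x y with hxy | rfl | hxy
  · rw [← e]; exact key x y hxy
  · simp
  · rw [← e, abs_sub_comm, abs_sub_comm x y, add_right_comm]
    exact key y x hxy

/-- Centred at the midpoint of the neighbours, the weight depends only on c - b and is even in v. -/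
theorem rhoWeight_mid (V : ℝ → ℝ) (b c v : ℝ) :
    rhoWeight V b c ((b + c) / 2 + v) =
      Real.exp (-(V ((c - b) / 2 + v) + V ((c - b) / 2 - v))) := by
  unfold rhoWeight
  congr 1
  rw [show (b + c) / 2 + v - b = (c - b) / 2 + v by ring,
    show c - ((b + c) / 2 + v) = (c - b) / 2 - v by ring]
  ring

theorem IsConfining.exists_rhoWeight_mid_le (hV : IsConfining V) :
    ∃ a D : ℝ, 0 < a ∧ 0 ≤ D ∧ (∀ x, -(D / 2) ≤ V x) ∧ ∀ b c v : ℝ,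
      rhoWeight V b c ((b + c) / 2 + v) ≤ Real.exp D * Real.exp (-(2 * a * |v|)) := by
  obtain ⟨a, b0, ha, h⟩ := hV.lower
  refine ⟨a, 2 * |b0|, ha, by positivity, fun x => ?_, fun b c v => ?_⟩
  · have := h x
    have := mul_nonneg ha.le (abs_nonneg x)
    linarith [le_abs_self b0]
  · rw [rhoWeight_mid, ← Real.exp_add]
    refine Real.exp_le_exp.2 ?_
    have h1 := h ((c - b) / 2 + v)
    have h2 := h ((c - b) / 2 - v)
    have h3 : 2 * |v| ≤ |(c - b) / 2 + v| + |(c - b) / 2 - v| := by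
      have := abs_sub ((c - b) / 2 + v) ((c - b) / 2 - v)
      have e : (c - b) / 2 + v - ((c - b) / 2 - v) = 2 * v := by ring
      rw [e, abs_mul, abs_two] at this
      exact this
    nlinarith [le_abs_self b0]

theorem IsConfining.integrable_pow_mul_rhoWeight_mid (hV : IsConfining V) (k : ℕ) (b c : ℝ) :
    Integrable fun v => (1 + |v|) ^ k * rhoWeight V b c ((b + c) / 2 + v) := by
  obtain ⟨a, D, ha, -, -, h⟩ := hV.exists_rhoWeight_mid_le
  have hc := hV.continuous_rhoWeight b c
  refine ((integrable_one_add_pow_mul_exp_neg_abs k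
    (by positivity : 0 < 2 * a)).const_mul (Real.exp D)).mono'
    (by fun_prop : Continuous _).aestronglyMeasurable (Eventually.of_forall fun v => ?_)
  rw [norm_mul, Real.norm_eq_abs, Real.norm_eq_abs, abs_of_pos (rhoWeight_pos _ _ _ _),
    abs_of_nonneg (by positivity)]
  calc (1 + |v|) ^ k * rhoWeight V b c ((b + c) / 2 + v)
      ≤ (1 + |v|) ^ k * (Real.exp D * Real.exp (-(2 * a * |v|))) := by gcongr; exact h b c v
    _ = _ := by ring

theorem IsConfining.integrable_rhoWeight (hV : IsConfining V) (b c : ℝ) :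
    Integrable (rhoWeight V b c) := by
  have := (hV.integrable_pow_mul_rhoWeight_mid 0 b c).comp_sub_right ((b + c) / 2)
  simpa using this

theorem IsConfining.integral_rhoWeight_pos (hV : IsConfining V) (b c : ℝ) :
    0 < ∫ u, rhoWeight V b c u := by
  rw [integral_pos_iff_support_of_nonneg (fun u => (rhoWeight_pos V b c u).le)
    (hV.integrable_rhoWeight b c)]
  have : Function.support (rhoWeight V b c) = Set.univ :=
    Set.eq_univ_of_forall fun u => (rhoWeight_pos V b c u).ne'
  simp [this]

theorem one_add_abs_add_abs_le (b c v : ℝ) :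
    1 + |(b + c) / 2 + v - b| + |c - ((b + c) / 2 + v)| ≤ 2 * (1 + |c - b|) * (1 + |v|) := by
  have h1 : |(b + c) / 2 + v - b| ≤ |c - b| / 2 + |v| := by
    have := abs_add_le ((c - b) / 2) v
    rw [abs_div, abs_two] at this
    rwa [show (b + c) / 2 + v - b = (c - b) / 2 + v by ring]
  have h2 : |c - ((b + c) / 2 + v)| ≤ |c - b| / 2 + |v| := by
    have := abs_sub ((c - b) / 2) v
    rw [abs_div, abs_two] at this
    rwa [show c - ((b + c) / 2 + v) = (c - b) / 2 - v by ring]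
  nlinarith [abs_nonneg (c - b), abs_nonneg v, mul_nonneg (abs_nonneg (c - b)) (abs_nonneg v)]

/-- Polynomial moments of the conditional density grow polynomially in the distance between the
neighbouring heights. -/
theorem IsConfining.exists_moment_rhoWeight_le (hV : IsConfining V) (k : ℕ) :
    ∃ C : ℝ, 1 ≤ C ∧ ∃ K : ℕ, ∀ b c : ℝ,
      Integrable (fun u => (1 + |u - b| + |c - u|) ^ k * rhoWeight V b c u) ∧
      ∫ u, (1 + |u - b| + |c - u|) ^ k * rhoWeight V b c u ≤
        C * (1 + |c - b|) ^ K * ∫ u, rhoWeight V b c u := by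
  obtain ⟨a, D, ha, hD, hlow, hmid⟩ := hV.exists_rhoWeight_mid_le
  obtain ⟨C₁, hC₁, K₁, h₁⟩ := hV.growth
  obtain ⟨C₂, hC₂, K₂, h₂⟩ := hV.exists_abs_sub_le
  set E := ∫ v : ℝ, (1 + |v|) ^ k * Real.exp (-(a * |v|)) with hE
  have hE0 : 0 ≤ E := integral_nonneg fun v => by positivity
  have hEi := integrable_one_add_pow_mul_exp_neg_abs k ha
  set B := 1 + (2 * C₁ + D) / a with hB
  have hB1 : 1 ≤ B := le_add_of_nonneg_right (by positivity)
  set C₃ := 2 * C₂ * 2 ^ K₂ with hC₃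
  have hC₃0 : 1 ≤ C₃ := by
    have := one_le_pow₀ (one_le_two : (1 : ℝ) ≤ 2) (n := K₂)
    nlinarith
  refine ⟨2 ^ k * (B ^ k + E * Real.exp 1 * C₃), ?_, k + (K₁ * k + K₂), fun b c => ?_⟩
  · have h2 := one_le_pow₀ (one_le_two : (1 : ℝ) ≤ 2) (n := k)
    have h3 := one_le_pow₀ hB1 (n := k)
    have : 0 ≤ E * Real.exp 1 * C₃ := by positivity
    nlinarith
  set σ := 1 + |c - b| with hσ
  have hσ1 : 1 ≤ σ := le_add_of_nonneg_right (abs_nonneg _)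
  set g : ℝ → ℝ := fun v => rhoWeight V b c ((b + c) / 2 + v) with hg
  have hg0 : ∀ v, 0 < g v := fun v => rhoWeight_pos _ _ _ _
  have hgi : Integrable g := by simpa using hV.integrable_pow_mul_rhoWeight_mid 0 b c
  have hgk := hV.integrable_pow_mul_rhoWeight_mid k b c
  have hshift : ∀ f : ℝ → ℝ, ∫ u, f u = ∫ v, f ((b + c) / 2 + v) := fun f =>
    (integral_add_left_eq_self f _).symm
  have hpt : ∀ v, (1 + |(b + c) / 2 + v - b| + |c - ((b + c) / 2 + v)|) ^ k * g v ≤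
      (2 * σ) ^ k * ((1 + |v|) ^ k * g v) := fun v => by
    rw [← mul_assoc, ← mul_pow]
    have := one_add_abs_add_abs_le b c v
    have := (hg0 v).le
    gcongr
  have hI : Integrable fun v => (1 + |(b + c) / 2 + v - b| + |c - ((b + c) / 2 + v)|) ^ k * g v := by
    have hc : Continuous g := by
      have := hV.continuous_rhoWeight b c
      simp only [hg]; fun_prop
    refine (hgk.const_mul ((2 * σ) ^ k)).mono'
      (by fun_prop : Continuous _).aestronglyMeasurable (Eventually.of_forall fun v => ?_)
    rw [Real.norm_of_nonneg (mul_nonneg (by positivity) (hg0 v).le)]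
    exact hpt v
  refine ⟨by simpa [hg] using hI.comp_sub_right ((b + c) / 2), ?_⟩
  rw [hshift, hshift (rhoWeight V b c)]
  have hgv : ∀ v, g v = Real.exp (-(V ((c - b) / 2 + v) + V ((c - b) / 2 - v))) :=
    rhoWeight_mid V b c
  have hg0v : g 0 = Real.exp (-(2 * V ((c - b) / 2))) := by
    rw [hgv]; congr 1; simp; ring
  have hs : |(c - b) / 2| ≤ |c - b| := by
    rw [abs_div, abs_two]; linarith [abs_nonneg (c - b)]
  -- Up to distance Bσ^K₁ the polynomial is simply bounded. Beyond it, the decay e^{-2a|v|} beats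
  -- both e^D and the possible smallness e^{-2C₁σ^K₁} of g 0, leaving g v ≤ g 0 e^{-a|v|}.
  have htail : ∀ v, (1 + |v|) ^ k * g v ≤
      (B * σ ^ K₁) ^ k * g v + g 0 * ((1 + |v|) ^ k * Real.exp (-(a * |v|))) := fun v => by
    have hp0 : (0 : ℝ) ≤ (1 + |v|) ^ k := by positivity
    rcases le_total (1 + |v|) (B * σ ^ K₁) with hv | hv
    · have h1 : (1 + |v|) ^ k * g v ≤ (B * σ ^ K₁) ^ k * g v := by
        have := (hg0 v).le
        gcongr
      have h2 : 0 ≤ g 0 * ((1 + |v|) ^ k * Real.exp (-(a * |v|))) :=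
        mul_nonneg (hg0 0).le (by positivity)
      linarith
    · have h1 : g v ≤ g 0 * Real.exp (-(a * |v|)) := by
        refine (hmid b c v).trans ?_
        rw [hg0v, ← Real.exp_add, ← Real.exp_add]
        refine Real.exp_le_exp.2 ?_
        have h3 : V ((c - b) / 2) ≤ C₁ * σ ^ K₁ := (le_abs_self _).trans ((h₁ _).trans (by
          gcongr
          linarith))
        have hσK : 1 ≤ σ ^ K₁ := one_le_pow₀ hσ1
        have h4 : (2 * C₁ + D) / a * σ ^ K₁ ≤ |v| := by
          have : B * σ ^ K₁ = σ ^ K₁ + (2 * C₁ + D) / a * σ ^ K₁ := by rw [hB]; ring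
          linarith
        rw [div_mul_eq_mul_div, div_le_iff₀ ha] at h4
        nlinarith
      have h2 : (1 + |v|) ^ k * g v ≤ (1 + |v|) ^ k * (g 0 * Real.exp (-(a * |v|))) := by gcongr
      have h3 : 0 ≤ (B * σ ^ K₁) ^ k * g v := mul_nonneg (by positivity) (hg0 v).le
      linarith
  -- By the local Lipschitz bound on V, g stays above g 0 / e on an interval of length δ, the
  -- inverse of a polynomial in σ. So g 0 is at most a polynomial times the total mass.
  have hlowint : g 0 ≤ Real.exp 1 * C₃ * σ ^ K₂ * ∫ v, g v := by
    set δ := 1 / (C₃ * σ ^ K₂) with hδ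
    have hCσ : 1 ≤ C₃ * σ ^ K₂ := by
      have hσK : 1 ≤ σ ^ K₂ := one_le_pow₀ hσ1
      nlinarith
    have hδ0 : 0 < δ := by positivity
    have hδ1 : δ ≤ 1 := by rw [hδ]; exact (div_le_one (by linarith)).2 hCσ
    have hlo : ∀ v ∈ Set.Ioc 0 δ, g 0 * Real.exp (-1) ≤ g v := fun v hv => by
      rw [hg0v, hgv, ← Real.exp_add]
      refine Real.exp_le_exp.2 ?_
      have hv1 : |v| ≤ 1 := by rw [abs_of_pos hv.1]; exact hv.2.trans hδ1
      have p1 : ∀ w, |w| ≤ |v| → V ((c - b) / 2 + w) - V ((c - b) / 2) ≤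
          C₂ * (2 * σ) ^ K₂ * |v| := fun w hw => by
        refine (le_abs_self _).trans ((h₂ _ _).trans ?_)
        rw [add_sub_cancel_left]
        have h5 := abs_add_le ((c - b) / 2) w
        have h6 : |(c - b) / 2| = |c - b| / 2 := by rw [abs_div, abs_two]
        gcongr
        linarith
      have q1 := p1 v le_rfl
      have q2 := p1 (-v) (by rw [abs_neg])
      rw [← sub_eq_add_neg] at q2
      have q3 : 2 * (C₂ * (2 * σ) ^ K₂ * |v|) ≤ 1 := by
        have : 2 * (C₂ * (2 * σ) ^ K₂ * |v|) = (C₃ * σ ^ K₂) * |v| := by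
          rw [mul_pow, hC₃]; ring
        rw [this, abs_of_pos hv.1]
        calc (C₃ * σ ^ K₂) * v ≤ (C₃ * σ ^ K₂) * δ := by gcongr; exact hv.2
          _ = 1 := by rw [hδ]; field_simp
      linarith
    have h7 : δ * (g 0 * Real.exp (-1)) ≤ ∫ v, g v := by
      calc δ * (g 0 * Real.exp (-1)) = ∫ _ in Set.Ioc 0 δ, g 0 * Real.exp (-1) := by
            simp [hδ0.le]
        _ ≤ ∫ v in Set.Ioc 0 δ, g v :=
            setIntegral_mono_on continuous_const.integrableOn_Ioc hgi.integrableOn measurableSet_Ioc hlo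
        _ ≤ _ := setIntegral_le_integral hgi (Eventually.of_forall fun v => (hg0 v).le)
    have h8 : g 0 = Real.exp 1 * C₃ * σ ^ K₂ * (δ * (g 0 * Real.exp (-1))) := by
      rw [hδ, Real.exp_neg]
      field_simp
    rw [h8]
    gcongr
  have hint : ∫ v, (1 + |v|) ^ k * g v ≤
      ((B * σ ^ K₁) ^ k + E * Real.exp 1 * C₃ * σ ^ K₂) * ∫ v, g v := by
    calc ∫ v, (1 + |v|) ^ k * g v
        ≤ ∫ v, ((B * σ ^ K₁) ^ k * g v + g 0 * ((1 + |v|) ^ k * Real.exp (-(a * |v|)))) :=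
          integral_mono hgk ((hgi.const_mul _).add (hEi.const_mul _)) htail
      _ = (B * σ ^ K₁) ^ k * (∫ v, g v) + g 0 * E := by
          rw [integral_add (hgi.const_mul _) (hEi.const_mul _), integral_const_mul,
            integral_const_mul]
      _ ≤ (B * σ ^ K₁) ^ k * (∫ v, g v) + (Real.exp 1 * C₃ * σ ^ K₂ * ∫ v, g v) * E := by gcongr
      _ = _ := by ring
  have hIg : 0 ≤ ∫ v, g v := integral_nonneg fun v => (hg0 v).le
  calc ∫ v, (1 + |(b + c) / 2 + v - b| + |c - ((b + c) / 2 + v)|) ^ k * g v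
      ≤ ∫ v, (2 * σ) ^ k * ((1 + |v|) ^ k * g v) := integral_mono hI (hgk.const_mul _) hpt
    _ = (2 * σ) ^ k * ∫ v, (1 + |v|) ^ k * g v := integral_const_mul _ _
    _ ≤ (2 * σ) ^ k * (((B * σ ^ K₁) ^ k + E * Real.exp 1 * C₃ * σ ^ K₂) * ∫ v, g v) := by gcongr
    _ ≤ (2 * σ) ^ k * ((B ^ k * σ ^ (K₁ * k + K₂) + E * Real.exp 1 * C₃ * σ ^ (K₁ * k + K₂)) *
          ∫ v, g v) := by
        rw [mul_pow B, ← pow_mul]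
        gcongr <;> first | exact hσ1 | omega
    _ = _ := by rw [mul_pow, pow_add]; ring

theorem IsConfining.lintegral_rho (hV : IsConfining V) (b c : ℝ) :
    ∫⁻ u, ENNReal.ofReal (rho V b c u) = 1 := by
  have hZ := hV.integral_rhoWeight_pos b c
  have hi : Integrable (rho V b c) := (hV.integrable_rhoWeight b c).div_const _
  rw [← ofReal_integral_eq_lintegral_ofReal hi
    (Eventually.of_forall fun u => rho_nonneg V b c u)]
  have : ∫ u, rho V b c u = 1 := by
    simp only [rho_eq]
    rw [integral_div, div_self hZ.ne']
  rw [this, ENNReal.ofReal_one]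

theorem measurable_rho_right (hV : Measurable V) (b c : ℝ) : Measurable (rho V b c) :=
  (measurable_rho hV).comp (measurable_prodMk_left (x := (b, c)))

/-- Both densities have mass one, so their positive and negative differences balance. This lets the
Lipschitz estimate normalize by whichever constant is larger. -/
theorem IsConfining.lintegral_rho_sub_comm (hV : IsConfining V) (b c b' c' : ℝ) :
    ∫⁻ u, ENNReal.ofReal (rho V b c u - rho V b' c' u) =
      ∫⁻ u, ENNReal.ofReal (rho V b' c' u - rho V b c u) := by
  have m1 := measurable_rho_right hV.measurable b c
  have m2 := measurable_rho_right hV.measurable b' c'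
  have h : (∫⁻ u, ENNReal.ofReal (rho V b c u - rho V b' c' u)) + 1 =
      (∫⁻ u, ENNReal.ofReal (rho V b' c' u - rho V b c u)) + 1 := by
    nth_rw 1 [← hV.lintegral_rho b' c']
    rw [← hV.lintegral_rho b c, ← lintegral_add_left (by fun_prop),
      ← lintegral_add_left (by fun_prop)]
    refine lintegral_congr fun u => ?_
    rcases le_total (rho V b c u) (rho V b' c' u) with hu | hu
    · rw [ENNReal.ofReal_of_nonpos (by linarith : rho V b c u - rho V b' c' u ≤ 0), zero_add,
        ← ENNReal.ofReal_add (by linarith) (rho_nonneg _ _ _ _), sub_add_cancel]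
    · rw [ENNReal.ofReal_of_nonpos (by linarith : rho V b' c' u - rho V b c u ≤ 0), zero_add,
        ← ENNReal.ofReal_add (by linarith) (rho_nonneg _ _ _ _), sub_add_cancel]
  exact (ENNReal.add_left_inj ENNReal.one_ne_top).1 h

theorem abs_exp_sub_exp_le (x y : ℝ) :
    |Real.exp x - Real.exp y| ≤ |x - y| * Real.exp x + |x - y| * Real.exp y := by
  have key : ∀ x y : ℝ, x ≤ y → Real.exp y - Real.exp x ≤ (y - x) * Real.exp y := fun x y _ => by
    have := Real.add_one_le_exp (x - y)
    have h2 : Real.exp x = Real.exp (x - y) * Real.exp y := by rw [← Real.exp_add]; congr 1; ring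
    rw [h2]
    nlinarith [Real.exp_pos y]
  have hx := Real.exp_pos x
  have hy := Real.exp_pos y
  rcases le_total x y with h | h
  · rw [abs_sub_comm, abs_of_nonneg (by linarith [Real.exp_le_exp.2 h]), abs_sub_comm,
      abs_of_nonneg (by linarith)]
    nlinarith [key x y h]
  · rw [abs_of_nonneg (by linarith [Real.exp_le_exp.2 h]), abs_of_nonneg (by linarith)]
    nlinarith [key y x h]

/-- The conditional densities depend on the neighbouring heights in a Lipschitz way in total
variation, with a constant growing polynomially with the distance of these heights. -/
theorem IsConfining.exists_lintegral_rho_sub_le (hV : IsConfining V) :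
    ∃ C : ℝ, 1 ≤ C ∧ ∃ K : ℕ, ∀ (R b c b' c' : ℝ), |c' - b'| ≤ R →
      ∫⁻ u, ENNReal.ofReal (rho V b c u - rho V b' c' u) ≤
        ENNReal.ofReal (C * (1 + R) ^ K * (|b - b'| + |c - c'|)) := by
  obtain ⟨C₁, hC₁, k, h₁⟩ := hV.exists_abs_sub_le
  obtain ⟨C₂, hC₂, K, h₂⟩ := hV.exists_moment_rhoWeight_le k
  have h2k := one_le_pow₀ (one_le_two : (1 : ℝ) ≤ 2) (n := k)
  have h2K := one_le_pow₀ (one_le_two : (1 : ℝ) ≤ 2) (n := K)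
  refine ⟨2 * (C₁ * 2 ^ k) * (C₂ * 2 ^ K), ?_, K, fun R b c b' c' hR => ?_⟩
  · have : 1 ≤ C₁ * 2 ^ k := by nlinarith
    have : 1 ≤ C₂ * 2 ^ K := by nlinarith
    nlinarith
  have hR0 : 0 ≤ R := (abs_nonneg _).trans hR
  have hRK : 1 ≤ (1 + R) ^ K := one_le_pow₀ (by linarith)
  set δ := |b - b'| + |c - c'| with hδ
  -- For δ ≥ 1 the bound is trivial, the left side being at most 1. Otherwise |c - b| ≤ R + 1
  -- follows, which is why only the distance between `b'` and `c'` needs to be controlled.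
  rcases le_total 1 δ with hδ1 | hδ1
  · calc ∫⁻ u, ENNReal.ofReal (rho V b c u - rho V b' c' u)
        ≤ ∫⁻ u, ENNReal.ofReal (rho V b c u) := lintegral_mono fun u =>
          ENNReal.ofReal_le_ofReal (by linarith [rho_nonneg V b' c' u])
      _ = ENNReal.ofReal 1 := by rw [hV.lintegral_rho, ENNReal.ofReal_one]
      _ ≤ _ := by
          refine ENNReal.ofReal_le_ofReal ?_
          have h3 : 1 ≤ C₁ * 2 ^ k := by nlinarith
          have h4 : 1 ≤ C₂ * 2 ^ K := by nlinarith
          have h5 : 1 ≤ 2 * (C₁ * 2 ^ k) * (C₂ * 2 ^ K) := by nlinarith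
          have h6 : 1 ≤ 2 * (C₁ * 2 ^ k) * (C₂ * 2 ^ K) * (1 + R) ^ K := by nlinarith
          nlinarith
  have hδ0 : 0 ≤ δ := by positivity
  have hb : |b - b'| ≤ δ := le_add_of_nonneg_right (abs_nonneg _)
  have hc : |c - c'| ≤ δ := le_add_of_nonneg_left (abs_nonneg _)
  set Z := ∫ u, rhoWeight V b c u
  set Z' := ∫ u, rhoWeight V b' c' u
  have hZ : 0 < Z := hV.integral_rhoWeight_pos b c
  have hZ' : 0 < Z' := hV.integral_rhoWeight_pos b' c'
  obtain ⟨i1, m1⟩ := h₂ b c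
  obtain ⟨i2, m2⟩ := h₂ b' c'
  set P : ℝ → ℝ := fun u => (1 + |u - b| + |c - u|) ^ k * rhoWeight V b c u
  set P' : ℝ → ℝ := fun u => (1 + |u - b'| + |c' - u|) ^ k * rhoWeight V b' c' u
  have hdiff : ∀ u, |rhoWeight V b c u - rhoWeight V b' c' u| ≤
      C₁ * 2 ^ k * δ * (P u + P' u) := fun u => by
    -- As δ ≤ 1, the polynomial factor can be centred at either pair of neighbours, so that each
    -- exponential is multiplied by a polynomial in its own variables.
    have hexp : ∀ p : ℝ, 0 ≤ p → (1 + |u - b| + |u - b'|) ≤ 2 * p →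
        (1 + |c - u| + |c' - u|) ≤ 2 * p →
        |(-V (u - b) - V (c - u)) - (-V (u - b') - V (c' - u))| ≤ C₁ * 2 ^ k * δ * p ^ k := by
      intro p hp hp1 hp2
      have a1 := h₁ (u - b) (u - b')
      have a2 := h₁ (c - u) (c' - u)
      rw [show u - b - (u - b') = -(b - b') by ring, abs_neg] at a1
      rw [show c - u - (c' - u) = c - c' by ring] at a2
      have a3 : |(-V (u - b) - V (c - u)) - (-V (u - b') - V (c' - u))| ≤
          |V (u - b) - V (u - b')| + |V (c - u) - V (c' - u)| := by
        have e : (-V (u - b) - V (c - u)) - (-V (u - b') - V (c' - u)) =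
            -((V (u - b) - V (u - b')) + (V (c - u) - V (c' - u))) := by ring
        rw [e, abs_neg]
        exact abs_add_le _ _
      calc _ ≤ C₁ * (1 + |u - b| + |u - b'|) ^ k * |b - b'| +
            C₁ * (1 + |c - u| + |c' - u|) ^ k * |c - c'| := a3.trans (add_le_add a1 a2)
        _ ≤ C₁ * (2 * p) ^ k * |b - b'| + C₁ * (2 * p) ^ k * |c - c'| := by gcongr
        _ = _ := by rw [mul_pow, hδ]; ring
    have t1 : |u - b'| ≤ |u - b| + |b - b'| := by
      have := abs_sub_le u b b'; linarith
    have t2 : |u - b| ≤ |u - b'| + |b - b'| := by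
      have := abs_sub_le u b' b; rw [abs_sub_comm b' b] at this; linarith
    have t3 : |c' - u| ≤ |c - u| + |c - c'| := by
      have := abs_sub_le c' c u; rw [abs_sub_comm c' c] at this; linarith
    have t4 : |c - u| ≤ |c' - u| + |c - c'| := by
      have := abs_sub_le c c' u; linarith
    have n1 := abs_nonneg (u - b)
    have n2 := abs_nonneg (c - u)
    have n3 := abs_nonneg (u - b')
    have n4 := abs_nonneg (c' - u)
    have e1 := hexp (1 + |u - b| + |c - u|) (by positivity) (by linarith) (by linarith)
    have e2 := hexp (1 + |u - b'| + |c' - u|) (by positivity) (by linarith) (by linarith)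
    have w1 := (rhoWeight_pos V b c u).le
    have w2 := (rhoWeight_pos V b' c' u).le
    calc |rhoWeight V b c u - rhoWeight V b' c' u| ≤ _ := abs_exp_sub_exp_le _ _
      _ ≤ C₁ * 2 ^ k * δ * (1 + |u - b| + |c - u|) ^ k * rhoWeight V b c u +
          C₁ * 2 ^ k * δ * (1 + |u - b'| + |c' - u|) ^ k * rhoWeight V b' c' u :=
          add_le_add (mul_le_mul_of_nonneg_right e1 w1) (mul_le_mul_of_nonneg_right e2 w2)
      _ = _ := by simp only [P, P']; ring
  have hint : ∫ u, (P u + P' u) ≤ C₂ * 2 ^ K * (1 + R) ^ K * (Z + Z') := by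
    rw [integral_add i1 i2]
    have hcb : |c - b| ≤ R + 1 := by
      have e : c - b = (c - c') + (c' - b') + -(b - b') := by ring
      have := abs_add_three (c - c') (c' - b') (-(b - b'))
      rw [← e, abs_neg] at this
      linarith
    have r1 : C₂ * (1 + |c - b|) ^ K * Z ≤ C₂ * 2 ^ K * (1 + R) ^ K * Z := by
      rw [show C₂ * 2 ^ K * (1 + R) ^ K = C₂ * (2 * (1 + R)) ^ K by rw [mul_pow]; ring]
      gcongr
      linarith
    have r2 : C₂ * (1 + |c' - b'|) ^ K * Z' ≤ C₂ * 2 ^ K * (1 + R) ^ K * Z' := by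
      rw [show C₂ * 2 ^ K * (1 + R) ^ K = C₂ * (2 * (1 + R)) ^ K by rw [mul_pow]; ring]
      gcongr
      linarith
    linarith
  -- Y will be the larger normalization. Dividing both weights by it only increases the difference
  -- in the chosen direction, so the difference of the normalizing constants never has to be
  -- estimated.
  have final : ∀ Y : ℝ, 0 < Y → Z ≤ Y → Z' ≤ Y →
      ∫⁻ u, ENNReal.ofReal (|rhoWeight V b c u - rhoWeight V b' c' u| / Y) ≤
        ENNReal.ofReal (2 * (C₁ * 2 ^ k) * (C₂ * 2 ^ K) * (1 + R) ^ K * δ) := by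
    intro Y hY h1 h2
    have hi : Integrable fun u => C₁ * 2 ^ k * δ * (P u + P' u) / Y :=
      ((i1.add i2).const_mul _).div_const _
    calc _ ≤ ∫⁻ u, ENNReal.ofReal (C₁ * 2 ^ k * δ * (P u + P' u) / Y) :=
          lintegral_mono fun u => ENNReal.ofReal_le_ofReal (by gcongr; exact hdiff u)
      _ = ENNReal.ofReal (∫ u, C₁ * 2 ^ k * δ * (P u + P' u) / Y) := by
          rw [ofReal_integral_eq_lintegral_ofReal hi (Eventually.of_forall fun u => ?_)]
          have := (abs_nonneg _).trans (hdiff u)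
          exact div_nonneg this hY.le
      _ ≤ _ := by
          refine ENNReal.ofReal_le_ofReal ?_
          rw [integral_div, integral_const_mul, div_le_iff₀ hY]
          calc C₁ * 2 ^ k * δ * ∫ u, (P u + P' u)
              ≤ C₁ * 2 ^ k * δ * (C₂ * 2 ^ K * (1 + R) ^ K * (Z + Z')) := by gcongr
            _ ≤ C₁ * 2 ^ k * δ * (C₂ * 2 ^ K * (1 + R) ^ K * (Y + Y)) := by gcongr
            _ = _ := by ring
  rcases le_total Z' Z with hZZ | hZZ
  · refine le_trans (lintegral_mono fun u => ENNReal.ofReal_le_ofReal ?_) (final Z hZ le_rfl hZZ)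
    rw [rho_eq, rho_eq]
    have h1 : rhoWeight V b' c' u / Z ≤ rhoWeight V b' c' u / Z' := by
      have := (rhoWeight_pos V b' c' u).le
      gcongr
    calc _ ≤ rhoWeight V b c u / Z - rhoWeight V b' c' u / Z := by linarith
      _ = (rhoWeight V b c u - rhoWeight V b' c' u) / Z := by rw [sub_div]
      _ ≤ _ := by gcongr; exact le_abs_self _
  · rw [hV.lintegral_rho_sub_comm]
    refine le_trans (lintegral_mono fun u => ENNReal.ofReal_le_ofReal ?_) (final Z' hZ' hZZ le_rfl)
    rw [rho_eq, rho_eq]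
    have h1 : rhoWeight V b c u / Z' ≤ rhoWeight V b c u / Z := by
      have := (rhoWeight_pos V b c u).le
      gcongr
    calc _ ≤ rhoWeight V b' c' u / Z' - rhoWeight V b c u / Z' := by linarith
      _ = (rhoWeight V b' c' u - rhoWeight V b c u) / Z' := by rw [sub_div]
      _ ≤ _ := by rw [abs_sub_comm]; gcongr; exact le_abs_self _

end rho

/-! ### Quantile functions -/

section quantile

open ProbabilityTheory

/-- The quantile function of a probability measure on the line, set to `0` outside `(0, 1)`. -/
noncomputable def quantile (μ : Measure ℝ) (p : ℝ) : ℝ :=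
  open Classical in if p ∈ Set.Ioo (0 : ℝ) 1 then sInf {u | p ≤ cdf μ u} else 0

variable (μ : Measure ℝ)

/-- Right continuity of the distribution function makes the infimum attained; `quantile` is thus its
lower adjoint on (0, 1). -/
theorem quantile_le_iff {p : ℝ} (hp : p ∈ Set.Ioo (0 : ℝ) 1) (u : ℝ) :
    quantile μ p ≤ u ↔ p ≤ cdf μ u := by
  rw [quantile, if_pos hp]
  have hne : {u | p ≤ cdf μ u}.Nonempty := by
    obtain ⟨u, hu⟩ := ((tendsto_cdf_atTop μ).eventually_const_lt hp.2).exists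
    exact ⟨u, hu.le⟩
  have hbd : BddBelow {u | p ≤ cdf μ u} := by
    obtain ⟨m, hm⟩ := ((tendsto_cdf_atBot μ).eventually_lt_const hp.1).exists
    refine ⟨m, fun u hu => ?_⟩
    by_contra hlt
    have h1 := monotone_cdf μ (not_le.1 hlt).le
    have h2 : p ≤ cdf μ u := hu
    linarith
  constructor
  · intro h
    have hr := (cdf μ).right_continuous u
    have hr' : Tendsto (cdf μ) (𝓝[>] u) (𝓝 (cdf μ u)) :=
      hr.mono_left (nhdsWithin_mono _ Set.Ioi_subset_Ici_self)
    refine ge_of_tendsto hr' ?_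
    filter_upwards [self_mem_nhdsWithin] with v hv
    have hv' : sInf {u | p ≤ cdf μ u} < v := h.trans_lt hv
    obtain ⟨w, hw, hwv⟩ := exists_lt_of_csInf_lt hne hv'
    exact le_trans hw (monotone_cdf μ hwv.le)
  · exact fun h => csInf_le hbd h

theorem measurable_quantile : Measurable (quantile μ) := by
  refine measurable_of_Iic fun u => ?_
  have : quantile μ ⁻¹' Set.Iic u =
      (Set.Ioo (0 : ℝ) 1 ∩ Set.Iic (cdf μ u)) ∪ ((Set.Ioo (0 : ℝ) 1)ᶜ ∩ {_p | (0 : ℝ) ≤ u}) := by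
    ext p
    by_cases hp : p ∈ Set.Ioo (0 : ℝ) 1
    · have := quantile_le_iff μ hp u
      simp only [Set.mem_preimage, Set.mem_Iic, Set.mem_union, Set.mem_inter_iff, hp,
        Set.mem_compl_iff, true_and, not_true, false_and, or_false]
      exact this
    · simp only [Set.mem_preimage, Set.mem_Iic, Set.mem_union, Set.mem_inter_iff, hp,
        Set.mem_compl_iff, false_and, not_false_eq_true, true_and, false_or]
      rw [quantile, if_neg hp]
      rfl
  rw [this]
  exact (measurableSet_Ioo.inter measurableSet_Iic).union
    (measurableSet_Ioo.compl.inter (MeasurableSet.const _))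

theorem map_quantile [IsProbabilityMeasure μ] :
    (volume.restrict (Set.Ioo (0 : ℝ) 1)).map (quantile μ) = μ := by
  have : IsFiniteMeasure ((volume.restrict (Set.Ioo (0 : ℝ) 1)).map (quantile μ)) :=
    Measure.isFiniteMeasure_map _ _
  refine Measure.ext_of_Iic _ _ fun u => ?_
  rw [Measure.map_apply (measurable_quantile μ) measurableSet_Iic,
    Measure.restrict_apply (measurable_quantile μ measurableSet_Iic)]
  have hF0 := cdf_nonneg μ u
  have hF1 := cdf_le_one μ u
  have e : quantile μ ⁻¹' Set.Iic u ∩ Set.Ioo (0 : ℝ) 1 =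
      Set.Iic (cdf μ u) ∩ Set.Ioo (0 : ℝ) 1 := by
    ext p
    simp only [Set.mem_inter_iff, Set.mem_preimage, Set.mem_Iic]
    exact and_congr_left fun hp => quantile_le_iff μ hp u
  rw [e, ← ofReal_cdf]
  refine le_antisymm ?_ ?_
  · have hsub : Set.Iic (cdf μ u) ∩ Set.Ioo (0 : ℝ) 1 ⊆ Set.Ioc 0 (cdf μ u) :=
      fun p hp => ⟨hp.2.1, hp.1⟩
    exact (measure_mono hsub).trans (by simp)
  · have hsub : Set.Ioo 0 (cdf μ u) ⊆ Set.Iic (cdf μ u) ∩ Set.Ioo (0 : ℝ) 1 :=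
      fun p hp => ⟨hp.2.le, hp.1, hp.2.trans_le hF1⟩
    exact le_trans (by simp) (measure_mono hsub)

theorem quantile_le_quantile {μ ν : Measure ℝ} (h : ∀ u, cdf ν u ≤ cdf μ u) (p : ℝ) :
    quantile μ p ≤ quantile ν p := by
  by_cases hp : p ∈ Set.Ioo (0 : ℝ) 1
  · rw [quantile_le_iff μ hp]
    exact ((quantile_le_iff ν hp _).1 le_rfl).trans (h _)
  · rw [quantile, quantile, if_neg hp, if_neg hp]

end quantile

/-! ### The monotone coupling of conditional laws -/

section rhoMeasure

variable {V : ℝ → ℝ}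

/-- The conditional law of a height given its neighbours. -/
noncomputable def rhoMeasure (V : ℝ → ℝ) (b c : ℝ) : Measure ℝ :=
  volume.withDensity fun u => ENNReal.ofReal (rho V b c u)

theorem IsConfining.isProbabilityMeasure_rhoMeasure (hV : IsConfining V) (b c : ℝ) :
    IsProbabilityMeasure (rhoMeasure V b c) :=
  ⟨by rw [rhoMeasure, withDensity_apply _ .univ, setLIntegral_univ, hV.lintegral_rho]⟩

theorem IsConfining.lintegral_rhoMeasure (hV : IsConfining V) (b c : ℝ) {f : ℝ → ℝ≥0∞}
    (hf : Measurable f) :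
    ∫⁻ u, f u ∂(rhoMeasure V b c) = ∫⁻ u, ENNReal.ofReal (rho V b c u) * f u := by
  rw [rhoMeasure, lintegral_withDensity_eq_lintegral_mul _
    (measurable_rho_right hV.measurable b c).ennreal_ofReal hf]
  rfl

theorem IsConfining.integrable_mul_rho (hV : IsConfining V) (b c : ℝ) :
    Integrable fun u => rho V b c u * u := by
  obtain ⟨C, -, K, h⟩ := hV.exists_moment_rhoWeight_le 1
  have h1 := (h b c).1
  have hi : Integrable fun u => |b| * rhoWeight V b c u +
      (1 + |u - b| + |c - u|) ^ 1 * rhoWeight V b c u :=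
    ((hV.integrable_rhoWeight b c).const_mul _).add h1
  have hc := hV.continuous_rhoWeight b c
  have h2 : Integrable fun u => rhoWeight V b c u * u := by
    refine hi.mono' (by fun_prop : Continuous _).aestronglyMeasurable
      (Eventually.of_forall fun u => ?_)
    rw [norm_mul, Real.norm_eq_abs, Real.norm_eq_abs, abs_of_pos (rhoWeight_pos V b c u)]
    have h3 : |u| ≤ |b| + |u - b| := by
      have := abs_add_le b (u - b); simpa using this
    have := rhoWeight_pos V b c u
    nlinarith [abs_nonneg (c - u)]
  refine (h2.div_const (∫ s, rhoWeight V b c s)).congr (Eventually.of_forall fun u => ?_)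
  simp only [rho_eq]
  ring

/-- By symmetry the conditional mean of a height is the average of its neighbours. -/
theorem IsConfining.integral_rho_mul (hV : IsConfining V) (b c : ℝ) :
    ∫ u, rho V b c u * u = (b + c) / 2 := by
  have hi := hV.integrable_mul_rho b c
  have hr : Integrable (rho V b c) := (hV.integrable_rhoWeight b c).div_const _
  have h1 : ∫ u, rho V b c u = 1 := by
    simp only [rho_eq]
    rw [integral_div, div_self (hV.integral_rhoWeight_pos b c).ne']
  have hsymm : ∀ u, rho V b c (b + c - u) = rho V b c u := fun u => by
    simp only [rho]
    congr 2
    rw [show b + c - u - b = c - u by ring, show c - (b + c - u) = u - b by ring]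
    ring
  have h2 : ∫ u, rho V b c u * u = ∫ u, ((b + c) * rho V b c u - rho V b c u * u) := by
    rw [← integral_sub_left_eq_self (fun u => rho V b c u * u) _ (b + c)]
    refine integral_congr_ae (Eventually.of_forall fun u => ?_)
    simp only [hsymm]
    ring
  rw [integral_sub (hr.const_mul _) hi, integral_const_mul, h1] at h2
  linarith

/-- Monotone likelihood ratio: convexity of V makes each of the two factors of the density favour
higher values when its neighbour is raised. -/
theorem IsConfining.rho_mul_le (hV : IsConfining V) {b c b' c' u w : ℝ} (hb : b ≤ b')
    (hc : c ≤ c') (huw : u ≤ w) :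
    rho V b' c' u * rho V b c w ≤ rho V b c u * rho V b' c' w := by
  have hZ := hV.integral_rhoWeight_pos b c
  have hZ' := hV.integral_rhoWeight_pos b' c'
  have key : rhoWeight V b' c' u * rhoWeight V b c w ≤ rhoWeight V b c u * rhoWeight V b' c' w := by
    simp only [rhoWeight, ← Real.exp_add]
    refine Real.exp_le_exp.2 ?_
    have h1 := four_point_of_convex hV.convex (by linarith : u - b' ≤ w - b')
      (by linarith : 0 ≤ b' - b)
    have h2 := four_point_of_convex hV.convex (by linarith : c - w ≤ c - u)
      (by linarith : 0 ≤ c' - c)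
    rw [show u - b' + (b' - b) = u - b by ring, show w - b' + (b' - b) = w - b by ring] at h1
    rw [show c - w + (c' - c) = c' - w by ring, show c - u + (c' - c) = c' - u by ring] at h2
    linarith
  simp only [rho_eq, div_mul_div_comm]
  rw [mul_comm (∫ s, rhoWeight V b c s)]
  gcongr

/-- Integrating the likelihood ratio inequality over u ≤ x < w gives F'(1 - F) ≤ F(1 - F'), that is
F' ≤ F. -/
theorem IsConfining.cdf_rhoMeasure_le (hV : IsConfining V) {b c b' c' : ℝ} (hb : b ≤ b')
    (hc : c ≤ c') (x : ℝ) :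
    ProbabilityTheory.cdf (rhoMeasure V b' c') x ≤ ProbabilityTheory.cdf (rhoMeasure V b c) x := by
  have i1 := hV.isProbabilityMeasure_rhoMeasure b c
  have i2 := hV.isProbabilityMeasure_rhoMeasure b' c'
  have m1 := (measurable_rho_right hV.measurable b c).ennreal_ofReal
  have m2 := (measurable_rho_right hV.measurable b' c').ennreal_ofReal
  have key : rhoMeasure V b' c' (Set.Iic x) * rhoMeasure V b c (Set.Ioi x) ≤
      rhoMeasure V b c (Set.Iic x) * rhoMeasure V b' c' (Set.Ioi x) := by
    simp only [rhoMeasure, withDensity_apply _ measurableSet_Iic,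
      withDensity_apply _ measurableSet_Ioi]
    rw [← lintegral_mul_const _ m1, ← lintegral_mul_const _ m2]
    refine setLIntegral_mono' measurableSet_Iic fun u hu => ?_
    rw [← lintegral_const_mul _ m1, ← lintegral_const_mul _ m2]
    refine setLIntegral_mono' measurableSet_Ioi fun w hw => ?_
    rw [← ENNReal.ofReal_mul (rho_nonneg _ _ _ _), ← ENNReal.ofReal_mul (rho_nonneg _ _ _ _)]
    exact ENNReal.ofReal_le_ofReal (hV.rho_mul_le hb hc (le_trans hu (le_of_lt hw)))
  have hreal : ∀ (μ : Measure ℝ) [IsProbabilityMeasure μ], μ.real (Set.Ioi x) = 1 - μ.real (Set.Iic x) :=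
    fun μ _ => by
      rw [← Set.compl_Iic, probReal_compl_eq_one_sub measurableSet_Iic]
  have key2 := ENNReal.toReal_mono (by finiteness) key
  rw [ENNReal.toReal_mul, ENNReal.toReal_mul] at key2
  change (rhoMeasure V b' c').real _ * (rhoMeasure V b c).real _ ≤
    (rhoMeasure V b c).real _ * (rhoMeasure V b' c').real _ at key2
  rw [hreal, hreal] at key2
  rw [ProbabilityTheory.cdf_eq_real, ProbabilityTheory.cdf_eq_real]
  linarith

/-- Stochastic order makes the quantile difference of constant sign, so its L¹ norm is the
difference of the means, which symmetry gives exactly. -/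
theorem IsConfining.lintegral_quantile_sub_of_le (hV : IsConfining V) {b c b' c' : ℝ}
    (hb : b ≤ b') (hc : c ≤ c') :
    ∫⁻ p in Set.Ioo (0 : ℝ) 1, ENNReal.ofReal
      |quantile (rhoMeasure V b c) p - quantile (rhoMeasure V b' c') p| =
      ENNReal.ofReal ((b' - b) / 2 + (c' - c) / 2) := by
  have mean : ∀ b c, IntegrableOn (quantile (rhoMeasure V b c)) (Set.Ioo 0 1) ∧
      ∫ p in Set.Ioo (0 : ℝ) 1, quantile (rhoMeasure V b c) p = (b + c) / 2 := fun b c => by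
    have i1 := hV.isProbabilityMeasure_rhoMeasure b c
    have hmap := map_quantile (rhoMeasure V b c)
    have hq := measurable_quantile (rhoMeasure V b c)
    have hm := (measurable_rho_right hV.measurable b c)
    have hint : Integrable (fun u : ℝ => u) (rhoMeasure V b c) := by
      rw [rhoMeasure, integrable_withDensity_iff_integrable_smul' hm.ennreal_ofReal
        (Eventually.of_forall fun _ => ENNReal.ofReal_lt_top)]
      simp only [smul_eq_mul, ENNReal.toReal_ofReal (rho_nonneg _ _ _ _)]
      exact hV.integrable_mul_rho b c
    constructor
    · have := hint
      rw [← hmap] at this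
      exact this.comp_measurable hq
    · have h1 : ∫ u, u ∂(rhoMeasure V b c) = (b + c) / 2 := by
        rw [rhoMeasure, integral_withDensity_eq_integral_toReal_smul₀ hm.ennreal_ofReal.aemeasurable
          (Eventually.of_forall fun _ => ENNReal.ofReal_lt_top)]
        simp only [smul_eq_mul, ENNReal.toReal_ofReal (rho_nonneg _ _ _ _)]
        exact hV.integral_rho_mul b c
      rw [← h1]
      conv_rhs => rw [← hmap]
      exact (integral_map (f := fun u : ℝ => u) hq.aemeasurable aestronglyMeasurable_id).symm
  obtain ⟨j1, e1⟩ := mean b c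
  obtain ⟨j2, e2⟩ := mean b' c'
  have hle : ∀ p, quantile (rhoMeasure V b c) p ≤ quantile (rhoMeasure V b' c') p :=
    quantile_le_quantile fun u => hV.cdf_rhoMeasure_le hb hc u
  have habs : ∀ p, |quantile (rhoMeasure V b c) p - quantile (rhoMeasure V b' c') p| =
      quantile (rhoMeasure V b' c') p - quantile (rhoMeasure V b c) p := fun p => by
    rw [abs_sub_comm, abs_of_nonneg (by linarith [hle p])]
  simp only [habs]
  have j3 : Integrable (fun p => quantile (rhoMeasure V b' c') p - quantile (rhoMeasure V b c) p)
      (volume.restrict (Set.Ioo 0 1)) := j2.sub j1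
  rw [← ofReal_integral_eq_lintegral_ofReal j3
    (Eventually.of_forall fun p => by
      have := hle p
      simp only [Pi.zero_apply]; linarith)]
  congr 1
  have h3 := integral_sub j2 j1
  rw [e1, e2] at h3
  refine h3.trans ?_
  ring

/-- The monotone coupling of two conditional laws. -/
theorem IsConfining.lintegral_quantile_sub_le (hV : IsConfining V) (b c b' c' : ℝ) :
    ∫⁻ p in Set.Ioo (0 : ℝ) 1, ENNReal.ofReal
      |quantile (rhoMeasure V b c) p - quantile (rhoMeasure V b' c') p| ≤
      ENNReal.ofReal (|b - b'| / 2 + |c - c'| / 2) := by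
  have m1 := measurable_quantile (rhoMeasure V b c)
  have m2 := measurable_quantile (rhoMeasure V b' c)
  have m3 := measurable_quantile (rhoMeasure V b' c')
  -- Moving one neighbour at a time, through (b', c), makes each pair of laws ordered even when (b,
  -- c) and (b', c') are not comparable.
  have s1 : ∫⁻ p in Set.Ioo (0 : ℝ) 1, ENNReal.ofReal
      |quantile (rhoMeasure V b c) p - quantile (rhoMeasure V b' c) p| ≤
      ENNReal.ofReal (|b - b'| / 2) := by
    rcases le_total b b' with h | h
    · rw [hV.lintegral_quantile_sub_of_le h le_rfl, abs_sub_comm, abs_of_nonneg (by linarith)]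
      simp
    · simp only [abs_sub_comm (quantile (rhoMeasure V b c) _)]
      rw [hV.lintegral_quantile_sub_of_le h le_rfl, abs_of_nonneg (by linarith)]
      simp
  have s2 : ∫⁻ p in Set.Ioo (0 : ℝ) 1, ENNReal.ofReal
      |quantile (rhoMeasure V b' c) p - quantile (rhoMeasure V b' c') p| ≤
      ENNReal.ofReal (|c - c'| / 2) := by
    rcases le_total c c' with h | h
    · rw [hV.lintegral_quantile_sub_of_le le_rfl h, abs_sub_comm, abs_of_nonneg (by linarith)]
      simp
    · simp only [abs_sub_comm (quantile (rhoMeasure V b' c) _)]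
      rw [hV.lintegral_quantile_sub_of_le le_rfl h, abs_of_nonneg (by linarith)]
      simp
  rw [ENNReal.ofReal_add (by positivity) (by positivity)]
  refine le_trans ?_ (add_le_add s1 s2)
  rw [← lintegral_add_left (by fun_prop)]
  refine lintegral_mono fun p => ?_
  rw [← ENNReal.ofReal_add (abs_nonneg _) (abs_nonneg _)]
  exact ENNReal.ofReal_le_ofReal (abs_sub_le _ _ _)

end rhoMeasure

/-! ### Coupling along a fixed word of resamplings -/

section words

variable {V : ℝ → ℝ} {N : ℕ}

/-- The resampling operator `𝒬_k` on nonnegative functions. -/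
noncomputable def heatOp (V : ℝ → ℝ) (k : Fin (N - 1)) (f : Interface N → ℝ≥0∞)
    (x : Interface N) : ℝ≥0∞ :=
  ∫⁻ z, f z ∂(resampleAt V k x)

theorem measurable_setHeight_right (x : Interface N) (k : Fin (N - 1)) :
    Measurable (setHeight x k) :=
  (measurable_setHeight k).comp measurable_prodMk_left

theorem heatOp_eq (V : ℝ → ℝ) (k : Fin (N - 1)) {f : Interface N → ℝ≥0∞} (hf : Measurable f)
    (x : Interface N) :
    heatOp V k f x =
      ∫⁻ u, f (setHeight x k u) ∂(rhoMeasure V (x.1 (left k)) (x.1 (right k))) :=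
  lintegral_map hf (measurable_setHeight_right x k)

/-- The uniform variable p is a source of randomness common to all starting interfaces; using the
same p from two of them realizes the monotone coupling. -/
theorem heatOp_eq_quantile (hV : IsConfining V) (k : Fin (N - 1)) {f : Interface N → ℝ≥0∞}
    (hf : Measurable f) (x : Interface N) :
    heatOp V k f x = ∫⁻ p in Set.Ioo (0 : ℝ) 1,
      f (setHeight x k (quantile (rhoMeasure V (x.1 (left k)) (x.1 (right k))) p)) := by
  have := hV.isProbabilityMeasure_rhoMeasure (x.1 (left k)) (x.1 (right k))
  rw [heatOp_eq V k hf]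
  conv_lhs => rw [← map_quantile (rhoMeasure V (x.1 (left k)) (x.1 (right k)))]
  exact lintegral_map (hf.comp (measurable_setHeight_right x k)) (measurable_quantile _)

theorem measurable_heatOp (hV : IsConfining V) (k : Fin (N - 1)) {f : Interface N → ℝ≥0∞}
    (hf : Measurable f) : Measurable (heatOp V k f) :=
  (Measure.measurable_lintegral hf).comp (measurable_resampleAt hV.measurable k)

theorem heatOp_le_one (V : ℝ → ℝ) (k : Fin (N - 1)) {f : Interface N → ℝ≥0∞}
    (hf : ∀ x, f x ≤ 1) (x : Interface N) : heatOp V k f x ≤ 1 :=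
  (lintegral_mono hf).trans (by simpa using resampleAt_univ_le V k x)

/-- Successive resampling at the sites of a list, the head of the list being resampled first. -/
noncomputable def wordOp (V : ℝ → ℝ) (f : Interface N → ℝ≥0∞) :
    List (Fin (N - 1)) → Interface N → ℝ≥0∞
  | [] => f
  | k :: w => heatOp V k (wordOp V f w)

theorem measurable_wordOp (hV : IsConfining V) {f : Interface N → ℝ≥0∞} (hf : Measurable f)
    (w : List (Fin (N - 1))) : Measurable (wordOp V f w) := by
  induction w with
  | nil => exact hf
  | cons k w ih => exact measurable_heatOp hV k ih

theorem wordOp_le_one (V : ℝ → ℝ) {f : Interface N → ℝ≥0∞} (hf : ∀ x, f x ≤ 1)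
    (w : List (Fin (N - 1))) (x : Interface N) : wordOp V f w x ≤ 1 := by
  induction w generalizing x with
  | nil => exact hf x
  | cons k w ih => exact heatOp_le_one V k ih x

/-- Push the weight of a site to its two neighbours. -/
noncomputable def transport (k : Fin (N - 1)) (a : Fin (N + 1) → ℝ) : Fin (N + 1) → ℝ :=
  fun i => Function.update a (site k) 0 i +
    ((Pi.single (left k) (a (site k) / 2) : Fin (N + 1) → ℝ) i +
      (Pi.single (right k) (a (site k) / 2) : Fin (N + 1) → ℝ) i)

/-- The weights with which the initial discrepancies enter the probability that a coupling along
the word `w` fails. -/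
noncomputable def wordWeight (c : ℝ) : List (Fin (N - 1)) → Fin (N + 1) → ℝ
  | [] => 0
  | k :: w => fun i => transport k (wordWeight c w) i +
      if k ∈ w then 0 else (Pi.single (left k) c : Fin (N + 1) → ℝ) i +
        (Pi.single (right k) c : Fin (N + 1) → ℝ) i

theorem wordWeight_nonneg {c : ℝ} (hc : 0 ≤ c) (w : List (Fin (N - 1))) (i : Fin (N + 1)) :
    0 ≤ wordWeight c w i := by
  have hs : ∀ (i j : Fin (N + 1)) {d : ℝ}, 0 ≤ d → 0 ≤ (Pi.single j d : Fin (N + 1) → ℝ) i :=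
    fun i j d hd => by
      rw [Pi.single_apply]; split_ifs <;> simp [hd]
  induction w generalizing i with
  | nil => exact le_rfl
  | cons k w ih =>
    have h1 := ih (site k)
    have h2 : 0 ≤ Function.update (wordWeight c w) (site k) 0 i := by
      rw [Function.update_apply]
      split_ifs
      exacts [le_rfl, ih i]
    have h3 : 0 ≤ if k ∈ w then 0 else
        (Pi.single (left k) c : Fin (N + 1) → ℝ) i + (Pi.single (right k) c : Fin (N + 1) → ℝ) i := by
      split_ifs
      · exact le_rfl
      · exact add_nonneg (hs _ _ hc) (hs _ _ hc)
    exact add_nonneg (add_nonneg h2 (add_nonneg (hs _ _ (by linarith)) (hs _ _ (by linarith)))) h3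

/-- Expected number of last visits of the word `w` at which the increment around the resampled site
is larger than `R`. -/
noncomputable def wordDefect (V : ℝ → ℝ) (R : ℝ) : List (Fin (N - 1)) → Interface N → ℝ≥0∞
  | [] => 0
  | k :: w => fun y => heatOp V k (wordDefect V R w) y +
      if k ∈ w then 0 else
        Set.indicator {y : Interface N | R < |y.1 (right k) - y.1 (left k)|} 1 y

theorem measurableSet_increment (R : ℝ) (k : Fin (N - 1)) :
    MeasurableSet {y : Interface N | R < |y.1 (right k) - y.1 (left k)|} :=
  measurableSet_lt measurable_const ((measurable_height _).sub (measurable_height _)).norm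

theorem measurable_wordDefect (hV : IsConfining V) (R : ℝ) (w : List (Fin (N - 1))) :
    Measurable (wordDefect V R w) := by
  induction w with
  | nil => exact measurable_const
  | cons k w ih =>
    refine (measurable_heatOp hV k ih).add ?_
    split_ifs
    · exact measurable_const
    · exact measurable_one.indicator (measurableSet_increment R k)

theorem left_ne_site (k : Fin (N - 1)) : left k ≠ site k := by
  simp [left, site, Fin.ext_iff]

theorem right_ne_site (k : Fin (N - 1)) : right k ≠ site k := by
  simp [right, site, Fin.ext_iff]

theorem site_injective : Function.Injective (site (N := N)) := fun j k h => by
  simpa [site, Fin.ext_iff] using h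

theorem sum_single_mul {ι : Type*} [Fintype ι] [DecidableEq ι] (i : ι) (c : ℝ) (D : ι → ℝ) :
    ∑ j, (Pi.single i c : ι → ℝ) j * D j = c * D i := by
  simp [Pi.single_apply, ite_mul]

theorem sum_setHeight (a : Fin (N + 1) → ℝ) (x y : Interface N) (k : Fin (N - 1)) (u v : ℝ) :
    ∑ i, a i * |(setHeight x k u).1 i - (setHeight y k v).1 i| =
      (∑ i, Function.update a (site k) 0 i * |x.1 i - y.1 i|) + a (site k) * |u - v| := by
  rw [← sum_single_mul (site k) (a (site k)) (fun _ => |u - v|), ← Finset.sum_add_distrib]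
  refine Finset.sum_congr rfl fun i _ => ?_
  by_cases h : i = site k
  · subst h; simp [setHeight]
  · simp [setHeight, h]

theorem sum_transport (a : Fin (N + 1) → ℝ) (k : Fin (N - 1)) (D : Fin (N + 1) → ℝ) :
    ∑ i, transport k a i * D i =
      (∑ i, Function.update a (site k) 0 i * D i) +
        a (site k) * (D (left k) / 2 + D (right k) / 2) := by
  simp only [transport, add_mul, Finset.sum_add_distrib, sum_single_mul]
  ring

/-- Comparison of the law of the word `w` started from two interfaces that agree at the sites
which `w` does not visit. -/
theorem wordOp_le (hV : IsConfining V) {R c : ℝ} (hc : 0 ≤ c)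
    (hR : ∀ b d b' d' : ℝ, |d' - b'| ≤ R →
      ∫⁻ u, ENNReal.ofReal (rho V b d u - rho V b' d' u) ≤
        ENNReal.ofReal (c * (|b - b'| + |d - d'|)))
    {f : Interface N → ℝ≥0∞} (hf : Measurable f) (hf1 : ∀ x, f x ≤ 1)
    (w : List (Fin (N - 1))) (x y : Interface N)
    (hxy : ∀ k, k ∉ w → x.1 (site k) = y.1 (site k)) :
    wordOp V f w x ≤ wordOp V f w y +
      ENNReal.ofReal (∑ i, wordWeight c w i * |x.1 i - y.1 i|) + wordDefect V R w y := by
  induction w generalizing x y with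
  | nil =>
    have : x = y := by
      refine Subtype.ext (funext fun i => ?_)
      by_cases h0 : i = 0
      · rw [h0, x.2.1, y.2.1]
      by_cases hN : i = Fin.last N
      · rw [hN, x.2.2, y.2.2]
      have h1 : i.1 ≠ 0 := fun h => h0 (Fin.ext h)
      have h2 : i.1 ≠ N := fun h => hN (Fin.ext h)
      have h3 : i = site ⟨i.1 - 1, by omega⟩ := by
        ext; simp only [site]; omega
      rw [h3]
      exact hxy _ (by simp)
    subst this
    simp [wordWeight, wordDefect]
  | cons k w ih =>
    set h := wordOp V f w with hh
    have hm : Measurable h := measurable_wordOp hV hf w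
    have h1 : ∀ x, h x ≤ 1 := wordOp_le_one V hf1 w
    set a := wordWeight c w with ha
    have ha0 : ∀ i, 0 ≤ a i := wordWeight_nonneg hc w
    set D : Fin (N + 1) → ℝ := fun i => |x.1 i - y.1 i| with hD
    set rest := ∑ i, Function.update a (site k) 0 i * |x.1 i - y.1 i| with hrest
    have hrest0 : 0 ≤ rest := Finset.sum_nonneg fun i _ => by
      refine mul_nonneg ?_ (abs_nonneg _)
      rw [Function.update_apply]
      split_ifs
      exacts [le_rfl, ha0 i]
    have hdm := measurable_wordDefect hV R w
    show heatOp V k h x ≤ heatOp V k h y + _ + (heatOp V k (wordDefect V R w) y + _)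
    by_cases hk : k ∈ w
    -- Site k will be visited again, so the new heights need not agree. The same p is used on both
    -- sides, and the weight of k passes in halves to its neighbours.
    · have hxy' : ∀ u v, ∀ j, j ∉ w →
          (setHeight x k u).1 (site j) = (setHeight y k v).1 (site j) := fun u v j hj => by
        have hjk : j ≠ k := fun h => hj (h ▸ hk)
        have hs : site j ≠ site k := fun h => hjk (site_injective h)
        simp only [setHeight, Function.update_of_ne hs]
        exact hxy j (by simp [hjk, hj])
      set qx := quantile (rhoMeasure V (x.1 (left k)) (x.1 (right k)))
      set qy := quantile (rhoMeasure V (y.1 (left k)) (y.1 (right k)))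
      have hqx : Measurable qx := measurable_quantile _
      have hqy : Measurable qy := measurable_quantile _
      have hsy := measurable_setHeight_right y k
      have htotal : ∑ i, wordWeight c (k :: w) i * |x.1 i - y.1 i| =
          rest + a (site k) * (D (left k) / 2 + D (right k) / 2) := by
        rw [hrest, ← sum_transport]
        simp only [wordWeight, hk, if_true, add_zero, ha]
      rw [if_pos hk, add_zero, htotal, heatOp_eq_quantile hV k hm x, heatOp_eq_quantile hV k hm y,
        heatOp_eq_quantile hV k hdm y]
      calc ∫⁻ p in Set.Ioo (0 : ℝ) 1, h (setHeight x k (qx p))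
          ≤ ∫⁻ p in Set.Ioo (0 : ℝ) 1, (h (setHeight y k (qy p)) +
              (ENNReal.ofReal rest + ENNReal.ofReal (a (site k)) *
                ENNReal.ofReal |qx p - qy p|) + wordDefect V R w (setHeight y k (qy p))) := by
            refine lintegral_mono fun p => (ih _ _ (hxy' (qx p) (qy p))).trans (le_of_eq ?_)
            rw [sum_setHeight, ← ENNReal.ofReal_mul (ha0 _),
              ← ENNReal.ofReal_add hrest0 (mul_nonneg (ha0 _) (abs_nonneg _))]
        _ = (∫⁻ p in Set.Ioo (0 : ℝ) 1, h (setHeight y k (qy p))) +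
              (ENNReal.ofReal rest + ENNReal.ofReal (a (site k)) *
                ∫⁻ p in Set.Ioo (0 : ℝ) 1, ENNReal.ofReal |qx p - qy p|) +
              ∫⁻ p in Set.Ioo (0 : ℝ) 1, wordDefect V R w (setHeight y k (qy p)) := by
            rw [lintegral_add_left (by fun_prop), lintegral_add_left (by fun_prop),
              lintegral_add_left (by fun_prop), lintegral_const_mul _ (by fun_prop)]
            simp
        _ ≤ _ := by
            gcongr
            rw [ENNReal.ofReal_add hrest0 (mul_nonneg (ha0 _) (by positivity)),
              ENNReal.ofReal_mul (ha0 _)]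
            gcongr
            exact hV.lintegral_quantile_sub_le _ _ _ _
    -- This is the last visit to k, so the heights must agree from now on. The density `ρx` is
    -- replaced by `ρy` at the price of the total variation distance, as test functions are at most
    -- 1; then a common height u is used on both sides.
    · have hxy' : ∀ u, ∀ j, j ∉ w →
          (setHeight x k u).1 (site j) = (setHeight y k u).1 (site j) := fun u j hj => by
        by_cases hjk : j = k
        · subst hjk; simp [setHeight]
        have hs : site j ≠ site k := fun h => hjk (site_injective h)
        simp only [setHeight, Function.update_of_ne hs]
        exact hxy j (by simp [hjk, hj])
      have htotal : ∑ i, wordWeight c (k :: w) i * |x.1 i - y.1 i| =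
          rest + a (site k) * (D (left k) / 2 + D (right k) / 2) +
            c * (D (left k) + D (right k)) := by
        rw [hrest, ← sum_transport]
        simp only [wordWeight, hk, if_false, add_mul, Finset.sum_add_distrib, sum_single_mul, ha,
          hD]
        ring
      set ρx := rho V (x.1 (left k)) (x.1 (right k))
      set ρy := rho V (y.1 (left k)) (y.1 (right k))
      have hρx : Measurable ρx := measurable_rho_right hV.measurable _ _
      have hρy : Measurable ρy := measurable_rho_right hV.measurable _ _
      have hρy0 : ∀ u, 0 ≤ ρy u := rho_nonneg _ _ _
      have hsy := measurable_setHeight_right y k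
      have hsx := measurable_setHeight_right x k
      have htv : ∫⁻ u, ENNReal.ofReal (ρx u - ρy u) ≤
          ENNReal.ofReal (c * (D (left k) + D (right k))) +
            Set.indicator {y : Interface N | R < |y.1 (right k) - y.1 (left k)|} 1 y := by
        by_cases hy : R < |y.1 (right k) - y.1 (left k)|
        · rw [Set.indicator_of_mem (show y ∈ {y : Interface N | R < |y.1 (right k) - y.1 (left k)|}
            from hy)]
          refine le_trans ?_ le_add_self
          calc ∫⁻ u, ENNReal.ofReal (ρx u - ρy u) ≤ ∫⁻ u, ENNReal.ofReal (ρx u) :=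
                lintegral_mono fun u => ENNReal.ofReal_le_ofReal (by linarith [hρy0 u])
            _ = 1 := hV.lintegral_rho _ _
        · exact (hR _ _ _ _ (not_lt.1 hy)).trans le_self_add
      rw [if_neg hk, htotal, heatOp_eq V k hm x, heatOp_eq V k hm y, heatOp_eq V k hdm y,
        hV.lintegral_rhoMeasure _ _ (by fun_prop), hV.lintegral_rhoMeasure _ _ (by fun_prop),
        hV.lintegral_rhoMeasure _ _ (by fun_prop)]
      have hstep : ∫⁻ u, ENNReal.ofReal (ρy u) * h (setHeight x k u) ≤
          (∫⁻ u, ENNReal.ofReal (ρy u) * h (setHeight y k u)) + ENNReal.ofReal rest +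
            ∫⁻ u, ENNReal.ofReal (ρy u) * wordDefect V R w (setHeight y k u) := by
        calc _ ≤ ∫⁻ u, ENNReal.ofReal (ρy u) * (h (setHeight y k u) + ENNReal.ofReal rest +
              wordDefect V R w (setHeight y k u)) := by
              refine lintegral_mono fun u => mul_le_mul_right
                ((ih _ _ (hxy' u)).trans (le_of_eq ?_)) _
              rw [sum_setHeight, sub_self, abs_zero, mul_zero, add_zero]
          _ = _ := by
              simp only [mul_add]
              rw [lintegral_add_left (by fun_prop), lintegral_add_left (by fun_prop),
                lintegral_mul_const _ (by fun_prop), hV.lintegral_rho, one_mul]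
      calc ∫⁻ u, ENNReal.ofReal (ρx u) * h (setHeight x k u)
          ≤ ∫⁻ u, (ENNReal.ofReal (ρy u) * h (setHeight x k u) + ENNReal.ofReal (ρx u - ρy u)) := by
            refine lintegral_mono fun u => ?_
            have : ENNReal.ofReal (ρx u) ≤ ENNReal.ofReal (ρy u) + ENNReal.ofReal (ρx u - ρy u) := by
              refine le_trans (ENNReal.ofReal_le_ofReal ?_) ENNReal.ofReal_add_le
              linarith
            calc _ ≤ (ENNReal.ofReal (ρy u) + ENNReal.ofReal (ρx u - ρy u)) *
                  h (setHeight x k u) := by gcongr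
              _ = ENNReal.ofReal (ρy u) * h (setHeight x k u) +
                  ENNReal.ofReal (ρx u - ρy u) * h (setHeight x k u) := add_mul _ _ _
              _ ≤ _ := add_le_add le_rfl (mul_le_of_le_one_right' (h1 _))
        _ = (∫⁻ u, ENNReal.ofReal (ρy u) * h (setHeight x k u)) +
              ∫⁻ u, ENNReal.ofReal (ρx u - ρy u) := by
            rw [lintegral_add_left (by fun_prop)]
        _ ≤ _ := add_le_add hstep htv
        _ = (∫⁻ u, ENNReal.ofReal (ρy u) * h (setHeight y k u)) +
              (ENNReal.ofReal rest + ENNReal.ofReal (c * (D (left k) + D (right k)))) +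
              ((∫⁻ u, ENNReal.ofReal (ρy u) * wordDefect V R w (setHeight y k u)) +
                Set.indicator {y : Interface N | R < |y.1 (right k) - y.1 (left k)|} 1 y) := by
            ring
        _ ≤ _ := by
            gcongr
            rw [← ENNReal.ofReal_add hrest0 (mul_nonneg hc (by positivity))]
            refine ENNReal.ofReal_le_ofReal ?_
            -- Once the heights at k agree, its weight is not needed. `wordWeight` transports it all
            -- the same, so that the sums over words obey a linear recursion.
            have : 0 ≤ a (site k) * (D (left k) / 2 + D (right k) / 2) :=
              mul_nonneg (ha0 _) (by positivity)
            linarith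

end words

/-! ### The killed walk and its ℓ² norm -/

section schur

/-- Schur's test for a symmetric matrix with nonnegative entries and a positive eigenvector. -/
theorem sum_sq_mulVec_le {ι : Type*} [Fintype ι] {W : ι → ι → ℝ} {φ : ι → ℝ} {r : ℝ}
    (hW : ∀ j k, 0 ≤ W j k) (hsymm : ∀ j k, W j k = W k j) (hφ : ∀ j, 0 < φ j)
    (heig : ∀ j, ∑ k, W j k * φ k = r * φ j) (a : ι → ℝ) :
    ∑ j, (∑ k, W j k * a k) ^ 2 ≤ r ^ 2 * ∑ j, a j ^ 2 := by
  -- Cauchy–Schwarz for the factorization (W a)² = (W φ)(W a²/φ) of each summand; the eigenvector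
  -- equation then evaluates one factor for each row and, by symmetry, the remaining sum for each
  -- column.
  calc ∑ j, (∑ k, W j k * a k) ^ 2
      ≤ ∑ j, (∑ k, W j k * φ k) * ∑ k, W j k * (a k ^ 2 / φ k) :=
        Finset.sum_le_sum fun j _ => Finset.sum_sq_le_sum_mul_sum_of_sq_le_mul _
          (fun k _ => mul_nonneg (hW j k) (hφ k).le)
          (fun k _ => mul_nonneg (hW j k) (div_nonneg (sq_nonneg _) (hφ k).le))
          (fun k _ => by have := (hφ k).ne'; exact le_of_eq (by field_simp))
    _ = ∑ j, ∑ k, r * (a k ^ 2 / φ k) * (W k j * φ j) := by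
        refine Finset.sum_congr rfl fun j _ => ?_
        rw [heig, Finset.mul_sum]
        refine Finset.sum_congr rfl fun k _ => ?_
        rw [hsymm j k]; ring
    _ = ∑ k, r * (a k ^ 2 / φ k) * (r * φ k) := by
        rw [Finset.sum_comm]
        refine Finset.sum_congr rfl fun k _ => ?_
        rw [← Finset.mul_sum, heig]
    _ = _ := by
        rw [Finset.mul_sum]
        refine Finset.sum_congr rfl fun k _ => ?_
        have := (hφ k).ne'
        field_simp

/-- The transition matrix of simple random walk on the interior sites, killed at the boundary. -/
noncomputable def walk {m : ℕ} (j k : Fin m) : ℝ :=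
  (if k.1 = j.1 + 1 then 1 / 2 else 0) + (if j.1 = k.1 + 1 then 1 / 2 else 0)

theorem walk_nonneg {m : ℕ} (j k : Fin m) : 0 ≤ walk j k := by
  unfold walk; split_ifs <;> norm_num

theorem sum_ite_succ {m : ℕ} (i : ℕ) (g : ℕ → ℝ) (hg : g m = 0) (hi : i ≤ m) :
    ∑ k : Fin m, (if k.1 = i then 1 / 2 else 0) * g k.1 = 1 / 2 * g i := by
  rcases hi.lt_or_eq with h | rfl
  · rw [Finset.sum_eq_single (⟨i, h⟩ : Fin m)]
    · simp
    · intro b _ hb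
      rw [if_neg (fun h' => hb (Fin.ext h')), zero_mul]
    · simp
  · rw [hg, mul_zero]
    refine Finset.sum_eq_zero fun k _ => ?_
    rw [if_neg k.2.ne, zero_mul]

/-- The zeros of `g` at both ends stand for the killed neighbours, so the averaging formula needs no
boundary cases. -/
theorem sum_walk_mul {m : ℕ} (j : Fin m) (g : ℕ → ℝ) (h0 : g 0 = 0) (hm : g (m + 1) = 0) :
    ∑ k : Fin m, walk j k * g (k.1 + 1) = (g j.1 + g (j.1 + 2)) / 2 := by
  simp only [walk, add_mul, Finset.sum_add_distrib]
  have h1 := sum_ite_succ (m := m) (j.1 + 1) (fun i => g (i + 1)) hm j.2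
  have h2 : ∑ k : Fin m, (if j.1 = k.1 + 1 then 1 / 2 else 0) * g (k.1 + 1) = 1 / 2 * g j.1 := by
    rcases Nat.eq_zero_or_pos j.1 with hj | hj
    · rw [hj, h0, mul_zero]
      refine Finset.sum_eq_zero fun k _ => ?_
      rw [if_neg (by omega), zero_mul]
    · rw [Finset.sum_eq_single (⟨j.1 - 1, by omega⟩ : Fin m)]
      · have : j.1 = j.1 - 1 + 1 := by omega
        rw [if_pos this, ← this]
      · intro b _ hb
        rw [if_neg (fun h' => hb (Fin.ext (by simp only; omega))), zero_mul]
      · simp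
  rw [h1, h2]
  ring

theorem sum_walk_le {m : ℕ} (j : Fin m) : ∑ k : Fin m, walk j k ≤ 1 := by
  set g : ℕ → ℝ := fun i => if i = 0 ∨ i = m + 1 then 0 else 1 with hg
  have h := sum_walk_mul j g (by simp [hg]) (by simp [hg])
  have e : ∑ k : Fin m, walk j k = ∑ k : Fin m, walk j k * g (k.1 + 1) := by
    refine Finset.sum_congr rfl fun k _ => ?_
    have := k.2
    simp only [hg]
    rw [if_neg (by omega), mul_one]
  have hg1 : ∀ i, g i ≤ 1 := fun i => by simp only [hg]; split_ifs <;> norm_num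
  rw [e, h]
  linarith [hg1 j.1, hg1 (j.1 + 2)]

/-- The `ℓ²` operator norm of the killed walk. -/
theorem sum_sq_walk_le {N : ℕ} (hN : 2 ≤ N) (a : Fin (N - 1) → ℝ) :
    ∑ j, (∑ k, walk j k * a k) ^ 2 ≤ Real.cos (Real.pi / N) ^ 2 * ∑ j, a j ^ 2 := by
  have hN0 : (0 : ℝ) < N := by positivity
  set θ := Real.pi / N with hθ
  -- sin(πi/N) vanishes at i = 0 and i = N, is positive in between, and by the addition formulas is
  -- an eigenvector with eigenvalue cos(π/N).
  refine sum_sq_mulVec_le (φ := fun j => Real.sin (θ * ((j.1 + 1 : ℕ) : ℝ))) walk_nonneg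
    (fun j k => by unfold walk; rw [add_comm]) (fun j => ?_) (fun j => ?_) a
  · have hj := j.2
    have hj' : ((j.1 + 1 : ℕ) : ℝ) < N := by exact_mod_cast (by omega : j.1 + 1 < N)
    refine Real.sin_pos_of_pos_of_lt_pi ?_ ?_
    · have := Real.pi_pos
      positivity
    · calc θ * ((j.1 + 1 : ℕ) : ℝ) < θ * N := by
            have : 0 < θ := div_pos Real.pi_pos hN0
            gcongr
        _ = Real.pi := by rw [hθ]; field_simp
  · rw [sum_walk_mul j (fun i => Real.sin (θ * (i : ℝ))) (by simp) (by
      have : ((N - 1 + 1 : ℕ) : ℝ) = N := by congr 1; omega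
      rw [this, hθ, div_mul_cancel₀ _ hN0.ne', Real.sin_pi])]
    have e1 : θ * (j.1 : ℝ) = θ * ((j.1 + 1 : ℕ) : ℝ) - θ := by push_cast; ring
    have e2 : θ * ((j.1 + 2 : ℕ) : ℝ) = θ * ((j.1 + 1 : ℕ) : ℝ) + θ := by push_cast; ring
    rw [e1, e2, Real.sin_sub, Real.sin_add]
    ring

end schur

/-! ### Sums over words -/

section wordSum

variable {ι : Type*} [Fintype ι]

/-- The sum of `F` over all words of length `n`. -/
def wordSum {M : Type*} [AddCommMonoid M] : ℕ → (List ι → M) → M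
  | 0, F => F []
  | n + 1, F => ∑ k, wordSum n fun w => F (k :: w)

theorem wordSum_add {M : Type*} [AddCommMonoid M] (n : ℕ) (F G : List ι → M) :
    wordSum n (fun w => F w + G w) = wordSum n F + wordSum n G := by
  induction n generalizing F G with
  | zero => rfl
  | succ n ih => simp only [wordSum, ih, Finset.sum_add_distrib]

theorem wordSum_sum {M κ : Type*} [AddCommMonoid M] (s : Finset κ) (n : ℕ) (F : κ → List ι → M) :
    wordSum n (fun w => ∑ k ∈ s, F k w) = ∑ k ∈ s, wordSum n (F k) := by
  induction n generalizing F with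
  | zero => rfl
  | succ n ih =>
    simp only [wordSum, ih]
    exact Finset.sum_comm

theorem wordSum_mul {R : Type*} [CommSemiring R] (n : ℕ) (c : R) (F : List ι → R) :
    wordSum n (fun w => c * F w) = c * wordSum n F := by
  induction n generalizing F with
  | zero => rfl
  | succ n ih => simp only [wordSum, ih, Finset.mul_sum]

theorem wordSum_const {R : Type*} [CommSemiring R] (n : ℕ) (c : R) :
    wordSum n (fun _ : List ι => c) = (Fintype.card ι : R) ^ n * c := by
  induction n with
  | zero => simp [wordSum]
  | succ n ih => simp only [wordSum, ih]; simp [pow_succ']; ring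

theorem wordSum_mono {F G : List ι → ℝ≥0∞} (n : ℕ) (h : ∀ w, F w ≤ G w) :
    wordSum n F ≤ wordSum n G := by
  induction n generalizing F G with
  | zero => exact h _
  | succ n ih => exact Finset.sum_le_sum fun k _ => ih fun w => h _

theorem wordSum_nonneg {F : List ι → ℝ} (n : ℕ) (h : ∀ w, 0 ≤ F w) : 0 ≤ wordSum n F := by
  induction n generalizing F with
  | zero => exact h _
  | succ n ih => exact Finset.sum_nonneg fun k _ => ih fun w => h _

theorem wordSum_ofReal {F : List ι → ℝ} (n : ℕ) (h : ∀ w, 0 ≤ F w) :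
    wordSum n (fun w => ENNReal.ofReal (F w)) = ENNReal.ofReal (wordSum n F) := by
  induction n generalizing F with
  | zero => rfl
  | succ n ih =>
    simp only [wordSum]
    rw [ENNReal.ofReal_sum_of_nonneg fun k _ => wordSum_nonneg n fun w => h _]
    exact Finset.sum_congr rfl fun k _ => ih fun w => h _

/-- The number of words of length `n` which avoid the letter `k`. -/
theorem wordSum_notMem [DecidableEq ι] {R : Type*} [CommSemiring R] (n : ℕ) (k : ι) (c : R) :
    wordSum n (fun w => if k ∈ w then 0 else c) = ((Fintype.card ι - 1 : ℕ) : R) ^ n * c := by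
  induction n with
  | zero => simp [wordSum]
  | succ n ih =>
    simp only [wordSum]
    rw [← Finset.sum_erase_add _ _ (Finset.mem_univ k)]
    have h1 : wordSum n (fun w => if k ∈ k :: w then (0 : R) else c) = 0 := by
      simp only [List.mem_cons, true_or, if_true]
      rw [wordSum_const, mul_zero]
    have h2 : ∀ j ∈ Finset.univ.erase k, wordSum n (fun w => if k ∈ j :: w then (0 : R) else c) =
        ((Fintype.card ι - 1 : ℕ) : R) ^ n * c := fun j hj => by
      rw [← ih]
      congr 1
      funext w
      have : k ≠ j := (Finset.ne_of_mem_erase hj).symm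
      simp [this]
    rw [h1, add_zero, Finset.sum_congr rfl h2, Finset.sum_const,
      Finset.card_erase_of_mem (Finset.mem_univ k), Finset.card_univ, nsmul_eq_mul, pow_succ',
      mul_assoc]

end wordSum

/-! ### Growth of the total weights -/

section weights

variable {N : ℕ}

/-- The total weight at an interior site of all the words of length `n`. -/
noncomputable def totalWeight (c : ℝ) (n : ℕ) (j : Fin (N - 1)) : ℝ :=
  wordSum n fun w : List (Fin (N - 1)) => wordWeight c w (site j)

theorem single_left_add_single_right (c : ℝ) (j k : Fin (N - 1)) :
    (Pi.single (left k) c : Fin (N + 1) → ℝ) (site j) +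
      (Pi.single (right k) c : Fin (N + 1) → ℝ) (site j) = 2 * c * walk j k := by
  have e1 : site j = left k ↔ k.1 = j.1 + 1 := by
    simp only [site, left, Fin.ext_iff]; omega
  have e2 : site j = right k ↔ j.1 = k.1 + 1 := by
    simp only [site, right, Fin.ext_iff]; omega
  simp only [Pi.single_apply, e1, e2, walk]
  split_ifs <;> ring

/-- Split on the first letter k. The weight at j survives for the N - 2 letters other than j, a
neighbouring k sends half of its own weight, and each of the (N - 2)^n words avoiding k adds the
price of a last visit. -/
theorem totalWeight_succ (hN : 2 ≤ N) (c : ℝ) (n : ℕ) (j : Fin (N - 1)) :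
    totalWeight c (n + 1) j = ((N - 2 : ℕ) : ℝ) * totalWeight c n j +
      (∑ k, walk j k * totalWeight c n k) + 2 * c * ((N - 2 : ℕ) : ℝ) ^ n * ∑ k, walk j k := by
  have hstep : ∀ k, wordSum n (fun w => wordWeight c (k :: w) (site j)) =
      (if j = k then 0 else totalWeight c n j) + walk j k * totalWeight c n k +
        2 * c * ((N - 2 : ℕ) : ℝ) ^ n * walk j k := by
    intro k
    have e : ∀ w, wordWeight c (k :: w) (site j) =
        (if j = k then 0 else wordWeight c w (site j)) + walk j k * wordWeight c w (site k) +
          if k ∈ w then 0 else 2 * c * walk j k := fun w => by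
      simp only [wordWeight, transport, single_left_add_single_right]
      have : Function.update (wordWeight c w) (site k) 0 (site j) =
          if j = k then 0 else wordWeight c w (site j) := by
        simp only [Function.update_apply, site_injective.eq_iff]
      rw [this]
      ring
    simp only [e, wordSum_add, wordSum_mul, wordSum_notMem]
    rw [Fintype.card_fin, show N - 1 - 1 = N - 2 by omega]
    have : wordSum n (fun w => if j = k then 0 else wordWeight c w (site j)) =
        if j = k then 0 else totalWeight c n j := by
      split_ifs
      · rw [wordSum_const, mul_zero]
      · rfl
    rw [this]
    simp only [totalWeight]
    ring
  show ∑ k, wordSum n (fun w => wordWeight c (k :: w) (site j)) = _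
  simp only [hstep, Finset.sum_add_distrib, ← Finset.mul_sum]
  congr 2
  rw [← Finset.sum_erase_add _ _ (Finset.mem_univ j), if_pos rfl, add_zero,
    Finset.sum_congr rfl fun k hk => if_neg (Finset.ne_of_mem_erase hk).symm, Finset.sum_const,
    Finset.card_erase_of_mem (Finset.mem_univ j), Finset.card_univ, Fintype.card_fin, nsmul_eq_mul,
    show N - 1 - 1 = N - 2 by omega]

/-- The `ℓ²` norm of the total weight grows like the spectral radius of `∑ₖ 𝒬ₖ` on linear
functions. -/
theorem sqrt_sum_sq_totalWeight_le (hN : 2 ≤ N) {c : ℝ} (hc : 0 ≤ c) (n : ℕ) :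
    √(∑ j : Fin (N - 1), totalWeight c (n + 1) j ^ 2) ≤
      (n + 1) * (((N - 1 : ℕ) : ℝ) - gapValue N) ^ n * (2 * c * √N) := by
  set r := Real.cos (Real.pi / N) with hr
  have hN2 : (2 : ℝ) ≤ N := by exact_mod_cast hN
  have hr0 : 0 ≤ r := by
    refine Real.cos_nonneg_of_neg_pi_div_two_le_of_le ?_ ?_
    · have := Real.pi_pos
      have : 0 ≤ Real.pi / N := by positivity
      linarith
    · exact div_le_div_of_nonneg_left Real.pi_pos.le (by norm_num) hN2
  have hμ : ((N - 1 : ℕ) : ℝ) - gapValue N = ((N - 2 : ℕ) : ℝ) + r := by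
    rw [gapValue, ← hr]
    have : ((N - 1 : ℕ) : ℝ) = ((N - 2 : ℕ) : ℝ) + 1 := by
      rw [show N - 1 = N - 2 + 1 by omega]; push_cast; ring
    rw [this]; ring
  rw [hμ]
  set q : ℝ := ((N - 2 : ℕ) : ℝ) with hq
  have hq0 : 0 ≤ q := Nat.cast_nonneg _
  let vec : (Fin (N - 1) → ℝ) → EuclideanSpace ℝ (Fin (N - 1)) := fun v => WithLp.toLp 2 v
  have hnorm : ∀ v, ‖vec v‖ = √(∑ j, v j ^ 2) := fun v => by
    rw [EuclideanSpace.norm_eq]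
    simp [vec]
  -- The triangle inequality in ℓ² for the three terms of the recursion; √N bounds the norm of the
  -- row sums of the walk, which are at most 1.
  have hrec : ∀ n, ‖vec (totalWeight c (n + 1))‖ ≤
      (q + r) * ‖vec (totalWeight c n)‖ + q ^ n * (2 * c * √N) := by
    intro n
    have e : vec (totalWeight c (n + 1)) = q • vec (totalWeight c n) +
        vec (fun j => ∑ k, walk j k * totalWeight c n k) +
          (2 * c * q ^ n) • vec (fun j => ∑ k, walk j k) := by
      ext j
      simp [vec, totalWeight_succ hN, hq]
    have h1 : ‖vec (fun j => ∑ k, walk j k * totalWeight c n k)‖ ≤ r * ‖vec (totalWeight c n)‖ := by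
      rw [hnorm, hnorm]
      calc _ ≤ √(r ^ 2 * ∑ j, totalWeight c n j ^ 2) :=
            Real.sqrt_le_sqrt (sum_sq_walk_le hN _)
        _ = _ := by rw [Real.sqrt_mul (sq_nonneg r), Real.sqrt_sq hr0]
    have h2 : ‖vec (fun j => ∑ k, walk j k)‖ ≤ √N := by
      rw [hnorm]
      refine Real.sqrt_le_sqrt ?_
      calc ∑ j : Fin (N - 1), (∑ k, walk j k) ^ 2 ≤ ∑ _j : Fin (N - 1), (1 : ℝ) := by
            refine Finset.sum_le_sum fun j _ => ?_
            have h3 := sum_walk_le j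
            have h4 : 0 ≤ ∑ k, walk j k := Finset.sum_nonneg fun k _ => walk_nonneg j k
            nlinarith
        _ ≤ N := by
            simp only [Finset.sum_const, Finset.card_univ, Fintype.card_fin, nsmul_eq_mul, mul_one]
            exact_mod_cast Nat.sub_le N 1
    rw [e]
    refine (norm_add_le _ _).trans ?_
    refine (add_le_add (norm_add_le _ _) le_rfl).trans ?_
    rw [norm_smul, norm_smul, Real.norm_of_nonneg hq0, Real.norm_of_nonneg (by positivity)]
    have h3 : 2 * c * q ^ n * ‖vec (fun j => ∑ k, walk j k)‖ ≤ 2 * c * q ^ n * √N := by gcongr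
    nlinarith
  rw [← hnorm]
  -- The recursion starts from 0 and its source satisfies q^n ≤ (q + r)^n, so n + 1 sources
  -- accumulate to the factor (n + 1)(q + r)^n.
  induction n with
  | zero =>
    have h := hrec 0
    have h0 : vec (totalWeight c 0) = 0 := by
      ext j
      simp [vec, totalWeight, wordSum, wordWeight]
    rw [h0] at h
    simpa using h
  | succ n ih =>
    calc _ ≤ (q + r) * ‖vec (totalWeight c (n + 1))‖ + q ^ (n + 1) * (2 * c * √N) := hrec _
      _ ≤ (q + r) * ((n + 1) * (q + r) ^ n * (2 * c * √N)) +
          (q + r) ^ (n + 1) * (2 * c * √N) := by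
          gcongr
          linarith
      _ = _ := by push_cast; ring

end weights

/-! ### Invariance of the equilibrium measure -/

section invariance

variable {V : ℝ → ℝ} {N : ℕ}

theorem exists_eq_site {i : Fin (N + 1)} (h0 : i ≠ 0) (hN : i ≠ Fin.last N) :
    ∃ k : Fin (N - 1), site k = i := by
  have h1 : i.1 ≠ 0 := fun h => h0 (Fin.ext h)
  have h2 : i.1 ≠ N := fun h => hN (Fin.ext h)
  refine ⟨⟨i.1 - 1, by omega⟩, ?_⟩
  ext; simp only [site]; omega

theorem sum_eq_sum_site {M : Type*} [AddCommMonoid M] (D : Fin (N + 1) → M) (h0 : D 0 = 0)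
    (hN : D (Fin.last N) = 0) : ∑ i, D i = ∑ k : Fin (N - 1), D (site k) := by
  refine (Finset.sum_of_injOn site site_injective.injOn (by simp) (fun i _ hi => ?_)
    fun _ _ => rfl).symm
  by_contra hD
  have h1 : i ≠ 0 := fun h => hD (h ▸ h0)
  have h2 : i ≠ Fin.last N := fun h => hD (h ▸ hN)
  obtain ⟨k, rfl⟩ := exists_eq_site h1 h2
  simp at hi

theorem ofHeights_update (y : Fin (N - 1) → ℝ) (k : Fin (N - 1)) (u : ℝ) :
    ofHeights (Function.update y k u) = setHeight (ofHeights y) k u := by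
  refine Subtype.ext (funext fun i => ?_)
  by_cases h0 : i = 0
  · rw [h0, (ofHeights _).2.1, (setHeight _ _ _).2.1]
  by_cases hN : i = Fin.last N
  · rw [hN, (ofHeights _).2.2, (setHeight _ _ _).2.2]
  obtain ⟨j, rfl⟩ := exists_eq_site h0 hN
  have hy : ∀ y : Fin (N - 1) → ℝ, (ofHeights y).1 (site j) = y j := fun y => by
    have := j.2
    simp only [ofHeights, site]
    rw [dif_pos ⟨by omega, by omega⟩]
    rfl
  rw [hy]
  by_cases hjk : j = k
  · subst hjk; simp [setHeight]
  · have hs : site j ≠ site k := fun h => hjk (site_injective h)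
    simp only [setHeight, Function.update_of_ne hs, Function.update_of_ne hjk, hy]

theorem setHeight_setHeight (x : Interface N) (k : Fin (N - 1)) (u v : ℝ) :
    setHeight (setHeight x k u) k v = setHeight x k v := by
  refine Subtype.ext ?_
  simp [setHeight]

theorem heatOp_setHeight (k : Fin (N - 1)) (f : Interface N → ℝ≥0∞) (x : Interface N) (u : ℝ) :
    heatOp V k f (setHeight x k u) = heatOp V k f x := by
  have h1 : (setHeight x k u).1 (left k) = x.1 (left k) := Function.update_of_ne (left_ne_site k) _ _
  have h2 : (setHeight x k u).1 (right k) = x.1 (right k) :=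
    Function.update_of_ne (right_ne_site k) _ _
  have h3 : setHeight (setHeight x k u) k = setHeight x k := funext fun v =>
    setHeight_setHeight x k u v
  simp only [heatOp, resampleAt, h1, h2, h3]

theorem exists_hamiltonian_setHeight (V : ℝ → ℝ) (x : Interface N) (k : Fin (N - 1)) :
    ∃ h : ℝ, ∀ u, hamiltonian V (setHeight x k u) =
      h + (V (u - x.1 (left k)) + V (x.1 (right k) - u)) := by
  have hk := k.2
  set i : Fin N := ⟨k.1, by omega⟩ with hi
  set j : Fin N := ⟨k.1 + 1, by omega⟩ with hj
  have hij : j ≠ i := by simp [hi, hj]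
  refine ⟨∑ l ∈ (Finset.univ.erase i).erase j, V (x.1 l.succ - x.1 l.castSucc), fun u => ?_⟩
  have e1 : i.succ = site k := rfl
  have e2 : i.castSucc = left k := rfl
  have e3 : j.succ = right k := rfl
  have e4 : j.castSucc = site k := rfl
  rw [hamiltonian, ← Finset.sum_erase_add _ _ (Finset.mem_univ i),
    ← Finset.sum_erase_add _ _ (Finset.mem_erase.2 ⟨hij, Finset.mem_univ j⟩), e1, e2, e3, e4]
  have h1 : (setHeight x k u).1 (left k) = x.1 (left k) := Function.update_of_ne (left_ne_site k) _ _
  have h2 : (setHeight x k u).1 (right k) = x.1 (right k) :=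
    Function.update_of_ne (right_ne_site k) _ _
  have h3 : (setHeight x k u).1 (site k) = u := Function.update_self _ _ _
  have h4 : ∑ l ∈ (Finset.univ.erase i).erase j,
        V ((setHeight x k u).1 l.succ - (setHeight x k u).1 l.castSucc) =
      ∑ l ∈ (Finset.univ.erase i).erase j, V (x.1 l.succ - x.1 l.castSucc) := by
    refine Finset.sum_congr rfl fun l hl => ?_
    have hlj : l ≠ j := Finset.ne_of_mem_erase hl
    have hli : l ≠ i := Finset.ne_of_mem_erase (Finset.mem_of_mem_erase hl)
    have a1 : l.succ ≠ site k := by rw [← e1]; simpa using hli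
    have a2 : l.castSucc ≠ site k := by rw [← e4]; simpa using hlj
    simp only [setHeight, Function.update_of_ne a1, Function.update_of_ne a2]
  rw [h1, h2, h3, h4]
  ring

/-- Only the two increments next to site k involve its height, so the equilibrium density is
proportional to `rho` as a function of that height. -/
theorem IsConfining.exists_density_setHeight (hV : IsConfining V) (Z : ℝ) (hZ : 0 ≤ Z)
    (x : Interface N) (k : Fin (N - 1)) :
    ∃ a : ℝ≥0∞, ∀ u, ENNReal.ofReal (Real.exp (-hamiltonian V (setHeight x k u)) / Z) =
      a * ENNReal.ofReal (rho V (x.1 (left k)) (x.1 (right k)) u) := by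
  obtain ⟨h, hh⟩ := exists_hamiltonian_setHeight V x k
  have hI := hV.integral_rhoWeight_pos (x.1 (left k)) (x.1 (right k))
  refine ⟨ENNReal.ofReal (Real.exp (-h) / Z * ∫ s, rhoWeight V (x.1 (left k)) (x.1 (right k)) s),
    fun u => ?_⟩
  rw [← ENNReal.ofReal_mul (by positivity), hh, rho_eq, rhoWeight,
    show -(h + (V (u - x.1 (left k)) + V (x.1 (right k) - u))) =
      -h + (-V (u - x.1 (left k)) - V (x.1 (right k) - u)) by ring, Real.exp_add]
  congr 1
  field_simp

/-- The equilibrium measure is invariant under resampling. -/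
theorem IsConfining.lintegral_heatOp_equilibrium (hV : IsConfining V) (k : Fin (N - 1))
    {f : Interface N → ℝ≥0∞} (hf : Measurable f) :
    ∫⁻ x, heatOp V k f x ∂(equilibrium V N) = ∫⁻ x, f x ∂(equilibrium V N) := by
  set Z := ∫ z, Real.exp (-hamiltonian V z) ∂(lebesgue N) with hZ
  have hZ0 : 0 ≤ Z := integral_nonneg fun _ => (Real.exp_pos _).le
  set W : Interface N → ℝ≥0∞ := fun x => ENNReal.ofReal (Real.exp (-hamiltonian V x) / Z) with hW
  have hWm : Measurable W := ((measurable_hamiltonian hV.measurable).neg.exp.div_const _).ennreal_ofReal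
  have hm := measurable_heatOp hV k hf
  rw [equilibrium, lintegral_withDensity_eq_lintegral_mul _ hWm hm,
    lintegral_withDensity_eq_lintegral_mul _ hWm hf, lebesgue,
    lintegral_map (hWm.mul hm) measurable_ofHeights,
    lintegral_map (hWm.mul hf) measurable_ofHeights]
  -- It suffices to compare the integrals over the k-th height alone: there `heatOp V k f` is
  -- constant and the density is a multiple of a probability density.
  refine lintegral_eq_of_lmarginal_eq {k} ((hWm.mul hm).comp measurable_ofHeights)
    ((hWm.mul hf).comp measurable_ofHeights) ?_
  rw [lmarginal_singleton, lmarginal_singleton]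
  funext y
  simp only [Pi.mul_apply, hW, ofHeights_update, heatOp_setHeight]
  generalize ofHeights y = x
  obtain ⟨a, ha⟩ := hV.exists_density_setHeight Z hZ0 x k
  have hρ := measurable_rho_right hV.measurable (x.1 (left k)) (x.1 (right k))
  have hsx := measurable_setHeight_right x k
  simp only [ha]
  rw [lintegral_mul_const _ (by fun_prop), lintegral_const_mul _ (by fun_prop), hV.lintegral_rho,
    mul_one, heatOp_eq V k hf, hV.lintegral_rhoMeasure _ _ (by fun_prop)]
  simp only [mul_assoc]
  rw [lintegral_const_mul _ (by fun_prop)]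

theorem IsConfining.lintegral_wordOp_equilibrium (hV : IsConfining V) {f : Interface N → ℝ≥0∞}
    (hf : Measurable f) (w : List (Fin (N - 1))) :
    ∫⁻ x, wordOp V f w x ∂(equilibrium V N) = ∫⁻ x, f x ∂(equilibrium V N) := by
  induction w with
  | nil => rfl
  | cons k w ih => exact (hV.lintegral_heatOp_equilibrium k (measurable_wordOp hV hf w)).trans ih

/-- By invariance the interface is in equilibrium at each visit, and a word has at most one last
visit per site, so τ is paid at most once per site whatever the length of the word. -/
theorem IsConfining.lintegral_wordDefect_le (hV : IsConfining V) {R : ℝ} {τ : ℝ≥0∞}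
    (hτ : ∀ k, equilibrium V N {y | R < |y.1 (right k) - y.1 (left k)|} ≤ τ)
    (w : List (Fin (N - 1))) :
    ∫⁻ y, wordDefect V R w y ∂(equilibrium V N) ≤ ((N - 1 : ℕ) : ℝ≥0∞) * τ := by
  have key : ∫⁻ y, wordDefect V R w y ∂(equilibrium V N) ≤ (w.toFinset.card : ℝ≥0∞) * τ := by
    induction w with
    | nil => simp [wordDefect]
    | cons k w ih =>
      have hm := measurable_wordDefect hV R w
      by_cases hk : k ∈ w
      · simp only [wordDefect, hk, if_true, add_zero]
        rw [hV.lintegral_heatOp_equilibrium k hm]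
        simpa [hk] using ih
      · simp only [wordDefect, hk, if_false]
        rw [lintegral_add_left (measurable_heatOp hV k hm), hV.lintegral_heatOp_equilibrium k hm,
          lintegral_indicator_one (measurableSet_increment R k), List.toFinset_cons,
          Finset.card_insert_of_notMem (by simpa using hk)]
        push_cast
        rw [add_mul, one_mul]
        exact add_le_add ih (hτ k)
  refine key.trans ?_
  gcongr
  exact (Finset.card_le_univ _).trans (by simp)

theorem lintegral_resampleSum_iterate (hV : IsConfining V) {f : Interface N → ℝ≥0∞}
    (hf : Measurable f) (n : ℕ) (ν : Measure (Interface N)) :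
    ∫⁻ x, f x ∂((resampleSum V)^[n] ν) = wordSum n fun w => ∫⁻ x, wordOp V f w x ∂ν := by
  induction n generalizing ν with
  | zero => rfl
  | succ n ih =>
    rw [Function.iterate_succ_apply, ih, wordSum]
    have h : ∀ w, ∫⁻ x, wordOp V f w x ∂(resampleSum V ν) =
        ∑ k, ∫⁻ x, wordOp V f (k :: w) x ∂ν := fun w => by
      rw [resampleSum, lintegral_finsetSum_measure]
      exact Finset.sum_congr rfl fun k _ =>
        Measure.lintegral_bind (measurable_resampleAt hV.measurable k).aemeasurable
          (measurable_wordOp hV hf w).aemeasurable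
    simp only [h]
    exact wordSum_sum _ _ _

end invariance

/-! ### Averaging over initial couplings and words -/

section coupling

variable {V : ℝ → ℝ} {N : ℕ} {ν : Measure (Interface N)} {γ : Measure (Interface N × Interface N)}

/-- For a word visiting all sites, `wordOp_le` applies with no condition on the initial pair and is
integrated against γ. Any other word is bounded trivially by 1, charged once for every missed site.
-/
theorem lintegral_wordOp_le [IsProbabilityMeasure ν] (hV : IsConfining V) {R c : ℝ} (hc : 0 ≤ c)
    (hR : ∀ b d b' d' : ℝ, |d' - b'| ≤ R →
      ∫⁻ u, ENNReal.ofReal (rho V b d u - rho V b' d' u) ≤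
        ENNReal.ofReal (c * (|b - b'| + |d - d'|)))
    {τ : ℝ≥0∞} (hτ : ∀ k, equilibrium V N {y | R < |y.1 (right k) - y.1 (left k)|} ≤ τ)
    (hfst : γ.map Prod.fst = ν) (hsnd : γ.map Prod.snd = equilibrium V N)
    {f : Interface N → ℝ≥0∞} (hf : Measurable f) (hf1 : ∀ x, f x ≤ 1) (w : List (Fin (N - 1))) :
    ∫⁻ x, wordOp V f w x ∂ν ≤ (∫⁻ x, f x ∂(equilibrium V N)) +
      (∑ k, ENNReal.ofReal (wordWeight c w (site k)) *
        ∫⁻ p, ENNReal.ofReal |p.1.1 (site k) - p.2.1 (site k)| ∂γ) +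
      ((N - 1 : ℕ) : ℝ≥0∞) * τ + ∑ k, if k ∈ w then 0 else 1 := by
  have hγ : γ Set.univ = 1 := by
    have : ν Set.univ = 1 := measure_univ
    rwa [← hfst, Measure.map_apply measurable_fst .univ, Set.preimage_univ] at this
  have hwm := measurable_wordOp hV hf w
  have hdm := measurable_wordDefect hV R w
  have hh : ∀ i : Fin (N + 1), Measurable fun p : Interface N × Interface N =>
      ENNReal.ofReal |p.1.1 i - p.2.1 i| := fun i =>
    (((measurable_height i).comp measurable_fst).sub
      ((measurable_height i).comp measurable_snd)).norm.ennreal_ofReal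
  set S : Interface N × Interface N → ℝ≥0∞ := fun p =>
    ∑ k, ENNReal.ofReal (wordWeight c w (site k)) *
      ENNReal.ofReal |p.1.1 (site k) - p.2.1 (site k)| with hS
  have hSm : Measurable S := Finset.measurable_sum _ fun k _ => (hh _).const_mul _
  have hpt : ∀ p : Interface N × Interface N, wordOp V f w p.1 ≤
      wordOp V f w p.2 + S p + wordDefect V R w p.2 + ∑ k, if k ∈ w then 0 else 1 := by
    intro p
    by_cases hw : ∃ k, k ∉ w
    · obtain ⟨k, hk⟩ := hw
      refine (wordOp_le_one V hf1 w p.1).trans (le_trans ?_ le_add_self)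
      refine le_trans ?_ (Finset.single_le_sum (f := fun k => if k ∈ w then (0 : ℝ≥0∞) else 1)
        (fun _ _ => zero_le) (Finset.mem_univ k))
      simp [hk]
    · push Not at hw
      refine (wordOp_le hV hc hR hf hf1 w p.1 p.2 fun k hk => absurd (hw k) hk).trans
        (le_trans (le_of_eq ?_) le_self_add)
      congr 2
      rw [sum_eq_sum_site _ (by simp [p.1.2.1, p.2.2.1]) (by simp [p.1.2.2, p.2.2.2]),
        ENNReal.ofReal_sum_of_nonneg fun k _ =>
          mul_nonneg (wordWeight_nonneg hc w _) (abs_nonneg _)]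
      exact Finset.sum_congr rfl fun k _ => ENNReal.ofReal_mul (wordWeight_nonneg hc w _)
  have e1 : ∫⁻ p, S p ∂γ = ∑ k, ENNReal.ofReal (wordWeight c w (site k)) *
        ∫⁻ p, ENNReal.ofReal |p.1.1 (site k) - p.2.1 (site k)| ∂γ := by
    rw [hS, lintegral_finsetSum _ fun k _ => (hh _).const_mul _]
    exact Finset.sum_congr rfl fun k _ => lintegral_const_mul _ (hh _)
  calc ∫⁻ x, wordOp V f w x ∂ν = ∫⁻ p, wordOp V f w p.1 ∂γ := by
        rw [← hfst, lintegral_map hwm measurable_fst]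
    _ ≤ ∫⁻ p, (wordOp V f w p.2 + S p + wordDefect V R w p.2 +
          ∑ k, if k ∈ w then 0 else 1) ∂γ := lintegral_mono hpt
    _ = (∫⁻ p, wordOp V f w p.2 ∂γ) + (∫⁻ p, S p ∂γ) + (∫⁻ p, wordDefect V R w p.2 ∂γ) +
          ∑ k, if k ∈ w then 0 else 1 := by
        rw [lintegral_add_right _ measurable_const, lintegral_add_right _ (by fun_prop),
          lintegral_add_right _ hSm, lintegral_const, hγ, mul_one]
    _ ≤ _ := by
        rw [← lintegral_map hwm measurable_snd, ← lintegral_map hdm measurable_snd, hsnd, e1,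
          hV.lintegral_wordOp_equilibrium hf w]
        gcongr
        exact hV.lintegral_wordDefect_le hτ w

/-- Summation over words turns the weights into `totalWeight`, which Cauchy–Schwarz separates from
the expected discrepancies; each site is missed by (N - 2)^n words. -/
theorem lintegral_iterate_le [IsProbabilityMeasure ν] (hV : IsConfining V) {R c : ℝ} (hc : 0 ≤ c)
    (hR : ∀ b d b' d' : ℝ, |d' - b'| ≤ R →
      ∫⁻ u, ENNReal.ofReal (rho V b d u - rho V b' d' u) ≤
        ENNReal.ofReal (c * (|b - b'| + |d - d'|)))
    {τ : ℝ≥0∞} (hτ : ∀ k, equilibrium V N {y | R < |y.1 (right k) - y.1 (left k)|} ≤ τ)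
    (hfst : γ.map Prod.fst = ν) (hsnd : γ.map Prod.snd = equilibrium V N)
    {f : Interface N → ℝ≥0∞} (hf : Measurable f) (hf1 : ∀ x, f x ≤ 1) (n : ℕ) :
    ∫⁻ x, f x ∂((resampleSum V)^[n] ν) ≤
      ((N - 1 : ℕ) : ℝ≥0∞) ^ n *
        ((∫⁻ x, f x ∂(equilibrium V N)) + ((N - 1 : ℕ) : ℝ≥0∞) * τ) +
      ENNReal.ofReal √(∑ j : Fin (N - 1), totalWeight c n j ^ 2) *
        (∑ k : Fin (N - 1),
          (∫⁻ p, ENNReal.ofReal |p.1.1 (site k) - p.2.1 (site k)| ∂γ) ^ 2) ^ (1 / 2 : ℝ) +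
      ((N - 1 - 1 : ℕ) : ℝ≥0∞) ^ n * ((N - 1 : ℕ) : ℝ≥0∞) := by
  set E : Fin (N - 1) → ℝ≥0∞ := fun k =>
    ∫⁻ p, ENNReal.ofReal |p.1.1 (site k) - p.2.1 (site k)| ∂γ with hE
  have hw0 : ∀ j : Fin (N - 1), 0 ≤ totalWeight c n j := fun j =>
    wordSum_nonneg n fun w => wordWeight_nonneg hc w _
  have hCS : ∑ k, ENNReal.ofReal (totalWeight c n k) * E k ≤
      ENNReal.ofReal √(∑ j : Fin (N - 1), totalWeight c n j ^ 2) *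
        (∑ k, E k ^ 2) ^ (1 / 2 : ℝ) := by
    refine (ENNReal.inner_le_Lp_mul_Lq Finset.univ _ _ Real.HolderConjugate.two_two).trans
      (le_of_eq ?_)
    simp only [ENNReal.rpow_two]
    rw [Real.sqrt_eq_rpow, ← ENNReal.ofReal_rpow_of_nonneg
      (Finset.sum_nonneg fun j _ => sq_nonneg _) (by norm_num),
      ENNReal.ofReal_sum_of_nonneg fun j _ => sq_nonneg _]
    simp only [ENNReal.ofReal_pow (hw0 _)]
  rw [lintegral_resampleSum_iterate hV hf]
  refine (wordSum_mono n fun w => lintegral_wordOp_le hV hc hR hτ hfst hsnd hf hf1 w).trans ?_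
  rw [wordSum_add, wordSum_add, wordSum_add, wordSum_const, wordSum_const, wordSum_sum, wordSum_sum]
  simp only [wordSum_notMem, Fintype.card_fin, mul_one, Finset.sum_const, Finset.card_univ,
    nsmul_eq_mul]
  have h2 : ∀ k : Fin (N - 1), wordSum n (fun w => ENNReal.ofReal (wordWeight c w (site k)) * E k) =
      ENNReal.ofReal (totalWeight c n k) * E k := fun k => by
    simp only [mul_comm _ (E k), wordSum_mul]
    rw [wordSum_ofReal n fun w => wordWeight_nonneg hc w _]
    rfl
  simp only [hE] at h2
  simp only [h2]
  calc _ ≤ ((N - 1 : ℕ) : ℝ≥0∞) ^ n * (∫⁻ x, f x ∂(equilibrium V N)) +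
        ENNReal.ofReal √(∑ j : Fin (N - 1), totalWeight c n j ^ 2) *
        (∑ k, E k ^ 2) ^ (1 / 2 : ℝ) + ((N - 1 : ℕ) : ℝ≥0∞) ^ n * (((N - 1 : ℕ) : ℝ≥0∞) * τ) +
        ((N - 1 : ℕ) : ℝ≥0∞) * ((N - 1 - 1 : ℕ) : ℝ≥0∞) ^ n := by gcongr
    _ = _ := by ring

end coupling

/-! ### Poisson averages -/

section poisson

variable {a t r : ℝ}

theorem tsum_poisson_mul_pow (a : ℝ) (ht : 0 ≤ t) (hr : 0 ≤ r) :
    ∑' n : ℕ, ENNReal.ofReal (Real.exp (-a) * (t ^ n / n.factorial)) * ENNReal.ofReal r ^ n =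
      ENNReal.ofReal (Real.exp (r * t - a)) := by
  have h : HasSum (fun n : ℕ => Real.exp (-a) * ((r * t) ^ n / n.factorial))
      (Real.exp (-a) * Real.exp (r * t)) := by
    rw [Real.exp_eq_exp_ℝ]
    exact (NormedSpace.expSeries_div_hasSum_exp (r * t)).mul_left _
  rw [show r * t - a = -a + r * t by ring, Real.exp_add, ← h.tsum_eq,
    ENNReal.ofReal_tsum_of_nonneg (fun n => by positivity) h.summable]
  refine tsum_congr fun n => ?_
  rw [← ENNReal.ofReal_pow hr, ← ENNReal.ofReal_mul (by positivity), mul_pow]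
  congr 1
  ring

/-- The factor n + 1 cancels against (n + 1)!, shifting the Poisson weights by one index and leaving
a factor t. -/
theorem tsum_poisson_mul_le (a : ℝ) (ht : 0 ≤ t) (hr : 0 ≤ r) {d : ℝ} (hd : 0 ≤ d)
    {b : ℕ → ℝ} (h0 : b 0 = 0) (hb : ∀ n, b (n + 1) ≤ (n + 1) * r ^ n * d) :
    ∑' n : ℕ, ENNReal.ofReal (Real.exp (-a) * (t ^ n / n.factorial)) * ENNReal.ofReal (b n) ≤
      ENNReal.ofReal (d * t * Real.exp (r * t - a)) := by
  rw [tsum_eq_zero_add' ENNReal.summable, h0, ENNReal.ofReal_zero, mul_zero, zero_add,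
    ENNReal.ofReal_mul (by positivity), ← tsum_poisson_mul_pow a ht hr, ← ENNReal.tsum_mul_left]
  refine ENNReal.tsum_le_tsum fun n => ?_
  rw [← ENNReal.ofReal_pow hr, ← ENNReal.ofReal_mul (by positivity),
    ← ENNReal.ofReal_mul (by positivity), ← ENNReal.ofReal_mul (by positivity)]
  refine ENNReal.ofReal_le_ofReal ?_
  calc Real.exp (-a) * (t ^ (n + 1) / (n + 1).factorial) * b (n + 1)
      ≤ Real.exp (-a) * (t ^ (n + 1) / (n + 1).factorial) * ((n + 1) * r ^ n * d) := by
        gcongr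
        exact hb n
    _ = _ := by
        have : (n.factorial : ℝ) ≠ 0 := by positivity
        have : (n : ℝ) + 1 ≠ 0 := by positivity
        rw [Nat.factorial_succ]
        push_cast
        field_simp
        ring

end poisson

/-! ### Conclusion -/

section main

variable {V : ℝ → ℝ} {N : ℕ} {ν : Measure (Interface N)} {γ : Measure (Interface N × Interface N)}

/-- The heat bath dynamics started from `ν`, compared with equilibrium through a coupling `γ`. -/
theorem lawAt_apply_le [IsProbabilityMeasure ν] (hN : 2 ≤ N) (hV : IsConfining V) {R c : ℝ}
    (hc : 0 ≤ c)
    (hR : ∀ b d b' d' : ℝ, |d' - b'| ≤ R →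
      ∫⁻ u, ENNReal.ofReal (rho V b d u - rho V b' d' u) ≤
        ENNReal.ofReal (c * (|b - b'| + |d - d'|)))
    {τ : ℝ≥0∞} (hτ : ∀ k, equilibrium V N {y | R < |y.1 (right k) - y.1 (left k)|} ≤ τ)
    (hfst : γ.map Prod.fst = ν) (hsnd : γ.map Prod.snd = equilibrium V N)
    {t : ℝ} (ht : 0 ≤ t) {B : Set (Interface N)} (hB : MeasurableSet B) :
    lawAt V ν t B ≤ equilibrium V N B + ((N - 1 : ℕ) : ℝ≥0∞) * τ +
      ENNReal.ofReal (2 * c * √N * t * Real.exp (-(gapValue N * t))) *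
        (∑ k : Fin (N - 1),
          (∫⁻ p, ENNReal.ofReal |p.1.1 (site k) - p.2.1 (site k)| ∂γ) ^ 2) ^ (1 / 2 : ℝ) +
      ENNReal.ofReal (Real.exp (-t)) * ((N - 1 : ℕ) : ℝ≥0∞) := by
  set cost := (∑ k : Fin (N - 1),
          (∫⁻ p, ENNReal.ofReal |p.1.1 (site k) - p.2.1 (site k)| ∂γ) ^ 2) ^ (1 / 2 : ℝ) with hcost
  set m : ℝ := ((N - 1 : ℕ) : ℝ) with hm
  have hm0 : 0 ≤ m := Nat.cast_nonneg _
  set f : Interface N → ℝ≥0∞ := B.indicator 1 with hf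
  have hfm : Measurable f := measurable_one.indicator hB
  have hf1 : ∀ x, f x ≤ 1 := fun x => Set.indicator_le (fun _ _ => le_rfl) x
  have hfπ : ∫⁻ x, f x ∂(equilibrium V N) = equilibrium V N B := lintegral_indicator_one hB
  have hgap : gapValue N ≤ 1 := by
    rw [gapValue]
    have : 0 ≤ Real.cos (Real.pi / N) := by
      refine Real.cos_nonneg_of_neg_pi_div_two_le_of_le ?_ ?_
      · have := Real.pi_pos
        have : 0 ≤ Real.pi / N := by positivity
        linarith
      · exact div_le_div_of_nonneg_left Real.pi_pos.le (by norm_num) (by exact_mod_cast hN)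
    linarith
  have hm1 : m = ((N - 1 - 1 : ℕ) : ℝ) + 1 := by
    rw [hm, show N - 1 = N - 1 - 1 + 1 by omega]; push_cast; simp
  have hr : 0 ≤ m - gapValue N := by
    have : (0 : ℝ) ≤ ((N - 1 - 1 : ℕ) : ℝ) := Nat.cast_nonneg _
    linarith
  -- Against Poisson weights of mean mt, the growth rates m, m - 1 and m - λ_N give 1, e^{-t} and t
  -- e^{-λ_N t} respectively, the last up to the constant 2c√N.
  have e1 := tsum_poisson_mul_pow (m * t) ht hm0
  have e2 := tsum_poisson_mul_pow (m * t) ht (Nat.cast_nonneg (α := ℝ) (N - 1 - 1))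
  have e3 := tsum_poisson_mul_le (m * t) ht hr (by positivity : 0 ≤ 2 * c * √N)
    (b := fun n => √(∑ j : Fin (N - 1), totalWeight c n j ^ 2))
    (by simp [totalWeight, wordSum, wordWeight]) (sqrt_sum_sq_totalWeight_le hN hc)
  rw [sub_self, Real.exp_zero, ENNReal.ofReal_one, hm, ENNReal.ofReal_natCast, ← hm] at e1
  rw [ENNReal.ofReal_natCast, show ((N - 1 - 1 : ℕ) : ℝ) * t - m * t = -t by rw [hm1]; ring] at e2
  rw [show (m - gapValue N) * t - m * t = -(gapValue N * t) by ring] at e3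
  calc lawAt V ν t B = ∑' n : ℕ, ENNReal.ofReal (Real.exp (-(m * t)) * (t ^ n / n.factorial)) *
        ∫⁻ x, f x ∂((resampleSum V)^[n] ν) := by
        rw [lawAt, Measure.sum_apply _ hB]
        refine tsum_congr fun n => ?_
        rw [Measure.smul_apply, smul_eq_mul, lintegral_indicator_one hB]
    _ ≤ ∑' n : ℕ, (ENNReal.ofReal (Real.exp (-(m * t)) * (t ^ n / n.factorial)) *
          ((N - 1 : ℕ) : ℝ≥0∞) ^ n * (equilibrium V N B + ((N - 1 : ℕ) : ℝ≥0∞) * τ) +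
        ENNReal.ofReal (Real.exp (-(m * t)) * (t ^ n / n.factorial)) *
          ENNReal.ofReal √(∑ j : Fin (N - 1), totalWeight c n j ^ 2) * cost +
        ENNReal.ofReal (Real.exp (-(m * t)) * (t ^ n / n.factorial)) *
          ((N - 1 - 1 : ℕ) : ℝ≥0∞) ^ n * ((N - 1 : ℕ) : ℝ≥0∞)) := by
        refine ENNReal.tsum_le_tsum fun n => ?_
        refine (mul_le_mul_right (lintegral_iterate_le hV hc hR hτ hfst hsnd hfm hf1 n) _).trans
          (le_of_eq ?_)
        rw [hfπ, hcost]
        ring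
    _ ≤ _ := by
        rw [ENNReal.tsum_add, ENNReal.tsum_add, ENNReal.tsum_mul_right, ENNReal.tsum_mul_right,
          ENNReal.tsum_mul_right, e1, e2, one_mul]
        gcongr

theorem IsConfining.exists_tvDist_le (hV : IsConfining V) :
    ∃ C : ℝ, 0 < C ∧ ∀ N : ℕ, 2 ≤ N → ∀ ν : Measure (Interface N), IsProbabilityMeasure ν →
      ∀ t : ℝ, C * Real.log N ≤ t →
        tvDist (lawAt V ν t) (equilibrium V N) ≤
          ENNReal.ofReal C *
            (ENNReal.ofReal ((N : ℝ) ^ (1 / 2 : ℝ)) * couplingCost V ν *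
                ENNReal.ofReal (t ^ C * Real.exp (-(gapValue N * t))) +
              ENNReal.ofReal (N * Real.exp (-t))) := by
  obtain ⟨A, hA, hτ⟩ := hV.exists_equilibrium_tail
  obtain ⟨C₁, hC₁, K, hρ⟩ := hV.exists_lintegral_rho_sub_le
  set D : ℝ := 2 * C₁ * (1 + 10 * A) ^ K with hD
  have hD0 : 0 ≤ D := by positivity
  -- D is the prefactor after 1 + R ≤ (1 + 10A)t, and K + 1 is the power of t it comes with. The 5
  -- counts 4N e^{-t} from large increments and N e^{-t} from missed sites, and also ensures t ≥ 5
  -- log 2 ≥ 1.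
  set C : ℝ := D + K + 5 with hC
  have hK0 : (0 : ℝ) ≤ K := Nat.cast_nonneg _
  have hC0 : 0 < C := by positivity
  refine ⟨C, hC0, fun N hN ν hν t ht => ?_⟩
  have hN2 : (2 : ℝ) ≤ N := by exact_mod_cast hN
  have hN0 : (0 : ℝ) < N := by linarith
  have ht1 : 1 ≤ t := by
    have h1 : Real.log 2 ≤ Real.log N := Real.log_le_log (by norm_num) hN2
    have h2 := Real.log_two_gt_d9
    nlinarith
  have ht0 : 0 < t := by linarith
  -- The threshold R grows linearly in t: large increments then have probability at most 4e^{-t},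
  -- while the Lipschitz constant stays polynomial in t.
  set j := ⌈t⌉₊ with hj
  set R := 2 * (A + 2 * A * j) with hR
  have hj1 : t ≤ j := Nat.le_ceil t
  have hj2 : (j : ℝ) ≤ 2 * t := by
    have := Nat.ceil_lt_add_one ht0.le
    linarith
  have hR0 : 0 ≤ R := by positivity
  set c := C₁ * (1 + R) ^ K with hc
  have hc0 : 0 ≤ c := by positivity
  have hct : 2 * c * t ≤ D * t ^ C := by
    have h1 : 1 + R ≤ (1 + 10 * A) * t := by
      rw [hR]; nlinarith
    calc 2 * c * t ≤ 2 * (C₁ * ((1 + 10 * A) * t) ^ K) * t := by rw [hc]; gcongr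
      _ = D * t ^ (K + 1) := by rw [mul_pow, pow_succ, hD]; ring
      _ ≤ D * t ^ C := by
        gcongr
        rw [← Real.rpow_natCast]
        refine Real.rpow_le_rpow_of_exponent_le ht1 ?_
        push_cast
        linarith
  have hDC : D ≤ C := by linarith
  have htv : ∀ γ : {γ : Measure (Interface N × Interface N) //
      γ.map Prod.fst = ν ∧ γ.map Prod.snd = equilibrium V N},
      tvDist (lawAt V ν t) (equilibrium V N) ≤ ENNReal.ofReal C *
        (ENNReal.ofReal ((N : ℝ) ^ (1 / 2 : ℝ)) * (∑ k : Fin (N - 1),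
          (∫⁻ p, ENNReal.ofReal |p.1.1 (site k) - p.2.1 (site k)| ∂γ.1) ^ 2) ^ (1 / 2 : ℝ) *
            ENNReal.ofReal (t ^ C * Real.exp (-(gapValue N * t))) +
          ENNReal.ofReal (N * Real.exp (-t))) := by
    rintro ⟨γ, hfst, hsnd⟩
    refine iSup₂_le fun B hB => tsub_le_iff_left.2 ?_
    refine (lawAt_apply_le hN hV hc0 (hρ R) (fun k => hτ N hN k j) hfst hsnd ht0.le hB).trans ?_
    set cost := (∑ k : Fin (N - 1),
          (∫⁻ p, ENNReal.ofReal |p.1.1 (site k) - p.2.1 (site k)| ∂γ) ^ 2) ^ (1 / 2 : ℝ)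
    rw [add_assoc, add_assoc]
    refine add_le_add le_rfl ?_
    have hmN : ((N - 1 : ℕ) : ℝ) ≤ N := by exact_mod_cast Nat.sub_le N 1
    have h1 : ((N - 1 : ℕ) : ℝ≥0∞) * ENNReal.ofReal (4 * Real.exp (-j)) +
        ENNReal.ofReal (Real.exp (-t)) * ((N - 1 : ℕ) : ℝ≥0∞) ≤
          ENNReal.ofReal C * ENNReal.ofReal (N * Real.exp (-t)) := by
      rw [← ENNReal.ofReal_natCast, ← ENNReal.ofReal_mul (by positivity),
        ← ENNReal.ofReal_mul (by positivity), ← ENNReal.ofReal_mul (by positivity),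
        ← ENNReal.ofReal_add (by positivity) (by positivity)]
      refine ENNReal.ofReal_le_ofReal ?_
      calc ((N - 1 : ℕ) : ℝ) * (4 * Real.exp (-j)) + Real.exp (-t) * ((N - 1 : ℕ) : ℝ)
          ≤ N * (4 * Real.exp (-t)) + Real.exp (-t) * N := by gcongr
        _ = 5 * (N * Real.exp (-t)) := by ring
        _ ≤ C * (N * Real.exp (-t)) := by
          gcongr
          linarith
    have h2 : ENNReal.ofReal (2 * c * √N * t * Real.exp (-(gapValue N * t))) ≤
        ENNReal.ofReal C * ENNReal.ofReal ((N : ℝ) ^ (1 / 2 : ℝ)) *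
          ENNReal.ofReal (t ^ C * Real.exp (-(gapValue N * t))) := by
      rw [← ENNReal.ofReal_mul (by positivity), ← ENNReal.ofReal_mul (by positivity),
        ← Real.sqrt_eq_rpow]
      refine ENNReal.ofReal_le_ofReal ?_
      calc 2 * c * √N * t * Real.exp (-(gapValue N * t))
          = √N * (2 * c * t) * Real.exp (-(gapValue N * t)) := by ring
        _ ≤ √N * (C * t ^ C) * Real.exp (-(gapValue N * t)) := by
          have : 2 * c * t ≤ C * t ^ C := hct.trans (by gcongr)
          gcongr
        _ = _ := by ring
    calc _ = (((N - 1 : ℕ) : ℝ≥0∞) * ENNReal.ofReal (4 * Real.exp (-j)) +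
          ENNReal.ofReal (Real.exp (-t)) * ((N - 1 : ℕ) : ℝ≥0∞)) +
          ENNReal.ofReal (2 * c * √N * t * Real.exp (-(gapValue N * t))) * cost := by ring
      _ ≤ ENNReal.ofReal C * ENNReal.ofReal (N * Real.exp (-t)) +
          ENNReal.ofReal C * ENNReal.ofReal ((N : ℝ) ^ (1 / 2 : ℝ)) *
          ENNReal.ofReal (t ^ C * Real.exp (-(gapValue N * t))) * cost := by gcongr
      _ = _ := by ring
  have hpos : ∀ {x : ℝ}, 0 < x → ENNReal.ofReal x ≠ 0 := fun h =>
    (ENNReal.ofReal_pos.2 h).ne'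
  rw [couplingCost, iInf_subtype', ENNReal.mul_iInf_of_ne (hpos (by positivity)) ENNReal.ofReal_ne_top,
    ENNReal.iInf_mul_of_ne (hpos (by positivity)) ENNReal.ofReal_ne_top, ENNReal.iInf_add,
    ENNReal.mul_iInf_of_ne (hpos hC0) ENNReal.ofReal_ne_top]
  exact le_iInf htv

end main

end GradPhi

theorem proposition4p1 (V : ℝ → ℝ) (hV : GradPhi.IsPotential V) :
    ∃ C : ℝ, 0 < C ∧
      ∀ (N : ℕ), 2 ≤ N →
      ∀ (ν : Measure (GradPhi.Interface N)), IsProbabilityMeasure ν →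
      ∀ (t : ℝ), C * Real.log N ≤ t →
        GradPhi.tvDist (GradPhi.lawAt V ν t) (GradPhi.equilibrium V N) ≤
          ENNReal.ofReal C *
            (ENNReal.ofReal ((N : ℝ) ^ (1 / 2 : ℝ)) * GradPhi.couplingCost V ν *
                ENNReal.ofReal (t ^ C * Real.exp (-(GradPhi.gapValue N * t))) +
              ENNReal.ofReal (N * Real.exp (-t))) := by
  obtain ⟨θ, hθ⟩ := hV.exists_tilt
  simpa only [GradPhi.lawAt_tilt, GradPhi.equilibrium_tilt, GradPhi.couplingCost_tilt] using
    hθ.exists_tvDist_le
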